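/- **Setting.** Let $\Sigma\simeq\mathbb R^3$ carry a $\mathcal C^2$ Riemannian metric $h$ and a continuous symmetric $2$-tensor $\kappa$ (the extrinsic curvature) which outside a compact set $\{|x|<r_0\}$ are those of the slice $\{t=0\}$ of a Schwarzschild spacetime: for $|x|\ge r_0>\max(0,2m)$, $$h=\Big(1-\frac{2m}{|x|}\Big)^{-1}d|x|^2+|x|^2g_{\mathbb S^2},\qquad \kappa=0 .$$ Let $r:\Sigma\to[0,\infty)$ be a continuous function with $r=|x|$ for $|x|\ge r_0$ and $r(x)\ge c\,|x-p|$ for some $c>0$ and some $p\in\Sigma$. Let $\boldsymbol\nabla$, $\mathrm{Ric}$, $\epsilon$ and $\mathrm{dv}$ be the Levi-Civita connection, the Ricci tensor (positive on round spheres), the volume form and the volume measure of $h$, and $\boldsymbol\Delta=h^{ij}\boldsymbol\nabla_i\boldsymbol\nabla_j$ acting on $1$-forms. All fields are $1$-forms: $(\boldsymbol\nabla\times\mathbf A)_i=\epsilon_i{}^{jk}\boldsymbol\nabla_j\mathbf A_k$, $\boldsymbol\nabla\cdot\mathbf A=\boldsymbol\nabla^i\mathbf A_i$ and $(\mathbf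 A\cdot\kappa)_a=\mathbf A_b\kappa_a{}^b$; curl and divergence are taken in the sense of distributions. $L^2(\Sigma)$ is taken with respect to $h$ and $\mathrm{dv}$. $\dot H^1(\Sigma)$ is the completion of the smooth compactly supported $1$-forms in the norm $\|\boldsymbol\nabla\mathbf A\|_{L^2}$, realised as a subspace of $L^2_{\rm loc}(\Sigma)$; $\dot H^{-1}(\Sigma)$ is its dual; and $$\dot H^1_C(\Sigma)^{\rm curl}=\{\mathbf A\in\dot H^1(\Sigma):\boldsymbol\nabla\cdot\mathbf A=0,\ \boldsymbol\nabla\times\mathbf A\in L^2(\Sigma)\}.$$ Let $\delta=\|r^2\,\mathrm{Ric}\|_{L^\infty(\Sigma)}$, where the pointwise norm is $\sup_{|a|_h=1}|\mathrm{Ric}(a,a)|$. For a sign $\sigma\in\{1,-1\}$ put $\mathbf R=\sigma\,\mathrm{Ric}$. **Theorem.** There is a smallest constant $C\ge0$ such that Hardy's inequality $$\int_\Sigma\frac{|\mathbf X|^2}{r^2}\,\mathrm{dv}\le C\int_\Sigma|\boldsymbol\nabla\mathbf X|^2\,\mathrm{dv}$$ holds for all smooth compactly supported $1$-forms $\mathbf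 X$. If $C\delta<1$ for this $C$, then the following hold. 1. For either sign $\sigma$, the operator $-\boldsymbol\Delta-\mathbf R$, defined by $$\langle(-\boldsymbol\Delta-\mathbf R)\mathbf A,\mathbf A'\rangle=\int_\Sigma\big(\langle\boldsymbol\nabla\mathbf A,\boldsymbol\nabla\mathbf A'\rangle-\mathbf R_{ij}\mathbf A^i\mathbf A'^j\big)\,\mathrm{dv},$$ is continuous from $\dot H^1(\Sigma)$ to $\dot H^{-1}(\Sigma)$, it is coercive, $$\langle(-\boldsymbol\Delta-\mathbf R)\mathbf A,\mathbf A\rangle\ge(1-C\delta)\|\mathbf A\|^2_{\dot H^1},\qquad 1-C\delta>0,$$ its kernel in $\dot H^1(\Sigma)$ is trivial, and it is onto $\dot H^{-1}(\Sigma)$. 2. Let $\mathbf P=-\boldsymbol\Delta+\mathrm{Ric}$ (that is, $\sigma=-1$), which equals $\boldsymbol\nabla\times\boldsymbol\nabla\times$ on divergence-free $1$-forms. Then $$\operatorname{Int}:(\mathbf B,\mathbf E)\longmapsto(\mathbf A^{(0)},\mathbf A^{(1)})=\big(\mathbf P^{-1}(\boldsymbol\nabla\times\mathbf B),\ \mathbf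 E+\mathbf A^{(0)}\cdot\kappa\big)$$ is a bijection from $\{\mathbf B\in L^2(\Sigma):\boldsymbol\nabla\cdot\mathbf B=0\}\oplus L^2(\Sigma)$ onto $\dot H^1_C(\Sigma)^{\rm curl}\oplus L^2(\Sigma)$, and $\boldsymbol\nabla\times\mathbf A^{(0)}=\mathbf B$. It restricts to a bijection from the pairs with both $\boldsymbol\nabla\cdot\mathbf B=0$ and $\boldsymbol\nabla\cdot\mathbf E=0$ onto the pairs $(\mathbf A^{(0)},\mathbf A^{(1)})\in\dot H^1_C(\Sigma)^{\rm curl}\oplus L^2(\Sigma)$ with $\boldsymbol\nabla\cdot(\mathbf A^{(1)}-\mathbf A^{(0)}\cdot\kappa)=0$. -/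

import Mathlib

open MeasureTheory Filter Topology
open scoped ENNReal ContDiff

noncomputable section

/-- The global coordinate chart of the initial surface `Σ ≃ ℝ³`. -/
abbrev Chart := EuclideanSpace ℝ (Fin 3)

/-- Components of a `1`-form at a point. -/
abbrev Cov := Fin 3 → ℝ

/-- Components of a covariant `2`-tensor at a point. -/
abbrev Ten := Fin 3 → Fin 3 → ℝ

/-- `1`-forms on `Σ` with measurable components, modulo equality almost everywhere. -/
abbrev FormField := Chart →ₘ[(volume : Measure Chart)] Cov

/-- Covariant `2`-tensors on `Σ` with measurable components, modulo equality almost everywhere. -/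
abbrev TensorField := Chart →ₘ[(volume : Measure Chart)] Ten

/-- The partial derivative `∂ᵢ f`. -/
def pd (i : Fin 3) (f : Chart → ℝ) (x : Chart) : ℝ :=
  fderiv ℝ f x (EuclideanSpace.single i 1)

/-- The initial surface `Σ ≃ ℝ³`: a Riemannian metric `h` and an extrinsic curvature `κ`
(a symmetric covariant `2`-tensor) which outside a compact set are those of the slice `{t = 0}` of
the Schwarzschild spacetime, i.e. `h = (1 - 2m/r)⁻¹ dr² + r² g_{S²}` and `κ = 0` for `r ≥ r₀`,
where `r = |x|`. -/
structure InitialSurface where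
  h : Chart → Matrix (Fin 3) (Fin 3) ℝ
  κ : Chart → Matrix (Fin 3) (Fin 3) ℝ
  m : ℝ
  r₀ : ℝ
  h_contDiff : ∀ i j, ContDiff ℝ 2 (fun x => h x i j)
  h_posDef : ∀ x, (h x).PosDef
  κ_continuous : ∀ i j, Continuous (fun x => κ x i j)
  κ_symm : ∀ x, (κ x).IsSymm
  r₀_pos : 0 < r₀
  horizon_lt : 2 * m < r₀
  h_schwarzschild : ∀ x : Chart, r₀ ≤ ‖x‖ → ∀ i j,
    h x i j = (if i = j then 1 else 0)
      + ((1 - 2 * m / ‖x‖)⁻¹ - 1) * (x i / ‖x‖) * (x j / ‖x‖)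
  κ_schwarzschild : ∀ x : Chart, r₀ ≤ ‖x‖ → κ x = 0

namespace InitialSurface

variable (S : InitialSurface)

/-- A function `r` on `Σ` extending the Schwarzschild radius; it may vanish (at most linearly)
at one point. -/
structure IsRadius (r : Chart → ℝ) : Prop where
  continuous : Continuous r
  lower_bound : ∃ c : ℝ, 0 < c ∧ ∃ p : Chart, ∀ x, c * ‖x - p‖ ≤ r x
  eq_norm : ∀ x, S.r₀ ≤ ‖x‖ → r x = ‖x‖

/-! ### Riemannian geometry of `h` -/

/-- The inverse metric `h^{ij}`. -/
def hinv (x : Chart) (i j : Fin 3) : ℝ := (S.h x)⁻¹ i j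

/-- The Riemannian volume density. -/
def sqrtDet (x : Chart) : ℝ := Real.sqrt (S.h x).det

/-- The Riemannian volume measure of `h`. -/
def vol : Measure Chart :=
  (volume : Measure Chart).withDensity (fun x => ENNReal.ofReal (S.sqrtDet x))

/-- Christoffel symbols `Γ^k_{ij}`. -/
def christoffel (k i j : Fin 3) (x : Chart) : ℝ :=
  (1 / 2) * ∑ l, S.hinv x k l *
    (pd i (fun y => S.h y j l) x + pd j (fun y => S.h y i l) x - pd l (fun y => S.h y i j) x)

/-- The Ricci tensor `Ric_{ij}` of `h`, with the sign that makes it positive on round spheres. -/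
def ricci (i j : Fin 3) (x : Chart) : ℝ :=
  ∑ k, (pd k (S.christoffel k i j) x - pd j (S.christoffel k i k) x)
    + ∑ k, ∑ l, (S.christoffel k k l x * S.christoffel l i j x
        - S.christoffel k j l x * S.christoffel l i k x)

/-- Raising the index of a `1`-form: `a^i = h^{ij} a_j`. -/
def raise (x : Chart) (a : Cov) (i : Fin 3) : ℝ := ∑ j, S.hinv x i j * a j

/-- The inner product of `1`-forms, `h^{ij} a_i b_j`. -/
def ip (x : Chart) (a b : Cov) : ℝ := ∑ i, ∑ j, S.hinv x i j * a i * b j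

/-- The inner product of covariant `2`-tensors, `h^{ik} h^{jl} T_{ij} U_{kl}`. -/
def ip₂ (x : Chart) (T U : Ten) : ℝ :=
  ∑ i, ∑ j, ∑ k, ∑ l, S.hinv x i k * S.hinv x j l * T i j * U k l

/-- `Ric_{ij} a^i b^j` for `1`-forms `a`, `b`. -/
def ricForm (x : Chart) (a b : Cov) : ℝ :=
  ∑ i, ∑ j, S.ricci i j x * S.raise x a i * S.raise x b j

/-- The pointwise (operator) norm of the Ricci tensor with respect to `h`. -/
def ricNorm (x : Chart) : ℝ≥0∞ :=
  ⨆ (a : Cov) (_ : S.ip x a a = 1), ENNReal.ofReal |S.ricForm x a a|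

/-- `δ = ‖r² R‖_{L^∞(Σ)}`. -/
def curvatureSize (r : Chart → ℝ) : ℝ≥0∞ :=
  essSup (fun x => ENNReal.ofReal (r x ^ 2) * S.ricNorm x) S.vol

/-- The covariant derivative `(∇A)_{ij} = ∂_i A_j - Γ^k_{ij} A_k` of a differentiable `1`-form. -/
def covDeriv (A : Chart → Cov) (x : Chart) : Ten := fun i j =>
  pd i (fun y => A y j) x - ∑ k, S.christoffel k i j x * A x k

/-- The permutation symbol `[ijk]`. -/
def perm (i j k : Fin 3) : ℝ :=
  (((j : ℕ) : ℝ) - ((i : ℕ) : ℝ)) * (((k : ℕ) : ℝ) - ((i : ℕ) : ℝ))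
    * (((k : ℕ) : ℝ) - ((j : ℕ) : ℝ)) / 2

/-- `ε_i^{jk} T_{jk} = h_{il} ε^{ljk} T_{jk}`, where the volume form with upper indices is
`ε^{ljk} = [ljk] / √det h`. -/
def epsContract (x : Chart) (T : Ten) : Cov := fun i =>
  ∑ l, ∑ j, ∑ k, S.h x i l * (perm l j k / S.sqrtDet x) * T j k

/-- The curl `(∇ × A)_i = ε_i^{jk} ∇_j A_k` of a differentiable `1`-form. -/
def curl (A : Chart → Cov) (x : Chart) : Cov := S.epsContract x (S.covDeriv A x)

/-- `(A·κ)_a = A_b κ_a^b`. -/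
def dotκ (x : Chart) (a : Cov) : Cov := fun i => ∑ b, S.raise x a b * S.κ x i b

/-! ### Function spaces -/

/-- Smooth compactly supported `1`-forms. -/
def testForms : Submodule ℝ (Chart → Cov) where
  carrier := {X | ContDiff ℝ ∞ X ∧ HasCompactSupport X}
  add_mem' := fun hA hB => ⟨hA.1.add hB.1, hA.2.add hB.2⟩
  zero_mem' := ⟨contDiff_const, HasCompactSupport.zero⟩
  smul_mem' := fun c _ hA => ⟨contDiff_const.smul hA.1, hA.2.smul_left (f := fun _ => c)⟩

/-- `L²(Σ)` (square integrable `1`-forms). -/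
def L2 : Set FormField := {A | ∫⁻ x, ENNReal.ofReal (S.ip x (A x) (A x)) ∂S.vol < ⊤}

/-- `IsH1 A G`: `A` lies in `Ḣ¹(Σ)`, the completion of the smooth compactly supported `1`-forms
in the norm `‖∇·‖_{L²}`, realised as a space of locally square integrable `1`-forms, and its
covariant derivative is `G`. -/
def IsH1 (A : FormField) (G : TensorField) : Prop :=
  ∃ φ : ℕ → testForms,
    Tendsto (fun n => ∫⁻ x, ENNReal.ofReal
      (S.ip₂ x (S.covDeriv (φ n) x - G x) (S.covDeriv (φ n) x - G x)) ∂S.vol) atTop (𝓝 0) ∧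
    ∀ K : Set Chart, IsCompact K →
      Tendsto (fun n => ∫⁻ x in K, ENNReal.ofReal
        (S.ip x ((φ n : Chart → Cov) x - A x) ((φ n : Chart → Cov) x - A x)) ∂S.vol)
        atTop (𝓝 0)

/-- `‖G‖²_{L²}`; for `G = ∇A` this is `‖A‖²_{Ḣ¹}`. -/
def normSq₂ (G : Chart → Ten) : ℝ := ∫ x, S.ip₂ x (G x) (G x) ∂S.vol

/-- `∇·A = 0` in the sense of distributions, for a locally integrable `1`-form. -/
def DivFree (A : Chart → Cov) : Prop :=
  ∀ ψ : Chart → ℝ, ContDiff ℝ ∞ ψ → HasCompactSupport ψ →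
    ∫ x, S.ip x (A x) (fun i => pd i ψ x) ∂S.vol = 0

/-- The distribution `∇ × A` (curl is formally self-adjoint), tested against `X`. -/
def curlPairing (A : Chart → Cov) (X : testForms) : ℝ :=
  ∫ x, S.ip x (A x) (S.curl X x) ∂S.vol

/-- `∇ × A = B` in the sense of distributions. -/
def HasCurl (A B : FormField) : Prop :=
  ∀ X : testForms, S.curlPairing A X = ∫ x, S.ip x (B x) ((X : Chart → Cov) x) ∂S.vol

/-- `Ḣ¹_C(Σ)^curl = {A ∈ Ḣ¹(Σ) : ∇·A = 0, ∇ × A ∈ L²(Σ)}`. -/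
def H1Ccurl : Set FormField :=
  {A | (∃ G, S.IsH1 A G) ∧ S.DivFree A ∧ ∃ B ∈ S.L2, S.HasCurl A B}

/-- Divergence-free elements of `L²(Σ)`. -/
def L2div : Set FormField := {B | B ∈ S.L2 ∧ S.DivFree B}

/-- Membership in `Ḣ⁻¹(Σ)`, the dual of `Ḣ¹(Σ)`, for a linear functional on test forms
(which are dense in `Ḣ¹(Σ)`). -/
def IsHMinus1 (ℓ : testForms →ₗ[ℝ] ℝ) : Prop :=
  ∃ M : ℝ, ∀ X : testForms, |ℓ X| ≤ M * Real.sqrt (S.normSq₂ (S.covDeriv X))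

/-! ### The operator `-Δ - R` -/

/-- The density of `⟨(-Δ - σ Ric) A, A'⟩`, where `G = ∇A` and `G' = ∇A'`. -/
def formDensity (σ : ℝ) (A : Chart → Cov) (G : Chart → Ten) (A' : Chart → Cov)
    (G' : Chart → Ten) (x : Chart) : ℝ :=
  S.ip₂ x (G x) (G' x) - σ * S.ricForm x (A x) (A' x)

/-- The duality pairing `⟨(-Δ - σ Ric) A, A'⟩ = ∫_Σ (⟨∇A, ∇A'⟩ - σ Ric(A, A'))`, where `G = ∇A`
and `G' = ∇A'`.  The sign `σ` records the sign convention for the curvature `R = σ Ric`. -/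
def form (σ : ℝ) (A : Chart → Cov) (G : Chart → Ten) (A' : Chart → Cov)
    (G' : Chart → Ten) : ℝ :=
  ∫ x, S.formDensity σ A G A' G' x ∂S.vol

/-- The distribution `(-Δ - σ Ric) A`, tested against `X`, where `G = ∇A`. -/
def opPairing (σ : ℝ) (A : Chart → Cov) (G : Chart → Ten) (X : testForms) : ℝ :=
  S.form σ A G X (S.covDeriv X)

/-- Constants `C ≥ 0` for which Hardy's inequality `∫_Σ |X|²/r² ≤ C ∫_Σ |∇X|²` holds for all
smooth compactly supported `1`-forms `X`. -/
def hardyConstants (r : Chart → ℝ) : Set ℝ :=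
  {C | 0 ≤ C ∧ ∀ X : testForms,
    ∫⁻ x, ENNReal.ofReal (S.ip x ((X : Chart → Cov) x) ((X : Chart → Cov) x) / r x ^ 2) ∂S.vol
      ≤ ENNReal.ofReal C *
        ∫⁻ x, ENNReal.ofReal (S.ip₂ x (S.covDeriv X x) (S.covDeriv X x)) ∂S.vol}

end InitialSurface

end

/-! ### Partial derivatives -/

section PartialDerivatives

variable {f g : Chart → ℝ} {x : Chart} {i j : Fin 3}

/-! Outside a compact set `h` is explicit, so it is uniformly equivalent to the Euclidean metric and
`L²` norms may be computed in the chart. Kato's inequality `|d|X|²| ≤ 2|X||∇X|` reduces Hardy's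
inequality for `1`-forms to a Euclidean one on `ℝ³`, which comes from the divergence of `(x - p)/(|x
- p|² + ε²)`. The admissible constants form a nonempty closed set bounded below, whence the best
constant `C`. It is positive, so `Cδ < 1` forces `δ < ∞`.

By Hardy, convergence in `Ḣ¹` means `L²` convergence of both `∇φₙ` and `φₙ/r` (`isH1_iff`). The
Ricci term is the bounded form `r² Ric` evaluated on `A/r`, and `∫ |Ric(A, A)| ≤ δ ∫ |A|²/r² ≤ Cδ
‖∇A‖²`. Hence the form is bounded, symmetric and coercive for both signs (`exists_form_bound`,
`form_coercive`). Coercivity kills the kernel. Surjectivity is the Riesz representation theorem,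
proved by minimising `a(v, v) - 2 l(v)` over test forms (`exists_minimizing_sequence`).

For `σ = -1` the Weitzenböck identity (`weitzenbock_pointwise`) turns the form into `∫ ⟨∇ × A, ∇ ×
X⟩ + (∇ · A)(∇ · X)`. Given a divergence-free `B` in `L²`, solve `P A = ∇ × B`; it remains to see
that `∇ × A = B` and `∇ · A = 0`. The errors `b = ∇ × A - B` and `f = ∇ · A` lie in `L²` and
satisfy, weakly, the first order elliptic system `∇ × b - df = 0`, `∇ · b = 0`. This system has only
the zero solution in `L²` (`ae_eq_zero_of_weak_solution`). Indeed, for test data `∫ ⟨∇ × X, dψ⟩ =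
0`, so `⟨P X, X⟩ + ∫ |dψ|² = ∫ |∇ × X - dψ|² + ∫ (∇ · X)²`, and coercivity with Hardy bounds `X/r`
and `ψ/(1 + |x|)` by the right-hand side. Since `h` is only `C²`, the cut-off pair `(χb, χf)` is
approximated by mollification, using Friedrichs' commutator lemma (`tendsto_commutator`,
`exists_approximation`). In the limit the right-hand side contains only terms with `dχ`, which are
`O(1/n)` for a cutoff at scale `n`.

So `B ↦ A` is a bijection onto the Coulomb space, inverted by the curl. The field `A·κ` is in `L²`
because `rκ` is bounded, and adding it to `E` is a shear, which does not affect bijectivity. -/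

theorem pd_add (hf : DifferentiableAt ℝ f x) (hg : DifferentiableAt ℝ g x) :
    pd i (fun y => f y + g y) x = pd i f x + pd i g x := by
  simp only [pd]; rw [fderiv_fun_add hf hg]; rfl

theorem pd_sub (hf : DifferentiableAt ℝ f x) (hg : DifferentiableAt ℝ g x) :
    pd i (fun y => f y - g y) x = pd i f x - pd i g x := by
  simp only [pd]; rw [fderiv_fun_sub hf hg]; rfl

theorem pd_mul (hf : DifferentiableAt ℝ f x) (hg : DifferentiableAt ℝ g x) :
    pd i (fun y => f y * g y) x = pd i f x * g x + f x * pd i g x := by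
  simp only [pd]; rw [fderiv_fun_mul hf hg]
  simp only [add_apply, smul_apply, smul_eq_mul]; ring

theorem pd_const (c : ℝ) : pd i (fun _ => c) x = 0 := by
  simp [pd]

theorem pd_const_mul (c : ℝ) (hf : DifferentiableAt ℝ f x) :
    pd i (fun y => c * f y) x = c * pd i f x := by
  rw [pd_mul (differentiableAt_const c) hf, pd_const]; ring

theorem pd_sum {ι : Type*} (s : Finset ι) {F : ι → Chart → ℝ}
    (h : ∀ k ∈ s, DifferentiableAt ℝ (F k) x) :
    pd i (fun y => ∑ k ∈ s, F k y) x = ∑ k ∈ s, pd i (F k) x := by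
  simp only [pd]; rw [fderiv_fun_sum h]
  simp

theorem contDiff_pd {n : ℕ∞ω} {m : ℕ∞ω} (hf : ContDiff ℝ n f) (h : m + 1 ≤ n) :
    ContDiff ℝ m (pd i f) :=
  (hf.fderiv_right h).clm_apply contDiff_const

theorem continuous_pd (hf : ContDiff ℝ 1 f) : Continuous (pd i f) :=
  (contDiff_pd (m := 0) hf (by simp)).continuous

theorem pd_comm (hf : ContDiff ℝ 2 f) : pd i (pd j f) x = pd j (pd i f) x := by
  have hd : DifferentiableAt ℝ (fderiv ℝ f) x :=
    ((hf.fderiv_right (m := 1) (by norm_num)).differentiable one_ne_zero) x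
  have key : ∀ a b : Fin 3, pd a (pd b f) x
      = fderiv ℝ (fderiv ℝ f) x (EuclideanSpace.single a 1) (EuclideanSpace.single b 1) := by
    intro a b
    have : pd b f = fun y => (fderiv ℝ f y) (EuclideanSpace.single b 1) := rfl
    rw [this]
    simp only [pd]
    rw [fderiv_clm_apply hd (differentiableAt_const _)]
    simp
  rw [key, key]
  exact (hf.contDiffAt.isSymmSndFDerivAt (by simp)) _ _

theorem HasCompactSupport.pd (hf : HasCompactSupport f) : HasCompactSupport (pd i f) :=
  (hf.fderiv (𝕜 := ℝ)).comp_left (g := fun L : Chart →L[ℝ] ℝ => L (EuclideanSpace.single i 1)) rfl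

theorem integral_pd_eq_zero (hf : ContDiff ℝ 1 f) (hc : HasCompactSupport f) :
    ∫ x, pd i f x = 0 := by
  have hi : Integrable (pd i f) := (continuous_pd hf).integrable_of_hasCompactSupport hc.pd
  -- Integration by parts against the constant function `1`.
  have h := integral_mul_fderiv_eq_neg_fderiv_mul_of_integrable (𝕜 := ℝ)
    (μ := (volume : Measure Chart))
    (f := fun _ => (1 : ℝ)) (g := f) (v := EuclideanSpace.single i 1)
    (by simp) (by simp only [one_mul]; exact hi)
    (by simpa using hf.continuous.integrable_of_hasCompactSupport hc)
    (fun x _ => differentiableAt_const _) (fun x _ => hf.differentiable one_ne_zero x)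
  simpa [pd] using h

end PartialDerivatives

namespace InitialSurface

variable (S : InitialSurface)

/-! ### The metric and its inverse -/

theorem det_pos (x : Chart) : 0 < (S.h x).det := (S.h_posDef x).det_pos

theorem h_symm (x : Chart) (i j : Fin 3) : S.h x i j = S.h x j i := by
  have := (S.h_posDef x).isHermitian.apply j i
  simpa using this

theorem hinv_symm (x : Chart) (i j : Fin 3) : S.hinv x i j = S.hinv x j i := by
  have := (S.h_posDef x).inv.isHermitian.apply j i
  simpa [hinv] using this

theorem h_mul_hinv (x : Chart) (i j : Fin 3) :
    ∑ k, S.h x i k * S.hinv x k j = if i = j then 1 else 0 := by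
  have := congrFun (congrFun (Matrix.mul_nonsing_inv (S.h x) (S.det_pos x).ne'.isUnit) i) j
  simpa [Matrix.mul_apply, Matrix.one_apply, hinv] using this

theorem hinv_mul_h (x : Chart) (i j : Fin 3) :
    ∑ k, S.hinv x i k * S.h x k j = if i = j then 1 else 0 := by
  have := congrFun (congrFun (Matrix.nonsing_inv_mul (S.h x) (S.det_pos x).ne'.isUnit) i) j
  simpa [Matrix.mul_apply, Matrix.one_apply, hinv] using this

theorem sqrtDet_pos (x : Chart) : 0 < S.sqrtDet x := Real.sqrt_pos.2 (S.det_pos x)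

theorem sqrtDet_sq (x : Chart) : S.sqrtDet x ^ 2 = (S.h x).det := Real.sq_sqrt (S.det_pos x).le

theorem contDiff_det : ContDiff ℝ 2 (fun x => (S.h x).det) := by
  have := S.h_contDiff
  simp only [Matrix.det_fin_three]
  fun_prop

/-- Cramer's rule exhibits each entry as a polynomial in the entries of `h` divided by the
nonvanishing determinant. -/
theorem contDiff_hinv (i j : Fin 3) : ContDiff ℝ 2 (fun x => S.hinv x i j) := by
  have h := S.h_contDiff
  have hd : ContDiff ℝ 2 (fun x => ((S.h x).det)⁻¹) :=
    S.contDiff_det.inv fun x => (S.det_pos x).ne'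
  have ha : ContDiff ℝ 2 (fun x => (S.h x).adjugate i j) := by
    simp only [Matrix.adjugate_fin_three]
    fin_cases i <;> fin_cases j <;> simp <;> fun_prop
  have : (fun x => S.hinv x i j) = fun x => ((S.h x).det)⁻¹ * (S.h x).adjugate i j := by
    funext x
    simp [hinv, Matrix.inv_def]
  rw [this]
  exact hd.mul ha

theorem contDiff_sqrtDet : ContDiff ℝ 2 S.sqrtDet :=
  S.contDiff_det.sqrt fun x => (S.det_pos x).ne'

theorem differentiableAt_h (i j : Fin 3) (x : Chart) :
    DifferentiableAt ℝ (fun y => S.h y i j) x :=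
  (S.h_contDiff i j).differentiable two_ne_zero x

theorem differentiableAt_hinv (i j : Fin 3) (x : Chart) :
    DifferentiableAt ℝ (fun y => S.hinv y i j) x :=
  (S.contDiff_hinv i j).differentiable two_ne_zero x

theorem contDiff_christoffel (k i j : Fin 3) : ContDiff ℝ 1 (S.christoffel k i j) := by
  have h1 : ∀ a b c, ContDiff ℝ 1 (pd a (fun y => S.h y b c)) := fun a b c =>
    contDiff_pd (S.h_contDiff b c) (by norm_num)
  have h2 : ∀ a b, ContDiff ℝ 1 (fun y => S.hinv y a b) := fun a b =>
    (S.contDiff_hinv a b).of_le (by norm_num)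
  unfold christoffel
  fun_prop

theorem christoffel_symm (k i j : Fin 3) : S.christoffel k i j = S.christoffel k j i := by
  funext x
  simp only [christoffel]
  congr 1
  refine Finset.sum_congr rfl fun l _ => ?_
  have : (fun y => S.h y i j) = fun y => S.h y j i := funext fun y => S.h_symm y i j
  rw [this]; ring

theorem h_christoffel (a i j : Fin 3) (x : Chart) :
    ∑ k, S.h x a k * S.christoffel k i j x = 1 / 2 * (pd i (fun y => S.h y j a) x
      + pd j (fun y => S.h y i a) x - pd a (fun y => S.h y i j) x) := by
  have key : ∀ c : Fin 3 → ℝ, ∑ k, S.h x a k * (1 / 2 * ∑ l, S.hinv x k l * c l) = 1 / 2 * c a := by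
    intro c
    calc _ = 1 / 2 * ∑ l, (∑ k, S.h x a k * S.hinv x k l) * c l := by
          simp only [Finset.mul_sum, Finset.sum_mul]
          rw [Finset.sum_comm]
          refine Finset.sum_congr rfl fun _ _ => Finset.sum_congr rfl fun _ _ => by ring
      _ = _ := by simp [h_mul_hinv]
  exact key _

/-- Metric compatibility `∇h = 0` in coordinates: in the sum of two lowered Christoffel symbols all
but one derivative of `h` cancel. -/
theorem pd_h (k i j : Fin 3) (x : Chart) :
    pd k (fun y => S.h y i j) x = ∑ l, (S.h x i l * S.christoffel l k j x
      + S.h x j l * S.christoffel l k i x) := by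
  have e : ∀ a b, (fun y => S.h y a b) = fun y => S.h y b a :=
    fun a b => funext fun y => S.h_symm y a b
  rw [Finset.sum_add_distrib, h_christoffel, h_christoffel, e k i, e k j, e j i]
  ring

/-- Compatibility `∇h⁻¹ = 0`, obtained by differentiating `h⁻¹h = 1` and inserting `pd_h`. -/
theorem pd_hinv (k i j : Fin 3) (x : Chart) :
    pd k (fun y => S.hinv y i j) x = -∑ l, (S.christoffel i k l x * S.hinv x l j
      + S.christoffel j k l x * S.hinv x i l) := by
  have hz : ∀ b, ∑ a, (pd k (fun y => S.hinv y i a) x * S.h x a b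
      + S.hinv x i a * pd k (fun y => S.h y a b) x) = 0 := by
    intro b
    have h1 : pd k (fun y => ∑ a, S.hinv y i a * S.h y a b) x = 0 := by
      simp only [hinv_mul_h]; exact pd_const _
    rw [pd_sum _ fun a _ => (S.differentiableAt_hinv i a x).fun_mul
      (S.differentiableAt_h a b x)] at h1
    rw [← h1]
    exact Finset.sum_congr rfl fun a _ =>
      (pd_mul (S.differentiableAt_hinv i a x) (S.differentiableAt_h a b x)).symm
  -- The differentiated identity is multiplied by `h⁻¹` on the right, which isolates `∂h⁻¹ = -h⁻¹
  -- (∂h) h⁻¹`.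
  have e1 : pd k (fun y => S.hinv y i j) x
      = -∑ b, ∑ a, S.hinv x i a * pd k (fun y => S.h y a b) x * S.hinv x b j := by
    have : ∑ b, (∑ a, (pd k (fun y => S.hinv y i a) x * S.h x a b
      + S.hinv x i a * pd k (fun y => S.h y a b) x)) * S.hinv x b j = 0 := by simp [hz]
    simp only [Finset.sum_add_distrib, add_mul, Finset.sum_mul] at this
    rw [eq_neg_iff_add_eq_zero, ← this]
    congr 1
    rw [Finset.sum_comm]
    have : ∀ a, ∑ b, pd k (fun y => S.hinv y i a) x * S.h x a b * S.hinv x b j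
        = pd k (fun y => S.hinv y i a) x * if a = j then 1 else 0 := by
      intro a
      rw [← h_mul_hinv, Finset.mul_sum]
      exact Finset.sum_congr rfl fun _ _ => by ring
    simp [this]
  have e2 : ∀ c : Fin 3 → Fin 3 → ℝ,
      ∑ b, ∑ a, S.hinv x i a * (∑ l, (S.h x a l * c l b + S.h x b l * c l a)) * S.hinv x b j
      = ∑ l, (c i l * S.hinv x l j + c j l * S.hinv x i l) := by
    intro c
    simp only [Finset.sum_add_distrib, mul_add, add_mul]
    congr 1
    · refine Finset.sum_congr rfl fun b _ => ?_
      have : ∑ a, S.hinv x i a * (∑ l, S.h x a l * c l b)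
          = ∑ l, (∑ a, S.hinv x i a * S.h x a l) * c l b := by
        simp only [Finset.mul_sum, Finset.sum_mul]
        rw [Finset.sum_comm]
        refine Finset.sum_congr rfl fun _ _ => Finset.sum_congr rfl fun _ _ => by ring
      rw [← Finset.sum_mul, this]
      simp [hinv_mul_h]
    · rw [Finset.sum_comm]
      refine Finset.sum_congr rfl fun a _ => ?_
      have : ∑ b, S.hinv x i a * (∑ l, S.h x b l * c l a) * S.hinv x b j
          = ∑ l, (∑ b, S.hinv x j b * S.h x b l) * c l a * S.hinv x i a := by
        simp only [Finset.mul_sum, Finset.sum_mul]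
        rw [Finset.sum_comm]
        refine Finset.sum_congr rfl fun _ _ => Finset.sum_congr rfl fun b _ => ?_
        rw [S.hinv_symm x j b]; ring
      rw [this]
      simp [hinv_mul_h]
  rw [e1]
  simp only [pd_h]
  rw [e2 (fun a b => S.christoffel a k b x)]

/-- The two other derivatives of `h` enter antisymmetrically in the pair contracted with the
symmetric `h^{kl}`, so they cancel. -/
theorem sum_christoffel (i : Fin 3) (x : Chart) :
    ∑ k, S.christoffel k i k x = 1 / 2 * ∑ a, ∑ b, S.hinv x a b * pd i (fun y => S.h y a b) x := by
  simp only [christoffel, ← Finset.mul_sum]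
  congr 1
  have e : ∀ (d : Fin 3 → Fin 3 → ℝ), ∑ k, ∑ l, S.hinv x k l * (d k l - d l k) = 0 := by
    intro d
    simp only [mul_sub, Finset.sum_sub_distrib]
    rw [sub_eq_zero, Finset.sum_comm]
    refine Finset.sum_congr rfl fun _ _ => Finset.sum_congr rfl fun _ _ => by rw [S.hinv_symm]
  have e' := e (fun k l => pd k (fun y => S.h y i l) x)
  rw [← sub_eq_zero, ← e', ← Finset.sum_sub_distrib]
  refine Finset.sum_congr rfl fun _ _ => ?_
  rw [← Finset.sum_sub_distrib]
  refine Finset.sum_congr rfl fun _ _ => ?_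
  ring

/-- Jacobi's formula. With `det h · h⁻¹` replaced by the adjugate it becomes a polynomial identity
for `3 × 3` matrices. -/
theorem pd_det (i : Fin 3) (x : Chart) :
    pd i (fun y => (S.h y).det) x
      = (S.h x).det * ∑ a, ∑ b, S.hinv x a b * pd i (fun y => S.h y a b) x := by
  have e : ∀ a b, (S.h x).det * S.hinv x a b = (S.h x).adjugate a b := by
    intro a b
    have := (S.det_pos x).ne'
    simp [hinv, Matrix.inv_def]
    field_simp
  have hd := fun a b => S.differentiableAt_h a b x
  simp only [Finset.mul_sum, ← mul_assoc, e]
  simp only [Matrix.det_fin_three, Matrix.adjugate_fin_three]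
  repeat first
    | rw [pd_add (by fun_prop) (by fun_prop)]
    | rw [pd_sub (by fun_prop) (by fun_prop)]
    | rw [pd_mul (by fun_prop) (by fun_prop)]
  have s : ∀ a b, pd i (fun y => S.h y a b) x = pd i (fun y => S.h y b a) x := by
    intro a b; congr 1; exact funext fun y => S.h_symm y a b
  simp [Fin.sum_univ_three]
  rw [s 1 0, s 2 0, s 2 1, S.h_symm x 1 0, S.h_symm x 2 0, S.h_symm x 2 1]
  ring

/-- This is what makes `∂_i(√h V^i) = √h ∇_i V^i`, so that covariant divergences integrate to zero.
-/
theorem pd_sqrtDet (i : Fin 3) (x : Chart) :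
    pd i S.sqrtDet x = S.sqrtDet x * ∑ k, S.christoffel k i k x := by
  have hd : DifferentiableAt ℝ S.sqrtDet x := S.contDiff_sqrtDet.differentiable two_ne_zero x
  have h1 : pd i (fun y => S.sqrtDet y * S.sqrtDet y) x = pd i (fun y => (S.h y).det) x := by
    congr 1; funext y; rw [← sq, sqrtDet_sq]
  rw [pd_mul hd hd, pd_det, ← sqrtDet_sq] at h1
  rw [sum_christoffel]
  have := (S.sqrtDet_pos x).ne'
  have h2 : S.sqrtDet x * (2 * pd i S.sqrtDet x) = S.sqrtDet x * (S.sqrtDet x *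
    ∑ a, ∑ b, S.hinv x a b * pd i (fun y => S.h y a b) x) := by linear_combination h1
  have h3 := mul_left_cancel₀ this h2
  linear_combination h3 / 2

/-- The only term that is not visibly symmetric is the derivative of the contracted Christoffel
symbol. That symbol is the gradient of `log √(det h)`, so its derivative is a Hessian, symmetric
because `h` is `C²`. -/
theorem ricci_symm (i j : Fin 3) (x : Chart) : S.ricci i j x = S.ricci j i x := by
  have hl : ContDiff ℝ 2 (fun y => Real.log (S.sqrtDet y)) :=
    S.contDiff_sqrtDet.log fun y => (S.sqrtDet_pos y).ne'
  have e : ∀ a, pd a (fun y => Real.log (S.sqrtDet y)) = fun y => ∑ k, S.christoffel k a k y := by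
    intro a; funext y
    have hd : DifferentiableAt ℝ S.sqrtDet y := S.contDiff_sqrtDet.differentiable two_ne_zero y
    have h := S.pd_sqrtDet a y
    have hp := (S.sqrtDet_pos y).ne'
    simp only [pd] at *
    rw [(hd.hasFDerivAt.log hp).fderiv]
    simp only [smul_apply, smul_eq_mul, h]
    field_simp
  have hs : ∀ a b, ∑ k, pd a (S.christoffel k b k) x
      = pd a (pd b (fun y => Real.log (S.sqrtDet y))) x := by
    intro a b
    rw [e, pd_sum]
    intro k _
    exact (S.contDiff_christoffel k b k).differentiable one_ne_zero x
  simp only [ricci, Finset.sum_sub_distrib, hs]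
  rw [pd_comm hl]
  simp only [S.christoffel_symm _ i j]
  congr 2
  rw [Finset.sum_comm]
  refine Finset.sum_congr rfl fun k _ => Finset.sum_congr rfl fun l _ => ?_
  ring

theorem continuous_ricci (i j : Fin 3) : Continuous (S.ricci i j) := by
  have h1 : ∀ a k i j, Continuous (pd a (S.christoffel k i j)) := fun a k i j =>
    continuous_pd (S.contDiff_christoffel k i j)
  have h2 : ∀ k i j, Continuous (S.christoffel k i j) := fun k i j =>
    (S.contDiff_christoffel k i j).continuous
  unfold ricci
  fun_prop

theorem continuous_hinv (i j : Fin 3) : Continuous (fun x => S.hinv x i j) :=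
  (S.contDiff_hinv i j).continuous

theorem continuous_sqrtDet : Continuous S.sqrtDet := S.contDiff_sqrtDet.continuous

end InitialSurface

namespace InitialSurface

variable (S : InitialSurface)

/-! ### Pointwise identities for `1`-forms and `2`-tensors -/

/-- The trace `h^{ij} T_{ij}`; for `T = ∇A` this is the divergence `∇·A`. -/
noncomputable def trace (x : Chart) (T : Ten) : ℝ := ∑ i, ∑ j, S.hinv x i j * T i j

/-- The antisymmetrisation `[ijk] T_{jk}`. -/
noncomputable def alt (T : Ten) (i : Fin 3) : ℝ := ∑ j, ∑ k, perm i j k * T j k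

/-- `T_i{}^j = h^{jl} T_{il}`. -/
noncomputable def raiseSnd (x : Chart) (T : Ten) (i j : Fin 3) : ℝ := ∑ l, S.hinv x j l * T i l

theorem trace_eq (x : Chart) (T : Ten) : S.trace x T = ∑ i, S.raiseSnd x T i i := rfl

theorem epsContract_eq (x : Chart) (T : Ten) (i : Fin 3) :
    S.epsContract x T i = ∑ l, S.h x i l * (alt T l / S.sqrtDet x) := by
  simp only [epsContract, alt, Finset.sum_div, Finset.mul_sum]
  refine Finset.sum_congr rfl fun l _ => Finset.sum_congr rfl fun j _ =>
    Finset.sum_congr rfl fun k _ => ?_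
  ring

theorem ip_symm (x : Chart) (a b : Cov) : S.ip x a b = S.ip x b a := by
  simp only [ip]
  rw [Finset.sum_comm]
  refine Finset.sum_congr rfl fun i _ => Finset.sum_congr rfl fun j _ => ?_
  rw [S.hinv_symm x j i]; ring

theorem ip_eq_raise (x : Chart) (a b : Cov) : S.ip x a b = ∑ i, a i * S.raise x b i := by
  simp only [ip, raise, Finset.mul_sum]
  refine Finset.sum_congr rfl fun i _ => Finset.sum_congr rfl fun j _ => ?_
  ring

theorem raise_epsContract (x : Chart) (T : Ten) (i : Fin 3) :
    S.raise x (S.epsContract x T) i = alt T i / S.sqrtDet x := by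
  simp only [raise, epsContract_eq, Finset.mul_sum]
  rw [Finset.sum_comm]
  have : ∀ l, ∑ j, S.hinv x i j * (S.h x j l * (alt T l / S.sqrtDet x))
      = (if i = l then 1 else 0) * (alt T l / S.sqrtDet x) := by
    intro l
    rw [← hinv_mul_h, Finset.sum_mul]
    exact Finset.sum_congr rfl fun _ _ => by ring
  simp [this]

/-- The volume density cancels the one in the volume form and `h` cancels `h⁻¹`: the pairing does
not see the metric. -/
theorem sqrtDet_mul_ip_epsContract (x : Chart) (a : Cov) (T : Ten) :
    S.sqrtDet x * S.ip x a (S.epsContract x T) = ∑ i, a i * alt T i := by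
  have := (S.sqrtDet_pos x).ne'
  simp only [ip_eq_raise, raise_epsContract, Finset.mul_sum]
  refine Finset.sum_congr rfl fun i _ => ?_
  field_simp

/-- Cofactor formula for `h = (h⁻¹)⁻¹`. It lets curl products be written as polynomials in the
entries of `h⁻¹`. -/
theorem h_div_det (x : Chart) (i j : Fin 3) :
    S.h x i j / (S.h x).det = Matrix.adjugate (Matrix.of fun a b => S.hinv x a b) i j := by
  have hu := (S.det_pos x).ne'.isUnit
  have e : (Matrix.of fun a b => S.hinv x a b) = (S.h x)⁻¹ := by ext; rfl
  have h1 : (S.h x) = ((S.h x)⁻¹)⁻¹ := (Matrix.nonsing_inv_nonsing_inv _ hu).symm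
  have h2 : S.h x i j = (S.h x).det * (S.h x)⁻¹.adjugate i j := by
    conv_lhs => rw [h1, Matrix.inv_def]
    simp [Matrix.det_nonsing_inv]
  rw [e, h2]
  have := (S.det_pos x).ne'
  field_simp

theorem ip_epsContract_epsContract (x : Chart) (T U : Ten) :
    S.ip x (S.epsContract x T) (S.epsContract x U)
      = ∑ l, ∑ p, S.h x l p / (S.h x).det * alt T l * alt U p := by
  have h0 := (S.sqrtDet_pos x).ne'
  simp only [ip_eq_raise, raise_epsContract, epsContract_eq, Finset.sum_mul, ← sqrtDet_sq]
  rw [Finset.sum_comm]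
  refine Finset.sum_congr rfl fun l _ => Finset.sum_congr rfl fun p _ => ?_
  rw [S.h_symm x p l]
  field_simp

/-- The contraction `ε_i{}^{jk} ε^{ilm} = h^{jl}h^{km} - h^{jm}h^{kl}` gives `⟨εT, εU⟩ =
T_{jk}U^{jk} - T_{jk}U^{kj}`. After `h_div_det` both sides are polynomials in `h⁻¹`, `T` and `U`. -/
theorem ip₂_eq (x : Chart) (T U : Ten) :
    S.ip₂ x T U = S.ip x (S.epsContract x T) (S.epsContract x U)
      + ∑ i, ∑ j, S.raiseSnd x T i j * S.raiseSnd x U j i := by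
  rw [ip_epsContract_epsContract]
  simp only [h_div_det, Matrix.adjugate_fin_three, ip₂, raiseSnd, alt, perm, Fin.sum_univ_three]
  simp only [Matrix.of_apply, S.hinv_symm x 1 0, S.hinv_symm x 2 0, S.hinv_symm x 2 1]
  simp
  ring

/-! ### The Weitzenböck identity -/

variable {S}

theorem differentiableAt_comp {A : Chart → Cov} (hA : ContDiff ℝ ∞ A) (i : Fin 3) (x : Chart) :
    DifferentiableAt ℝ (fun y => A y i) x :=
  ((contDiff_pi.1 hA i).differentiable (by simp)) x

theorem contDiff_raise {A : Chart → Cov} (hA : ContDiff ℝ ∞ A) (j : Fin 3) :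
    ContDiff ℝ 2 (fun y => S.raise y (A y) j) := by
  have h1 := S.contDiff_hinv
  have h2 : ∀ i, ContDiff ℝ 2 (fun y => A y i) := fun i => contDiff_infty.1 (contDiff_pi.1 hA i) 2
  simp only [raise]
  fun_prop

theorem contDiff_covDeriv {A : Chart → Cov} (hA : ContDiff ℝ ∞ A) (i j : Fin 3) :
    ContDiff ℝ 1 (fun y => S.covDeriv A y i j) := by
  have h1 := fun k => S.contDiff_christoffel k i j
  have h2 : ∀ i, ContDiff ℝ 1 (fun y => A y i) := fun i => contDiff_infty.1 (contDiff_pi.1 hA i) 1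
  have h3 : ContDiff ℝ 1 (pd i (fun y => A y j)) :=
    contDiff_pd (contDiff_infty.1 (contDiff_pi.1 hA j) 2) (by norm_num)
  unfold covDeriv
  fun_prop

/-- Raising an index commutes with `∇`, since `∇h⁻¹ = 0`; the result is the usual covariant
derivative of the vector field `A^j`. -/
theorem raiseSnd_covDeriv {A : Chart → Cov} (hA : ContDiff ℝ ∞ A) (x : Chart) (i j : Fin 3) :
    S.raiseSnd x (S.covDeriv A x) i j = pd i (fun y => S.raise y (A y) j) x
      + ∑ k, S.christoffel j i k x * S.raise x (A x) k := by
  have hd := fun l => S.differentiableAt_hinv j l x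
  have hA' := fun l => differentiableAt_comp hA l x
  have e : pd i (fun y => S.raise y (A y) j) x = ∑ l, (pd i (fun y => S.hinv y j l) x * A x l
      + S.hinv x j l * pd i (fun y => A y l) x) := by
    simp only [raise]
    rw [pd_sum _ fun l _ => (hd l).fun_mul (hA' l)]
    exact Finset.sum_congr rfl fun l _ => pd_mul (hd l) (hA' l)
  rw [e]
  simp only [raiseSnd, covDeriv, pd_hinv, raise]
  simp only [Fin.sum_univ_three]
  ring

set_option maxRecDepth 10000 in
-- The commutation of second covariant derivatives, as an identity between jets. The left side is
-- the divergence `(∂_i + Γ^k_{ik})V^i` of `V^i = A^j∇_jX^i - A^i∇_jX^j`; the second derivatives of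
-- `X` cancel and the terms in `Γ`, `∂Γ` assemble into Ricci. Only the symmetries of `∂∂X` and `Γ`
-- are needed, so all jet components are treated as free variables.
theorem weitzenbock_algebra (A X : Fin 3 → ℝ) (dA dX : Fin 3 → Fin 3 → ℝ)
    (ddX : Fin 3 → Fin 3 → Fin 3 → ℝ) (Γ : Fin 3 → Fin 3 → Fin 3 → ℝ)
    (dΓ : Fin 3 → Fin 3 → Fin 3 → Fin 3 → ℝ)
    (hdd : ∀ i j k, ddX i j k = ddX j i k) (hΓ : ∀ k i j, Γ k i j = Γ k j i)
    (hdΓ : ∀ a k i j, dΓ a k i j = dΓ a k j i) :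
    ∑ i, (∑ j, ((dA i j * (dX j i + ∑ k, Γ i j k * X k)
        + A j * (ddX i j i + ∑ k, (dΓ i i j k * X k + Γ i j k * dX i k)))
        - (dA i i * (dX j j + ∑ k, Γ j j k * X k)
        + A i * (ddX i j j + ∑ k, (dΓ i j j k * X k + Γ j j k * dX i k))))
      + (∑ k, Γ k i k) * ∑ j, (A j * (dX j i + ∑ k, Γ i j k * X k)
        - A i * (dX j j + ∑ k, Γ j j k * X k)))
    = ∑ i, ∑ j, (dA i j + ∑ k, Γ j i k * A k) * (dX j i + ∑ k, Γ i j k * X k)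
      - (∑ i, (dA i i + ∑ k, Γ i i k * A k)) * (∑ i, (dX i i + ∑ k, Γ i i k * X k))
      + ∑ i, ∑ j, (∑ k, (dΓ k k i j - dΓ j k i k)
        + ∑ k, ∑ l, (Γ k k l * Γ l i j - Γ k j l * Γ l i k)) * A j * X i := by
  simp only [Fin.sum_univ_three]
  simp only [hΓ _ 1 0, hΓ _ 2 0, hΓ _ 2 1, hdΓ _ _ 1 0, hdΓ _ _ 2 0, hdΓ _ _ 2 1,
    hdd 1 0, hdd 2 0, hdd 2 1]
  ring

/-- The vector field whose divergence relates the Hodge and the rough energy densities. -/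
noncomputable def weitzenbockField (S : InitialSurface) (A X : Chart → Cov) (i : Fin 3)
    (x : Chart) : ℝ :=
  ∑ j, (S.raise x (A x) j * S.raiseSnd x (S.covDeriv X x) j i
    - S.raise x (A x) i * S.raiseSnd x (S.covDeriv X x) j j)

/-- By `ip₂_eq`, `⟨∇A, ∇X⟩` equals `⟨∇ × A, ∇ × X⟩` plus `∇_iA^j ∇_jX^i`. The last term is rewritten
by `weitzenbock_algebra` as the product of the divergences, minus Ricci, plus an exact divergence.
-/
theorem weitzenbock_pointwise {A X : Chart → Cov} (hA : ContDiff ℝ ∞ A) (hX : ContDiff ℝ ∞ X)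
    (x : Chart) :
    S.sqrtDet x * (S.ip₂ x (S.covDeriv A x) (S.covDeriv X x) + S.ricForm x (A x) (X x))
      = S.sqrtDet x * (S.ip x (S.curl A x) (S.curl X x)
          + S.trace x (S.covDeriv A x) * S.trace x (S.covDeriv X x))
        + ∑ i, pd i (fun y => S.sqrtDet y * S.weitzenbockField A X i y) x := by
  have hrA := fun j => contDiff_raise (S := S) hA j
  have hrX := fun j => contDiff_raise (S := S) hX j
  have dA := fun j => (hrA j).differentiable two_ne_zero x
  have dX := fun j => (hrX j).differentiable two_ne_zero x
  have ddX : ∀ i j, DifferentiableAt ℝ (pd i (fun y => S.raise y (X y) j)) x := fun i j =>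
    (contDiff_pd (m := 1) (hrX j) (by norm_num)).differentiable one_ne_zero x
  have dΓ := fun k i j => (S.contDiff_christoffel k i j).differentiable one_ne_zero x
  have hU : ∀ j i, (fun y => S.raiseSnd y (S.covDeriv X y) j i) = fun y =>
      pd j (fun y => S.raise y (X y) i) y + ∑ k, S.christoffel i j k y * S.raise y (X y) k :=
    fun j i => funext fun y => raiseSnd_covDeriv hX y j i
  have dU : ∀ j i, DifferentiableAt ℝ (fun y => S.raiseSnd y (S.covDeriv X y) j i) x := by
    intro j i; rw [hU]; fun_prop
  have pU : ∀ a j i, pd a (fun y => S.raiseSnd y (S.covDeriv X y) j i) x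
      = pd a (pd j (fun y => S.raise y (X y) i)) x
        + ∑ k, (pd a (S.christoffel i j k) x * S.raise x (X x) k
          + S.christoffel i j k x * pd a (fun y => S.raise y (X y) k) x) := by
    intro a j i
    rw [hU, pd_add (by fun_prop) (by fun_prop), pd_sum _ (fun k _ => by fun_prop)]
    congr 1
    exact Finset.sum_congr rfl fun k _ => pd_mul (dΓ i j k) (dX k)
  have dV : ∀ i, DifferentiableAt ℝ (S.weitzenbockField A X i) x := by
    intro i; unfold weitzenbockField; fun_prop
  have dh : DifferentiableAt ℝ S.sqrtDet x := S.contDiff_sqrtDet.differentiable two_ne_zero x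
  have pV : ∀ i, pd i (S.weitzenbockField A X i) x = ∑ j,
      ((pd i (fun y => S.raise y (A y) j) x * S.raiseSnd x (S.covDeriv X x) j i
        + S.raise x (A x) j * pd i (fun y => S.raiseSnd y (S.covDeriv X y) j i) x)
      - (pd i (fun y => S.raise y (A y) i) x * S.raiseSnd x (S.covDeriv X x) j j
        + S.raise x (A x) i * pd i (fun y => S.raiseSnd y (S.covDeriv X y) j j) x)) := by
    intro i
    unfold weitzenbockField
    rw [pd_sum _ (fun k _ => by fun_prop)]
    refine Finset.sum_congr rfl fun j _ => ?_
    rw [pd_sub (by fun_prop) (by fun_prop), pd_mul (dA _) (dU _ _), pd_mul (dA _) (dU _ _)]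
  have key := weitzenbock_algebra (fun i => S.raise x (A x) i) (fun i => S.raise x (X x) i)
    (fun i j => pd i (fun y => S.raise y (A y) j) x)
    (fun i j => pd i (fun y => S.raise y (X y) j) x)
    (fun i j k => pd i (pd j (fun y => S.raise y (X y) k)) x)
    (fun k i j => S.christoffel k i j x) (fun a k i j => pd a (S.christoffel k i j) x)
    (fun i j k => pd_comm (hrX k)) (fun k i j => congrFun (S.christoffel_symm k i j) x)
    (fun a k i j => by rw [S.christoffel_symm k i j])
  have hpV : ∑ i, pd i (fun y => S.sqrtDet y * S.weitzenbockField A X i y) x = S.sqrtDet x *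
      ∑ i, (pd i (S.weitzenbockField A X i) x
        + (∑ k, S.christoffel k i k x) * S.weitzenbockField A X i x) := by
    rw [Finset.mul_sum]
    refine Finset.sum_congr rfl fun i _ => ?_
    rw [pd_mul dh (dV i), pd_sqrtDet]; ring
  rw [hpV, ← mul_add]
  congr 1
  simp only [pV, pU]
  simp only [weitzenbockField, trace_eq]
  rw [ip₂_eq]
  simp only [raiseSnd_covDeriv hA, raiseSnd_covDeriv hX]
  rw [key]
  have hric : S.ricForm x (A x) (X x)
      = ∑ i, ∑ j, S.ricci i j x * S.raise x (A x) j * S.raise x (X x) i := by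
    simp only [ricForm]
    rw [Finset.sum_comm]
    refine Finset.sum_congr rfl fun i _ => Finset.sum_congr rfl fun j _ => ?_
    rw [S.ricci_symm j i]
  rw [hric]
  simp only [ricci, curl]
  ring

end InitialSurface

namespace InitialSurface

variable (S : InitialSurface)

/-! ### The volume measure -/

theorem measurable_sqrtDet : Measurable S.sqrtDet := S.continuous_sqrtDet.measurable

theorem lintegral_vol (f : Chart → ℝ≥0∞) :
    ∫⁻ x, f x ∂S.vol = ∫⁻ x, ENNReal.ofReal (S.sqrtDet x) * f x :=
  lintegral_withDensity_eq_lintegral_mul_non_measurable₀ _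
    S.measurable_sqrtDet.ennreal_ofReal.aemeasurable (by simp) f

theorem setLIntegral_vol (f : Chart → ℝ≥0∞) {K : Set Chart} (hK : MeasurableSet K) :
    ∫⁻ x in K, f x ∂S.vol = ∫⁻ x in K, ENNReal.ofReal (S.sqrtDet x) * f x := by
  rw [vol, restrict_withDensity hK]
  exact lintegral_withDensity_eq_lintegral_mul_non_measurable₀ _
    S.measurable_sqrtDet.ennreal_ofReal.aemeasurable (by simp) f

theorem integral_vol (f : Chart → ℝ) : ∫ x, f x ∂S.vol = ∫ x, S.sqrtDet x * f x := by
  rw [vol, integral_withDensity_eq_integral_toReal_smul S.measurable_sqrtDet.ennreal_ofReal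
    (by simp)]
  simp [ENNReal.toReal_ofReal (S.sqrtDet_pos _).le]

theorem integrable_vol_iff (f : Chart → ℝ) :
    Integrable f S.vol ↔ Integrable (fun x => S.sqrtDet x * f x) := by
  rw [vol, integrable_withDensity_iff_integrable_smul' S.measurable_sqrtDet.ennreal_ofReal
    (by simp)]
  simp [ENNReal.toReal_ofReal (S.sqrtDet_pos _).le]

theorem ae_vol_iff {p : Chart → Prop} : (∀ᵐ x ∂S.vol, p x) ↔ ∀ᵐ x, p x := by
  rw [vol, ae_withDensity_iff S.measurable_sqrtDet.ennreal_ofReal]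
  simp [S.sqrtDet_pos]

/-! ### Test forms -/

variable {S}

theorem testForms_contDiff (X : testForms) : ContDiff ℝ ∞ (X : Chart → Cov) := X.2.1

theorem testForms_compact (X : testForms) : HasCompactSupport (X : Chart → Cov) := X.2.2

theorem hasCompactSupport_comp {X : Chart → Cov} (h : HasCompactSupport X) (i : Fin 3) :
    HasCompactSupport (fun x => X x i) :=
  h.comp_left (g := fun a : Cov => a i) rfl

theorem hasCompactSupport_covDeriv {X : Chart → Cov} (h : HasCompactSupport X) :
    HasCompactSupport (S.covDeriv X) := by
  refine HasCompactSupport.intro h fun x hx => ?_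
  have h0 : X =ᶠ[𝓝 x] 0 := notMem_tsupport_iff_eventuallyEq.1 hx
  have h1 : ∀ i j, pd i (fun y => X y j) x = 0 := by
    intro i j
    have : (fun y => X y j) =ᶠ[𝓝 x] fun _ => 0 := h0.mono fun y hy => by simp [hy]
    simp only [pd]
    rw [this.fderiv_eq]
    simp
  funext i j
  simp [covDeriv, h1, h0.eq_of_nhds]

theorem continuous_covDeriv {A : Chart → Cov} (hA : ContDiff ℝ ∞ A) :
    Continuous (S.covDeriv A) :=
  continuous_pi fun i => continuous_pi fun j => (contDiff_covDeriv hA i j).continuous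

theorem hasCompactSupport_raise {X : Chart → Cov} (h : HasCompactSupport X) (i : Fin 3) :
    HasCompactSupport (fun x => S.raise x (X x) i) :=
  HasCompactSupport.intro h fun x hx => by simp [raise, image_eq_zero_of_notMem_tsupport hx]

theorem hasCompactSupport_of_zero {E F : Type*} [Zero E] [Zero F] {f : Chart → E}
    (h : HasCompactSupport f) {g : Chart → F} (hg : ∀ x, f x = 0 → g x = 0) :
    HasCompactSupport g :=
  HasCompactSupport.intro h fun x hx => hg x (image_eq_zero_of_notMem_tsupport hx)

/-! ### Integrations by parts -/

theorem integral_pd_mul {f g : Chart → ℝ} (i : Fin 3) (hf : ContDiff ℝ 1 f) (hg : ContDiff ℝ 1 g)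
    (hc : HasCompactSupport f ∨ HasCompactSupport g) :
    ∫ x, pd i f x * g x = -∫ x, f x * pd i g x := by
  have h : ∫ x, pd i (fun y => f y * g y) x = 0 :=
    integral_pd_eq_zero (hf.mul hg) (hc.elim (fun h => h.mul_right) fun h => h.mul_left)
  have e : pd i (fun y => f y * g y) = fun x => pd i f x * g x + f x * pd i g x :=
    funext fun x => pd_mul (hf.differentiable one_ne_zero x) (hg.differentiable one_ne_zero x)
  have hi1 : Integrable (fun x => pd i f x * g x) :=
    ((continuous_pd hf).mul hg.continuous).integrable_of_hasCompactSupport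
      (hc.elim (fun h => (HasCompactSupport.pd h).mul_right) fun h => h.mul_left)
  have hi2 : Integrable (fun x => f x * pd i g x) :=
    (hf.continuous.mul (continuous_pd hg)).integrable_of_hasCompactSupport
      (hc.elim (fun h => h.mul_right) fun h => (HasCompactSupport.pd h).mul_left)
  rw [e, integral_add hi1 hi2] at h
  linarith

/-- The connection is torsion free: `Γ` is symmetric in its lower indices and drops out of the
antisymmetrisation. -/
theorem alt_covDeriv (A : Chart → Cov) (x : Chart) (i : Fin 3) :
    alt (S.covDeriv A x) i = ∑ j, ∑ k, perm i j k * pd j (fun y => A y k) x := by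
  simp only [alt, covDeriv, Fin.sum_univ_three]
  simp only [S.christoffel_symm _ 1 0, S.christoffel_symm _ 2 0, S.christoffel_symm _ 2 1]
  fin_cases i <;> simp [perm] <;> ring

theorem sqrtDet_mul_ip_curl (x : Chart) (a : Cov) (X : Chart → Cov) :
    S.sqrtDet x * S.ip x a (S.curl X x)
      = ∑ i, ∑ j, ∑ k, perm i j k * (a i * pd j (fun y => X y k) x) := by
  rw [curl, sqrtDet_mul_ip_epsContract]
  simp only [alt_covDeriv, Finset.mul_sum]
  refine Finset.sum_congr rfl fun i _ => Finset.sum_congr rfl fun j _ =>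
    Finset.sum_congr rfl fun k _ => by ring

theorem sqrtDet_mul_trace_covDeriv {A : Chart → Cov} (hA : ContDiff ℝ ∞ A) (x : Chart) :
    S.sqrtDet x * S.trace x (S.covDeriv A x)
      = ∑ i, pd i (fun y => S.sqrtDet y * S.raise y (A y) i) x := by
  have dh : DifferentiableAt ℝ S.sqrtDet x := S.contDiff_sqrtDet.differentiable two_ne_zero x
  have dA := fun j => (contDiff_raise (S := S) hA j).differentiable two_ne_zero x
  simp only [pd_mul dh (dA _), pd_sqrtDet, trace_eq, raiseSnd_covDeriv hA, Fin.sum_univ_three]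
  simp only [S.christoffel_symm _ 1 0, S.christoffel_symm _ 2 0, S.christoffel_symm _ 2 1]
  ring

/-- The exact divergence in `weitzenbock_pointwise` integrates to zero; its field is linear in `A`,
so compact support of `A` alone is enough. -/
theorem integral_form_test {A X : Chart → Cov} (hA : ContDiff ℝ ∞ A) (hX : ContDiff ℝ ∞ X)
    (hc : HasCompactSupport A) :
    S.form (-1) A (S.covDeriv A) X (S.covDeriv X) = ∫ x, (S.ip x (S.curl A x) (S.curl X x)
        + S.trace x (S.covDeriv A x) * S.trace x (S.covDeriv X x)) ∂S.vol := by
  have hrA := fun j => contDiff_raise (S := S) hA j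
  have hcd := fun i j => contDiff_covDeriv (S := S) hX i j
  have hV : ∀ i, ContDiff ℝ 1 (fun y => S.sqrtDet y * S.weitzenbockField A X i y) := by
    intro i
    have h1 := fun j => (hrA j).of_le (m := 1) (by norm_num)
    have h2 := S.contDiff_sqrtDet.of_le (m := 1) (by norm_num)
    have h3 := fun a b => (S.contDiff_hinv a b).of_le (m := 1) (by norm_num)
    unfold weitzenbockField
    simp only [raiseSnd]
    fun_prop
  have hVc : ∀ i, HasCompactSupport (fun y => S.sqrtDet y * S.weitzenbockField A X i y) := by
    intro i
    refine hasCompactSupport_of_zero hc fun x hx => ?_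
    simp [weitzenbockField, hx, raise]
  have h0 : ∫ x, ∑ i, pd i (fun y => S.sqrtDet y * S.weitzenbockField A X i y) x = 0 := by
    rw [integral_finsetSum _ fun i _ =>
      (continuous_pd (hV i)).integrable_of_hasCompactSupport (HasCompactSupport.pd (hVc i))]
    exact Finset.sum_eq_zero fun i _ => integral_pd_eq_zero (hV i) (hVc i)
  have hint : Integrable
      (fun x => ∑ i, pd i (fun y => S.sqrtDet y * S.weitzenbockField A X i y) x) :=
    integrable_finsetSum _ fun i _ =>
      (continuous_pd (hV i)).integrable_of_hasCompactSupport (HasCompactSupport.pd (hVc i))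
  have hcA := hasCompactSupport_covDeriv (S := S) hc
  have hcontA := continuous_covDeriv (S := S) hA
  have hcontX := continuous_covDeriv (S := S) hX
  have hint2 : Integrable (fun x => S.sqrtDet x * (S.ip₂ x (S.covDeriv A x) (S.covDeriv X x)
      + S.ricForm x (A x) (X x))) := by
    refine Continuous.integrable_of_hasCompactSupport ?_ ?_
    · have h1 := S.continuous_sqrtDet
      have h2 := S.continuous_hinv
      have h3 := S.continuous_ricci
      have h4 := hA.continuous
      have h5 := hX.continuous
      simp only [ip₂, ricForm, raise]
      fun_prop
    · refine HasCompactSupport.mul_left (HasCompactSupport.add ?_ ?_)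
      · exact hasCompactSupport_of_zero hcA fun x hx => by simp [ip₂, hx]
      · exact hasCompactSupport_of_zero hc fun x hx => by simp [ricForm, raise, hx]
  rw [form, integral_vol, integral_vol]
  have e : ∀ x, S.sqrtDet x * S.formDensity (-1) A (S.covDeriv A) X (S.covDeriv X) x
      = S.sqrtDet x * (S.ip₂ x (S.covDeriv A x) (S.covDeriv X x) + S.ricForm x (A x) (X x)) := by
    intro x; simp [formDensity]
  have e2 : ∀ x, S.sqrtDet x * (S.ip x (S.curl A x) (S.curl X x)
      + S.trace x (S.covDeriv A x) * S.trace x (S.covDeriv X x))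
      = S.sqrtDet x * (S.ip₂ x (S.covDeriv A x) (S.covDeriv X x) + S.ricForm x (A x) (X x))
        - ∑ i, pd i (fun y => S.sqrtDet y * S.weitzenbockField A X i y) x := by
    intro x; rw [weitzenbock_pointwise hA hX x]; ring
  simp only [e, e2]
  rw [integral_sub hint2 hint, h0, sub_zero]

/-- Integration by parts costs a sign, and exchanging `i` and `k` in `[ijk]` costs another: this is
the self-adjointness of the curl, free of the metric. -/
theorem integral_perm {A X : Chart → Cov} (hA : ContDiff ℝ 1 A) (hX : ContDiff ℝ 1 X)
    (hc : HasCompactSupport A ∨ HasCompactSupport X) :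
    ∫ x, ∑ i, ∑ j, ∑ k, perm i j k * (A x i * pd j (fun y => X y k) x)
      = ∫ x, ∑ i, ∑ j, ∑ k, perm i j k * (X x i * pd j (fun y => A y k) x) := by
  have hA' := contDiff_pi.1 hA
  have hX' := contDiff_pi.1 hX
  have hI : ∀ i j k, Integrable (fun x => perm i j k * (A x i * pd j (fun y => X y k) x)) := by
    intro i j k
    refine (Continuous.integrable_of_hasCompactSupport
      ((hA' i).continuous.mul (continuous_pd (hX' k))) ?_).const_mul _
    exact hc.elim (fun h => (hasCompactSupport_comp h i).mul_right)
      fun h => (HasCompactSupport.pd (hasCompactSupport_comp h k)).mul_left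
  have hI' : ∀ i j k, Integrable (fun x => perm i j k * (X x i * pd j (fun y => A y k) x)) := by
    intro i j k
    refine (Continuous.integrable_of_hasCompactSupport
      ((hX' i).continuous.mul (continuous_pd (hA' k))) ?_).const_mul _
    exact hc.elim (fun h => (HasCompactSupport.pd (hasCompactSupport_comp h k)).mul_left)
      fun h => (hasCompactSupport_comp h i).mul_right
  have e : ∀ i j k, ∫ x, A x i * pd j (fun y => X y k) x
      = -∫ x, X x k * pd j (fun y => A y i) x := by
    intro i j k
    rw [show (∫ x, X x k * pd j (fun y => A y i) x) = ∫ x, pd j (fun y => A y i) x * X x k from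
      integral_congr_ae (Eventually.of_forall fun x => mul_comm _ _),
      integral_pd_mul j (hA' i) (hX' k)
        (hc.imp (fun h => hasCompactSupport_comp h i) fun h => hasCompactSupport_comp h k), neg_neg]
  have ex : ∀ F : Fin 3 → Fin 3 → Fin 3 → Chart → ℝ, (∀ i j k, Integrable (F i j k)) →
      ∫ x, ∑ i, ∑ j, ∑ k, F i j k x = ∑ i, ∑ j, ∑ k, ∫ x, F i j k x := by
    intro F hF
    rw [integral_finsetSum _ fun i _ => integrable_finsetSum _ fun j _ =>
      integrable_finsetSum _ fun k _ => hF i j k]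
    refine Finset.sum_congr rfl fun i _ => ?_
    rw [integral_finsetSum _ fun j _ => integrable_finsetSum _ fun k _ => hF i j k]
    refine Finset.sum_congr rfl fun j _ => ?_
    rw [integral_finsetSum _ fun k _ => hF i j k]
  rw [ex _ hI, ex _ hI']
  simp only [integral_const_mul, e]
  simp [Fin.sum_univ_three, perm]
  ring

theorem integral_ip_curl_comm {A X : Chart → Cov} (hA : ContDiff ℝ ∞ A) (hX : ContDiff ℝ ∞ X)
    (hc : HasCompactSupport A ∨ HasCompactSupport X) :
    ∫ x, S.ip x (A x) (S.curl X x) ∂S.vol = ∫ x, S.ip x (S.curl A x) (X x) ∂S.vol := by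
  simp only [S.ip_symm _ (S.curl A _) _, integral_vol, sqrtDet_mul_ip_curl]
  exact integral_perm (contDiff_infty.1 hA 1) (contDiff_infty.1 hX 1) hc

/-- The differential of a function, as a `1`-form. -/
noncomputable def grad (ψ : Chart → ℝ) (x : Chart) : Cov := fun i => pd i ψ x

theorem contDiff_grad {ψ : Chart → ℝ} (hψ : ContDiff ℝ ∞ ψ) : ContDiff ℝ ∞ (grad ψ) :=
  contDiff_pi.2 fun _ => contDiff_pd hψ (by simp)

theorem hasCompactSupport_grad {ψ : Chart → ℝ} (hψ : HasCompactSupport ψ) :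
    HasCompactSupport (grad ψ) := by
  refine HasCompactSupport.intro (hψ.fderiv (𝕜 := ℝ)) fun x hx => ?_
  funext i
  simp [grad, pd, image_eq_zero_of_notMem_tsupport hx]

theorem alt_covDeriv_grad {ψ : Chart → ℝ} (hψ : ContDiff ℝ ∞ ψ) (x : Chart) :
    alt (S.covDeriv (grad ψ) x) = 0 := by
  funext i
  rw [alt_covDeriv]
  have h2 : ContDiff ℝ 2 ψ := contDiff_infty.1 hψ 2
  have e : ∀ j k, pd j (fun y => grad ψ y k) x = pd k (fun y => grad ψ y j) x := fun j k =>
    pd_comm h2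
  simp only [Fin.sum_univ_three, e 1 0, e 2 0, e 2 1]
  fin_cases i <;> simp [perm] <;> ring

theorem curl_grad {ψ : Chart → ℝ} (hψ : ContDiff ℝ ∞ ψ) (x : Chart) :
    S.curl (grad ψ) x = 0 := by
  funext i
  simp [curl, epsContract_eq, alt_covDeriv_grad hψ]

/-- Moving the curl onto `dψ` gives `∇ × dψ = 0`. This orthogonality removes the cross term in the
energy identity `form_add_grad_eq`. -/
theorem integral_ip_curl_grad {A : Chart → Cov} {ψ : Chart → ℝ} (hA : ContDiff ℝ ∞ A)
    (hψ : ContDiff ℝ ∞ ψ) (hc : HasCompactSupport A) :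
    ∫ x, S.ip x (S.curl A x) (grad ψ x) ∂S.vol = 0 := by
  rw [← integral_ip_curl_comm hA (contDiff_grad hψ) (Or.inl hc)]
  simp [curl_grad hψ, ip]

theorem integral_ip_grad {A : Chart → Cov} {ψ : Chart → ℝ} (hA : ContDiff ℝ ∞ A)
    (hψ : ContDiff ℝ ∞ ψ) (hc : HasCompactSupport A ∨ HasCompactSupport ψ) :
    ∫ x, S.ip x (A x) (grad ψ x) ∂S.vol
      = -∫ x, S.trace x (S.covDeriv A x) * ψ x ∂S.vol := by
  have hψ1 : ContDiff ℝ 1 ψ := contDiff_infty.1 hψ 1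
  have hV : ∀ i, ContDiff ℝ 1 (fun y => S.sqrtDet y * S.raise y (A y) i) := fun i =>
    (S.contDiff_sqrtDet.mul (contDiff_raise hA i)).of_le (by norm_num)
  have hc' : ∀ i, HasCompactSupport (fun y => S.sqrtDet y * S.raise y (A y) i) ∨
      HasCompactSupport ψ := fun i => hc.imp (fun h => (hasCompactSupport_raise h i).mul_left) id
  have e1 : ∀ x, S.sqrtDet x * S.ip x (A x) (grad ψ x)
      = ∑ i, (S.sqrtDet x * S.raise x (A x) i) * pd i ψ x := by
    intro x
    rw [ip_symm, ip_eq_raise, Finset.mul_sum]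
    refine Finset.sum_congr rfl fun i _ => ?_
    simp only [grad]; ring
  have e2 : ∀ x, S.sqrtDet x * (S.trace x (S.covDeriv A x) * ψ x)
      = ∑ i, pd i (fun y => S.sqrtDet y * S.raise y (A y) i) x * ψ x := by
    intro x; rw [← mul_assoc, sqrtDet_mul_trace_covDeriv hA, Finset.sum_mul]
  simp only [integral_vol, e1, e2]
  rw [integral_finsetSum, integral_finsetSum, ← Finset.sum_neg_distrib]
  · refine Finset.sum_congr rfl fun i _ => ?_
    rw [integral_pd_mul i (hV i) hψ1 (hc' i), neg_neg]
  · intro i _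
    exact ((continuous_pd (hV i)).mul hψ1.continuous).integrable_of_hasCompactSupport
      ((hc' i).elim (fun h => (HasCompactSupport.pd h).mul_right) fun h => h.mul_left)
  · intro i _
    exact ((hV i).continuous.mul (continuous_pd hψ1)).integrable_of_hasCompactSupport
      ((hc' i).elim (fun h => h.mul_right) fun h => (HasCompactSupport.pd h).mul_left)

end InitialSurface

namespace InitialSurface

variable (S : InitialSurface)

/-! ### Uniform equivalence of `h` with the Euclidean metric -/

theorem ip_pos (x : Chart) {a : Cov} (ha : a ≠ 0) : 0 < S.ip x a a := by
  have h := (S.h_posDef x).inv.dotProduct_mulVec_pos ha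
  have e : S.ip x a a = star a ⬝ᵥ (S.h x)⁻¹.mulVec a := by
    simp only [ip, hinv, dotProduct, Matrix.mulVec, Finset.mul_sum, star_trivial, Pi.star_apply]
    refine Finset.sum_congr rfl fun i _ => Finset.sum_congr rfl fun j _ => by ring
  rwa [e]

theorem ip_smul_smul (x : Chart) (s t : ℝ) (a b : Cov) :
    S.ip x (s • a) (t • b) = s * t * S.ip x a b := by
  simp only [ip, Finset.mul_sum, Pi.smul_apply, smul_eq_mul]
  refine Finset.sum_congr rfl fun i _ => Finset.sum_congr rfl fun j _ => by ring

theorem ip_nonneg (x : Chart) (a : Cov) : 0 ≤ S.ip x a a := by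
  rcases eq_or_ne a 0 with rfl | h
  · simp [ip]
  · exact (S.ip_pos x h).le

theorem norm_sq_le_sum (a : Cov) : ‖a‖ ^ 2 ≤ ∑ i, a i ^ 2 := by
  have h0 : 0 ≤ ∑ i, a i ^ 2 := by positivity
  have : ‖a‖ ≤ Real.sqrt (∑ i, a i ^ 2) := by
    refine (pi_norm_le_iff_of_nonneg (Real.sqrt_nonneg _)).2 fun i => ?_
    rw [Real.norm_eq_abs]
    exact Real.abs_le_sqrt (Finset.single_le_sum (f := fun i => a i ^ 2)
      (fun _ _ => sq_nonneg _) (Finset.mem_univ i))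
  calc ‖a‖ ^ 2 ≤ Real.sqrt (∑ i, a i ^ 2) ^ 2 := by gcongr
    _ = _ := Real.sq_sqrt h0

theorem sum_le_norm_sq (a : Cov) : ∑ i, a i ^ 2 ≤ 3 * ‖a‖ ^ 2 := by
  have : ∀ i, a i ^ 2 ≤ ‖a‖ ^ 2 := fun i => by
    rw [← sq_abs, ← Real.norm_eq_abs]
    gcongr
    exact norm_le_pi_norm a i
  calc ∑ i, a i ^ 2 ≤ ∑ _i : Fin 3, ‖a‖ ^ 2 := Finset.sum_le_sum fun i _ => this i
    _ = _ := by simp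

theorem sum_sq_unit {x : Chart} (hx : x ≠ 0) : ∑ i, (x i / ‖x‖) ^ 2 = 1 := by
  have h := EuclideanSpace.real_norm_sq_eq x
  have hn : ‖x‖ ≠ 0 := norm_ne_zero_iff.2 hx
  simp only [div_pow, ← Finset.sum_div, ← h]
  field_simp

theorem norm_pos_of_le {x : Chart} (hx : S.r₀ ≤ ‖x‖) : 0 < ‖x‖ := S.r₀_pos.trans_le hx

theorem one_sub_pos {x : Chart} (hx : S.r₀ ≤ ‖x‖) : 0 < 1 - 2 * S.m / ‖x‖ := by
  rw [sub_pos, div_lt_one (S.norm_pos_of_le hx)]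
  exact S.horizon_lt.trans_le hx

/-- In the exterior `h` is a rank-one perturbation `1 + (w - 1) n ⊗ n` of the identity with `|n| =
1` and `w = (1 - t)⁻¹`; since `w(1 - t) = 1`, its inverse is `1 - t n ⊗ n`. -/
theorem hinv_schwarzschild {x : Chart} (hx : S.r₀ ≤ ‖x‖) (i j : Fin 3) :
    S.hinv x i j = (if i = j then 1 else 0) - 2 * S.m / ‖x‖ * (x i / ‖x‖) * (x j / ‖x‖) := by
  have ht := (S.one_sub_pos hx).ne'
  have hn := sum_sq_unit (norm_pos_iff.1 (S.norm_pos_of_le hx))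
  have hh := S.h_schwarzschild x hx
  set t := 2 * S.m / ‖x‖
  set n : Fin 3 → ℝ := fun i => x i / ‖x‖ with hndef
  have hn' : ∑ i, n i ^ 2 = 1 := hn
  have key : S.h x * (Matrix.of fun i j => (if i = j then 1 else 0) - t * n i * n j) = 1 := by
    ext i j
    have e : (1 - t)⁻¹ * (1 - t) = 1 := inv_mul_cancel₀ ht
    simp only [Matrix.mul_apply, Matrix.of_apply, hh, Matrix.one_apply]
    set w := (1 - t)⁻¹
    change ∑ k, ((if i = k then (1 : ℝ) else 0) + (w - 1) * n i * n k)
      * ((if k = j then (1 : ℝ) else 0) - t * n k * n j) = _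
    have : ∑ k, ((if i = k then (1 : ℝ) else 0) + (w - 1) * n i * n k)
      * ((if k = j then (1 : ℝ) else 0) - t * n k * n j)
      = (if i = j then 1 else 0) + (w - 1) * n i * n j - t * n i * n j
        - (w - 1) * t * n i * n j * ∑ k, n k ^ 2 := by
      simp only [Fin.sum_univ_three]
      fin_cases i <;> fin_cases j <;> simp <;> ring
    rw [this, hn']
    linear_combination (n i * n j) * e
  have := Matrix.inv_eq_right_inv key
  rw [hinv, this]
  rfl

theorem det_schwarzschild {x : Chart} (hx : S.r₀ ≤ ‖x‖) :
    (S.h x).det = (1 - 2 * S.m / ‖x‖)⁻¹ := by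
  have hn := sum_sq_unit (norm_pos_iff.1 (S.norm_pos_of_le hx))
  have hh := S.h_schwarzschild x hx
  rw [Matrix.det_fin_three]
  simp only [hh]
  simp only [Fin.sum_univ_three] at hn
  simp
  linear_combination ((1 - 2 * S.m / ‖x‖)⁻¹ - 1) * hn

theorem ip_schwarzschild {x : Chart} (hx : S.r₀ ≤ ‖x‖) (a : Cov) :
    S.ip x a a = ∑ i, a i ^ 2 - 2 * S.m / ‖x‖ * (∑ i, x i / ‖x‖ * a i) ^ 2 := by
  simp only [ip, S.hinv_schwarzschild hx, Fin.sum_univ_three]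
  simp
  ring

theorem neg_le_ratio {x : Chart} (hx : S.r₀ ≤ ‖x‖) :
    -(2 * |S.m| / S.r₀) ≤ 2 * S.m / ‖x‖ ∧ 2 * S.m / ‖x‖ ≤ max 0 (2 * S.m / S.r₀) := by
  have h0 := S.r₀_pos
  have h1 := S.norm_pos_of_le hx
  constructor
  · have e : |2 * S.m / ‖x‖| ≤ 2 * |S.m| / S.r₀ := by
      rw [abs_div, abs_mul, abs_of_pos h1, abs_two]
      gcongr
    exact (abs_le.1 e).1
  · rcases le_or_gt S.m 0 with hm | hm
    · exact le_max_of_le_left (div_nonpos_of_nonpos_of_nonneg (by linarith) h1.le)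
    · exact le_max_of_le_right (by gcongr)

/-- Over the ball of radius `r₀` the bounds come from compactness of ball times unit sphere and
homogeneity; outside they come from the explicit exterior metric and the Cauchy–Schwarz inequality
for the radial component. -/
theorem exists_ip_bounds :
    ∃ c K : ℝ, 0 < c ∧ 0 < K ∧ ∀ x a, c * ‖a‖ ^ 2 ≤ S.ip x a a ∧ S.ip x a a ≤ K * ‖a‖ ^ 2 := by
  have h0 := S.r₀_pos
  have hcpt : IsCompact (Metric.closedBall (0 : Chart) S.r₀ ×ˢ Metric.sphere (0 : Cov) 1) :=
    (isCompact_closedBall _ _).prod (isCompact_sphere _ _)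
  have hne : (Metric.closedBall (0 : Chart) S.r₀ ×ˢ Metric.sphere (0 : Cov) 1).Nonempty := by
    refine ⟨(0, fun _ => 1), by simp [h0.le], ?_⟩
    simp only [mem_sphere_zero_iff_norm]
    exact (pi_norm_const (1 : ℝ)).trans (by simp)
  have hcont : Continuous (fun p : Chart × Cov => S.ip p.1 p.2 p.2) := by
    have h2 := fun i j => (S.continuous_hinv i j).comp (continuous_fst (X := Chart) (Y := Cov))
    simp only [Function.comp_def] at h2
    unfold ip
    fun_prop
  obtain ⟨p, hp, hpm⟩ := hcpt.exists_isMinOn hne hcont.continuousOn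
  obtain ⟨q, hq, hqm⟩ := hcpt.exists_isMaxOn hne hcont.continuousOn
  have hp0 : 0 < S.ip p.1 p.2 p.2 := S.ip_pos _ (by
    intro h; have := hp.2; simp [h] at this)
  -- The radial eigenvalue of `h⁻¹` is `1 - 2m/|x|`. It is at least `1 - τ > 0` by `horizon_lt`; the
  -- maximum with `0` covers negative mass.
  set τ := max 0 (2 * S.m / S.r₀)
  have hτ : 0 < 1 - τ := by
    rw [sub_pos, max_lt_iff]
    exact ⟨one_pos, (div_lt_one h0).2 S.horizon_lt⟩
  -- For negative mass the radial eigenvalue exceeds `1`, but not `K₁`. The factor `3` used with it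
  -- compares the Euclidean norm with the sup norm on `Cov`.
  set K₁ := 1 + 2 * |S.m| / S.r₀
  have hK₁ : 0 < K₁ := by positivity
  have hq0 : 0 < S.ip q.1 q.2 q.2 := lt_of_lt_of_le hp0 (hqm hp)
  refine ⟨min (S.ip p.1 p.2 p.2) (1 - τ), max (S.ip q.1 q.2 q.2) (K₁ * 3), lt_min hp0 hτ,
    lt_max_of_lt_left hq0, fun x a => ?_⟩
  rcases le_or_gt S.r₀ ‖x‖ with hx | hx
  · have hn := sum_sq_unit (norm_pos_iff.1 (S.norm_pos_of_le hx))
    have hcs := Finset.sum_mul_sq_le_sq_mul_sq Finset.univ (fun i => x i / ‖x‖) a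
    rw [hn, one_mul] at hcs
    rw [S.ip_schwarzschild hx]
    obtain ⟨h1, h2⟩ := S.neg_le_ratio hx
    have h3 := norm_sq_le_sum a
    have h4 := sum_le_norm_sq a
    have hsq := sq_nonneg (∑ i, x i / ‖x‖ * a i)
    have hτ0 : 0 ≤ τ := le_max_left _ _
    have hm0 : 0 ≤ 2 * |S.m| / S.r₀ := by positivity
    constructor
    · calc _ ≤ (1 - τ) * ∑ i, a i ^ 2 := by
            refine mul_le_mul (min_le_right _ _) h3 (sq_nonneg _) hτ.le
        _ ≤ _ := by
          have := mul_le_mul h2 hcs hsq hτ0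
          linarith
    · calc _ ≤ K₁ * ∑ i, a i ^ 2 := by
            have h5 := mul_le_mul_of_nonneg_right h1 hsq
            have h6 := mul_le_mul_of_nonneg_left hcs hm0
            simp only [K₁]; linarith
        _ ≤ K₁ * 3 * ‖a‖ ^ 2 := by
            rw [mul_assoc]; exact mul_le_mul_of_nonneg_left h4 hK₁.le
        _ ≤ _ := mul_le_mul_of_nonneg_right (le_max_right _ _) (sq_nonneg _)
  · rcases eq_or_ne a 0 with rfl | ha
    · simp [ip]
    have hna : 0 < ‖a‖ := norm_pos_iff.2 ha
    have hmem : (x, ‖a‖⁻¹ • a) ∈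
        Metric.closedBall (0 : Chart) S.r₀ ×ˢ Metric.sphere (0 : Cov) 1 := by
      refine ⟨by simpa using hx.le, ?_⟩
      simp [norm_smul, hna.ne']
    have e : S.ip x a a = S.ip x (‖a‖⁻¹ • a) (‖a‖⁻¹ • a) * ‖a‖ ^ 2 := by
      rw [ip_smul_smul]; field_simp
    rw [e]
    have h1 := isMinOn_iff.1 hpm _ hmem
    have h2 := isMaxOn_iff.1 hqm _ hmem
    dsimp only at h1 h2
    exact ⟨mul_le_mul_of_nonneg_right ((min_le_left _ _).trans h1) (sq_nonneg _),
      mul_le_mul_of_nonneg_right (le_max_of_le_left h2) (sq_nonneg _)⟩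

theorem exists_sqrtDet_bounds :
    ∃ c K : ℝ, 0 < c ∧ 0 < K ∧ ∀ x, c ≤ S.sqrtDet x ∧ S.sqrtDet x ≤ K := by
  have h0 := S.r₀_pos
  have hcpt : IsCompact (Metric.closedBall (0 : Chart) S.r₀) := isCompact_closedBall _ _
  have hne : (Metric.closedBall (0 : Chart) S.r₀).Nonempty := ⟨0, by simp [h0.le]⟩
  obtain ⟨p, hp, hpm⟩ := hcpt.exists_isMinOn hne S.continuous_sqrtDet.continuousOn
  obtain ⟨q, hq, hqm⟩ := hcpt.exists_isMaxOn hne S.continuous_sqrtDet.continuousOn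
  set τ := max 0 (2 * S.m / S.r₀)
  have hτ : 0 < 1 - τ := by
    rw [sub_pos, max_lt_iff]
    exact ⟨one_pos, (div_lt_one h0).2 S.horizon_lt⟩
  set K₁ := 1 + 2 * |S.m| / S.r₀
  have hK₁ : 0 < K₁ := by positivity
  refine ⟨min (S.sqrtDet p) (Real.sqrt K₁⁻¹), max (S.sqrtDet q) (Real.sqrt (1 - τ)⁻¹),
    lt_min (S.sqrtDet_pos p) (Real.sqrt_pos.2 (inv_pos.2 hK₁)),
    lt_max_of_lt_left (S.sqrtDet_pos q), fun x => ?_⟩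
  rcases le_or_gt S.r₀ ‖x‖ with hx | hx
  · obtain ⟨h1, h2⟩ := S.neg_le_ratio hx
    have h3 := S.one_sub_pos hx
    have hs : S.sqrtDet x = Real.sqrt (1 - 2 * S.m / ‖x‖)⁻¹ := by
      rw [sqrtDet, S.det_schwarzschild hx]
    rw [hs]
    constructor
    · refine (min_le_right _ _).trans (Real.sqrt_le_sqrt ?_)
      gcongr
      simp only [K₁]; linarith
    · refine le_max_of_le_right (Real.sqrt_le_sqrt ?_)
      gcongr
  · have hm : x ∈ Metric.closedBall (0 : Chart) S.r₀ := by simpa using hx.le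
    exact ⟨(min_le_left _ _).trans (hpm hm), le_max_of_le_left (hqm hm)⟩

theorem ip_add_left (x : Chart) (a b c : Cov) : S.ip x (a + b) c = S.ip x a c + S.ip x b c := by
  simp only [ip, ← Finset.sum_add_distrib, Pi.add_apply]
  refine Finset.sum_congr rfl fun i _ => Finset.sum_congr rfl fun j _ => by ring

theorem ip_sub_left (x : Chart) (a b c : Cov) : S.ip x (a - b) c = S.ip x a c - S.ip x b c := by
  simp only [ip, ← Finset.sum_sub_distrib, Pi.sub_apply]
  refine Finset.sum_congr rfl fun i _ => Finset.sum_congr rfl fun j _ => by ring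

theorem ip_sub_right (x : Chart) (a b c : Cov) : S.ip x a (b - c) = S.ip x a b - S.ip x a c := by
  rw [ip_symm, ip_sub_left, S.ip_symm x b, S.ip_symm x c]

theorem ip_sq_le (x : Chart) (a b : Cov) : S.ip x a b ^ 2 ≤ S.ip x a a * S.ip x b b := by
  rcases eq_or_ne b 0 with rfl | hb
  · simp [ip]
  have hq := S.ip_pos x hb
  have h := S.ip_nonneg x (S.ip x b b • a - S.ip x a b • b)
  rw [ip_sub_left, ip_sub_right, ip_sub_right] at h
  simp only [ip_smul_smul, S.ip_symm x b a] at h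
  have : 0 ≤ S.ip x b b * (S.ip x a a * S.ip x b b - S.ip x a b ^ 2) := by linarith
  linarith [nonneg_of_mul_nonneg_right this hq]

theorem exists_hinv_bound : ∃ K : ℝ, 0 < K ∧ ∀ x i j, |S.hinv x i j| ≤ K := by
  obtain ⟨c, K, hc, hK, h⟩ := S.exists_ip_bounds
  refine ⟨K, hK, fun x i j => ?_⟩
  have e : S.hinv x i j = S.ip x (Pi.single i 1) (Pi.single j 1) := by
    simp [ip, Pi.single_apply]
  have hn : ∀ i : Fin 3, ‖(Pi.single i 1 : Cov)‖ = 1 := by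
    intro i
    rw [Pi.norm_single]; simp
  have h1 : ∀ i, S.ip x (Pi.single i 1) (Pi.single i 1) ≤ K := fun i => by
    have := (h x (Pi.single i 1)).2
    rwa [hn, one_pow, mul_one] at this
  rw [e]
  refine abs_le_of_sq_le_sq ((S.ip_sq_le x _ _).trans ?_) hK.le
  rw [sq]
  exact mul_le_mul (h1 i) (h1 j) (S.ip_nonneg _ _) hK.le

open scoped ComplexOrder MatrixOrder Matrix.Norms.L2Operator in
-- An orthonormal frame at `x`: the positive matrix `h⁻¹` is of the form `BᵀB`, by the
-- characterisation of positive elements of a C⋆-algebra.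
theorem exists_frame (x : Chart) : ∃ B : Matrix (Fin 3) (Fin 3) ℝ,
    ∀ i j, S.hinv x i j = ∑ p, B p i * B p j := by
  obtain ⟨B, hB⟩ := CStarAlgebra.nonneg_iff_eq_star_mul_self.mp (S.h_posDef x).inv.posSemidef.nonneg
  refine ⟨B, fun i j => ?_⟩
  rw [hinv, hB]
  simp [Matrix.mul_apply]

/-- Contracting the second index with an orthonormal frame turns a `2`-tensor into three `1`-forms,
so positivity and norm bounds for `ip₂` follow from those for `ip`. -/
theorem exists_ip₂_eq (x : Chart) : ∃ v : Ten → Fin 3 → Cov,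
    (∀ T U, S.ip₂ x T U = ∑ p, S.ip x (v T p) (v U p)) ∧
    ∀ T i, ∑ p, v T p i ^ 2 = S.ip x (T i) (T i) := by
  obtain ⟨B, hB⟩ := S.exists_frame x
  refine ⟨fun T p i => ∑ j, B p j * T i j, fun T U => ?_, fun T i => ?_⟩
  · simp only [ip₂, ip, hB, Fin.sum_univ_three]; ring
  · simp only [ip, hB, Fin.sum_univ_three]; ring

theorem ip₂_nonneg (x : Chart) (T : Ten) : 0 ≤ S.ip₂ x T T := by
  obtain ⟨v, hv, -⟩ := S.exists_ip₂_eq x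
  rw [hv]
  exact Finset.sum_nonneg fun p _ => S.ip_nonneg _ _

theorem norm_sq_le_sum_ten (T : Ten) : ‖T‖ ^ 2 ≤ ∑ i, ‖T i‖ ^ 2 := by
  have h0 : 0 ≤ ∑ i, ‖T i‖ ^ 2 := by positivity
  have : ‖T‖ ≤ Real.sqrt (∑ i, ‖T i‖ ^ 2) := by
    refine (pi_norm_le_iff_of_nonneg (Real.sqrt_nonneg _)).2 fun i => ?_
    exact Real.le_sqrt_of_sq_le (Finset.single_le_sum (f := fun i => ‖T i‖ ^ 2)
      (fun _ _ => sq_nonneg _) (Finset.mem_univ i))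
  calc ‖T‖ ^ 2 ≤ Real.sqrt (∑ i, ‖T i‖ ^ 2) ^ 2 := by gcongr
    _ = _ := Real.sq_sqrt h0

theorem exists_ip₂_bounds :
    ∃ c K : ℝ, 0 < c ∧ 0 < K ∧ ∀ x T, c * ‖T‖ ^ 2 ≤ S.ip₂ x T T ∧ S.ip₂ x T T ≤ K * ‖T‖ ^ 2 := by
  obtain ⟨c, K, hc, hK, h⟩ := S.exists_ip_bounds
  refine ⟨c / 3 * c, K * (9 * K), by positivity, by positivity, fun x T => ?_⟩
  obtain ⟨v, hv, hv'⟩ := S.exists_ip₂_eq x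
  rw [hv]
  have hs : ∑ p, ∑ i, v T p i ^ 2 = ∑ i, S.ip x (T i) (T i) := by
    rw [Finset.sum_comm]; exact Finset.sum_congr rfl fun i _ => hv' T i
  constructor
  · calc c / 3 * c * ‖T‖ ^ 2 ≤ c / 3 * ∑ i, c * ‖T i‖ ^ 2 := by
          rw [← Finset.mul_sum, mul_assoc]; gcongr; exact norm_sq_le_sum_ten T
      _ ≤ c / 3 * ∑ i, S.ip x (T i) (T i) := by
          gcongr with i; exact (h x _).1
      _ = ∑ p, c / 3 * ∑ i, v T p i ^ 2 := by rw [← hs, Finset.mul_sum]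
      _ ≤ _ := by
          gcongr with p
          calc _ ≤ c / 3 * (3 * ‖v T p‖ ^ 2) := by gcongr; exact sum_le_norm_sq _
            _ = c * ‖v T p‖ ^ 2 := by ring
            _ ≤ _ := (h x _).1
  · calc _ ≤ ∑ p, K * ∑ i, v T p i ^ 2 := by
          gcongr with p
          exact (h x _).2.trans (by gcongr; exact norm_sq_le_sum _)
      _ = K * ∑ i, S.ip x (T i) (T i) := by rw [← hs, Finset.mul_sum]
      _ ≤ K * ∑ _i : Fin 3, K * ‖T‖ ^ 2 := by
          gcongr with i
          exact (h x _).2.trans (by gcongr; exact norm_le_pi_norm T i)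
      _ ≤ _ := by simp; nlinarith [mul_nonneg hK.le (sq_nonneg ‖T‖)]

end InitialSurface

/-! ### Hardy's inequality -/

section Hardy

theorem pd_coord (i j : Fin 3) (p : Chart) (x : Chart) :
    pd i (fun y : Chart => y j - p j) x = if i = j then 1 else 0 := by
  have h : HasFDerivAt (fun y : Chart => y j - p j) (EuclideanSpace.proj (𝕜 := ℝ) j) x :=
    ((EuclideanSpace.proj (𝕜 := ℝ) j : Chart →L[ℝ] ℝ).hasFDerivAt).sub_const _
  rw [pd, h.fderiv]
  simp [eq_comm]

theorem pd_inv {f : Chart → ℝ} {x : Chart} (i : Fin 3) (hf : DifferentiableAt ℝ f x)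
    (h0 : f x ≠ 0) : pd i (fun y => (f y)⁻¹) x = -pd i f x / f x ^ 2 := by
  simp only [pd]
  have h : HasFDerivAt (fun y => (f y)⁻¹) _ x := (hasDerivAt_inv h0).comp_hasFDerivAt x hf.hasFDerivAt
  rw [h.fderiv]
  simp; ring

/-- The functions `u` and `w` stand for `|X|²` and a multiple of `|∇X|`. In dimension three the
field `V = (x - p)/q` with `q = |x - p|² + ε²` has `div V = 3/q - 2|x - p|²/q² ≥ 1/q`, and
integrating `div(uV)` to zero bounds `∫ u/q` by `∫ |du| |V|`. The regularisation `ε` makes `V`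
smooth at `p`. -/
theorem hardy_regularized {u w : Chart → ℝ} (p : Chart) {ε : ℝ} (hε : 0 < ε)
    (hu : ContDiff ℝ 1 u) (huc : HasCompactSupport u) (hu0 : ∀ x, 0 ≤ u x)
    (hw : Continuous w) (hwc : HasCompactSupport w)
    (hd : ∀ x i, |pd i u x| ≤ 2 * Real.sqrt (u x) * w x) :
    ∫ x, u x / (‖x - p‖ ^ 2 + ε ^ 2) ≤ 36 * ∫ x, w x ^ 2 := by
  set q : Chart → ℝ := fun x => ‖x - p‖ ^ 2 + ε ^ 2 with hq
  have hq0 : ∀ x, 0 < q x := fun x => by positivity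
  have hqs : ∀ x, q x = ∑ j, (x j - p j) ^ 2 + ε ^ 2 := fun x => by
    simp [hq, EuclideanSpace.real_norm_sq_eq]
  have hqs' : q = fun x => ∑ j, (x j - p j) * (x j - p j) + ε ^ 2 := by
    funext x; rw [hqs]; simp [sq]
  have hco : ∀ j, ContDiff ℝ 1 (fun y : Chart => y j - p j) := fun j => by fun_prop
  have hqc : ContDiff ℝ 1 q := by rw [hqs']; fun_prop
  have hV : ∀ i, ContDiff ℝ 1 (fun y : Chart => (y i - p i) * (q y)⁻¹) := fun i =>
    (hco i).mul (hqc.inv fun x => (hq0 x).ne')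
  have hpq : ∀ i x, pd i q x = 2 * (x i - p i) := by
    intro i x
    have hdj : ∀ j, DifferentiableAt ℝ (fun y : Chart => y j - p j) x := fun j =>
      (hco j).differentiable one_ne_zero x
    rw [hqs', pd_add (DifferentiableAt.fun_sum fun j _ => (hdj j).fun_mul (hdj j))
      (differentiableAt_const _), pd_const, pd_sum _ fun j _ => (hdj j).fun_mul (hdj j)]
    simp only [pd_mul (hdj _) (hdj _), pd_coord, Finset.sum_add_distrib]
    simp; ring
  have hpV : ∀ x, ∑ i, pd i (fun y : Chart => (y i - p i) * (q y)⁻¹) x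
      = 1 / q x + 2 * ε ^ 2 / q x ^ 2 := by
    intro x
    have hqx := (hq0 x).ne'
    have hdq : DifferentiableAt ℝ q x := hqc.differentiable one_ne_zero x
    have e : ∀ i, pd i (fun y : Chart => (y i - p i) * (q y)⁻¹) x
        = 1 / q x - 2 * (x i - p i) ^ 2 / q x ^ 2 := by
      intro i
      rw [pd_mul ((hco i).differentiable one_ne_zero x) (hdq.fun_inv hqx), pd_coord,
        pd_inv i hdq hqx, hpq]
      simp; ring
    simp only [e, Finset.sum_sub_distrib, ← Finset.sum_div, ← Finset.mul_sum]
    rw [show ∑ j, (x j - p j) ^ 2 = q x - ε ^ 2 by rw [hqs]; ring]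
    simp
    field_simp
    ring
  have hF : ∀ i, ContDiff ℝ 1 (fun y => u y * ((y i - p i) * (q y)⁻¹)) := fun i => hu.mul (hV i)
  have hFc : ∀ i, HasCompactSupport (fun y => u y * ((y i - p i) * (q y)⁻¹)) := fun i =>
    huc.mul_right
  have hFi : ∀ i, Integrable (pd i (fun y => u y * ((y i - p i) * (q y)⁻¹))) := fun i =>
    (continuous_pd (hF i)).integrable_of_hasCompactSupport (HasCompactSupport.pd (hFc i))
  have h0 : ∫ x, ∑ i, pd i (fun y => u y * ((y i - p i) * (q y)⁻¹)) x = 0 := by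
    rw [integral_finsetSum _ fun i _ => hFi i]
    exact Finset.sum_eq_zero fun i _ => integral_pd_eq_zero (hF i) (hFc i)
  have hi1 : Integrable (fun x => u x / q x) :=
    (hu.continuous.div hqc.continuous fun x => (hq0 x).ne').integrable_of_hasCompactSupport
      (by simpa only [div_eq_mul_inv] using huc.mul_right)
  have hi2 : Integrable (fun x => w x ^ 2) :=
    (hw.pow 2).integrable_of_hasCompactSupport
      (by simpa only [sq] using hwc.mul_right)
  -- With `v = √u` and `s = √q`, the three components of `du · V` are at least `-6vw/s` in total,
  -- and `½ (v/s - 6w)² ≥ 0` absorbs this at the cost of half of `u/q` and `18 w²`. Hence the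
  -- constant `36`.
  have hpt : ∀ x, (1 / 2) * (u x / q x) - 18 * w x ^ 2
      ≤ ∑ i, pd i (fun y => u y * ((y i - p i) * (q y)⁻¹)) x := by
    intro x
    have hs : 0 < Real.sqrt (q x) := Real.sqrt_pos.2 (hq0 x)
    have hsq : Real.sqrt (q x) ^ 2 = q x := Real.sq_sqrt (hq0 x).le
    have husq : Real.sqrt (u x) ^ 2 = u x := Real.sq_sqrt (hu0 x)
    set s := Real.sqrt (q x)
    set v := Real.sqrt (u x)
    have hv : 0 ≤ v := Real.sqrt_nonneg _
    simp only [pd_mul (hu.differentiable one_ne_zero x) ((hV _).differentiable one_ne_zero x),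
      Finset.sum_add_distrib, ← Finset.mul_sum, hpV]
    have hb : ∀ i, -(2 * v * w x * (1 / s)) ≤ pd i u x * ((x i - p i) * (q x)⁻¹) := by
      intro i
      have h1 : |(x i - p i) * (q x)⁻¹| ≤ 1 / s := by
        have : |x i - p i| ≤ s := by
          refine Real.abs_le_sqrt ?_
          rw [hqs]
          have := Finset.single_le_sum (f := fun j => (x j - p j) ^ 2)
            (fun _ _ => sq_nonneg _) (Finset.mem_univ i)
          have := sq_nonneg ε
          linarith
        rw [abs_mul, abs_inv, abs_of_pos (hq0 x), ← hsq]
        calc _ ≤ s * (s ^ 2)⁻¹ := by gcongr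
          _ = 1 / s := by field_simp
      have h2 : |pd i u x * ((x i - p i) * (q x)⁻¹)| ≤ 2 * v * w x * (1 / s) := by
        rw [abs_mul]
        exact mul_le_mul (hd x i) h1 (abs_nonneg _) ((abs_nonneg _).trans (hd x i))
      exact (abs_le.1 h2).1
    have hb' : -(6 * v * w x * (1 / s)) ≤ ∑ i, pd i u x * ((x i - p i) * (q x)⁻¹) := by
      rw [Fin.sum_univ_three]
      linarith [hb 0, hb 1, hb 2]
    have h3 : 0 ≤ u x * (2 * ε ^ 2 / q x ^ 2) := mul_nonneg (hu0 x) (by positivity)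
    have h4 : u x / q x = (v * (1 / s)) ^ 2 := by
      rw [mul_pow, husq, div_pow, hsq]; ring
    have h5 : 0 ≤ (v * (1 / s) - 6 * w x) ^ 2 := sq_nonneg _
    have h6 : u x * (1 / q x + 2 * ε ^ 2 / q x ^ 2)
        = u x / q x + u x * (2 * ε ^ 2 / q x ^ 2) := by ring
    rw [h6, h4]
    nlinarith
  have h1 := integral_mono (((hi1.const_mul (1 / 2)).sub (hi2.const_mul 18)))
    (integrable_finsetSum _ fun i _ => hFi i) hpt
  rw [h0] at h1
  simp only [Pi.sub_apply] at h1
  rw [integral_sub (hi1.const_mul _) (hi2.const_mul _), integral_const_mul,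
    integral_const_mul] at h1
  linarith

/-- Fatou's lemma with `ε = 1/(n + 1)`. -/
theorem hardy_general {u w : Chart → ℝ} (p : Chart)
    (hu : ContDiff ℝ 1 u) (huc : HasCompactSupport u) (hu0 : ∀ x, 0 ≤ u x)
    (hw : Continuous w) (hwc : HasCompactSupport w)
    (hd : ∀ x i, |pd i u x| ≤ 2 * Real.sqrt (u x) * w x) :
    ∫⁻ x, ENNReal.ofReal (u x / ‖x - p‖ ^ 2) ≤ 36 * ∫⁻ x, ENNReal.ofReal (w x ^ 2) := by
  have hi2 : Integrable (fun x => w x ^ 2) :=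
    (hw.pow 2).integrable_of_hasCompactSupport (by simpa only [sq] using hwc.mul_right)
  have hm : ∀ e : ℝ, Measurable fun x : Chart => ENNReal.ofReal (u x / (‖x - p‖ ^ 2 + e ^ 2)) := by
    intro e
    have := hu.continuous
    have : Measurable u := this.measurable
    fun_prop
  have hpt : ∀ x, ENNReal.ofReal (u x / ‖x - p‖ ^ 2) ≤ liminf (fun n : ℕ =>
      ENNReal.ofReal (u x / (‖x - p‖ ^ 2 + (1 / ((n : ℝ) + 1)) ^ 2))) atTop := by
    intro x
    rcases eq_or_ne (‖x - p‖) 0 with h | h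
    -- At `x = p` the quotient is a division by zero, whose value is `0`.
    · simp [h]
    refine le_of_eq (Tendsto.liminf_eq ?_).symm
    refine ENNReal.tendsto_ofReal (tendsto_const_nhds.div ?_ (by positivity))
    have := (tendsto_one_div_add_atTop_nhds_zero_nat (𝕜 := ℝ)).pow 2
    simpa using this.const_add (‖x - p‖ ^ 2)
  calc _ ≤ ∫⁻ x, liminf (fun n : ℕ =>
      ENNReal.ofReal (u x / (‖x - p‖ ^ 2 + (1 / ((n : ℝ) + 1)) ^ 2))) atTop := lintegral_mono hpt
    _ ≤ liminf (fun n : ℕ => ∫⁻ x,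
      ENNReal.ofReal (u x / (‖x - p‖ ^ 2 + (1 / ((n : ℝ) + 1)) ^ 2))) atTop :=
        lintegral_liminf_le fun n => hm _
    _ ≤ liminf (fun _ : ℕ => 36 * ∫⁻ x, ENNReal.ofReal (w x ^ 2)) atTop := by
        refine liminf_le_liminf (Eventually.of_forall fun n => ?_)
        have hε : (0 : ℝ) < 1 / ((n : ℝ) + 1) := by positivity
        have h := hardy_regularized p hε hu huc hu0 hw hwc hd
        rw [← ofReal_integral_eq_lintegral_ofReal, ← ofReal_integral_eq_lintegral_ofReal hi2]
        · calc _ ≤ ENNReal.ofReal (36 * ∫ x, w x ^ 2) := ENNReal.ofReal_le_ofReal h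
            _ = _ := by rw [ENNReal.ofReal_mul (by norm_num)]; simp
        · exact Eventually.of_forall fun x => sq_nonneg _
        · refine Continuous.integrable_of_hasCompactSupport ?_
            (InitialSurface.hasCompactSupport_of_zero huc fun x hx => by simp [hx])
          exact hu.continuous.div (by fun_prop) fun x => by positivity
        · exact Eventually.of_forall fun x => div_nonneg (hu0 x) (by positivity)
    _ = _ := by simp

end Hardy

namespace InitialSurface

variable (S : InitialSurface)

variable {S}

/-- The derivatives of `h⁻¹` cancel the Christoffel terms by metric compatibility. -/
theorem pd_ip {X : Chart → Cov} (hX : ContDiff ℝ ∞ X) (i : Fin 3) (x : Chart) :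
    pd i (fun y => S.ip y (X y) (X y)) x = 2 * S.ip x (S.covDeriv X x i) (X x) := by
  have hd := fun a b => S.differentiableAt_hinv a b x
  have hX' := fun a => differentiableAt_comp hX a x
  simp only [ip]
  rw [pd_sum _ fun a _ => by fun_prop]
  have e : ∀ a, pd i (fun y => ∑ b, S.hinv y a b * X y a * X y b) x
      = ∑ b, ((pd i (fun y => S.hinv y a b) x * X x a + S.hinv x a b * pd i (fun y => X y a) x)
        * X x b + S.hinv x a b * X x a * pd i (fun y => X y b) x) := by
    intro a
    rw [pd_sum _ fun b _ => by fun_prop]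
    refine Finset.sum_congr rfl fun b _ => ?_
    rw [pd_mul (by fun_prop) (hX' b), pd_mul (hd a b) (hX' a)]
  simp only [e]
  simp only [pd_hinv, covDeriv, Fin.sum_univ_three]
  rw [S.hinv_symm x 1 0, S.hinv_symm x 2 0, S.hinv_symm x 2 1]
  ring

theorem contDiff_ip {X : Chart → Cov} (hX : ContDiff ℝ ∞ X) :
    ContDiff ℝ 1 (fun y => S.ip y (X y) (X y)) := by
  have h1 := fun a b => (S.contDiff_hinv a b).of_le (m := 1) (by norm_num)
  have h2 := fun i => contDiff_infty.1 (contDiff_pi.1 hX i) 1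
  simp only [ip]
  fun_prop

variable (S) in
/-- Hardy's inequality for test forms. -/
theorem exists_hardy_forms (p : Chart) : ∃ K : ℝ, 0 < K ∧ ∀ X : testForms,
    ∫⁻ x, ENNReal.ofReal (S.ip x ((X : Chart → Cov) x) ((X : Chart → Cov) x) / ‖x - p‖ ^ 2)
      ≤ ENNReal.ofReal K * ∫⁻ x, ENNReal.ofReal (S.ip₂ x (S.covDeriv X x) (S.covDeriv X x)) := by
  obtain ⟨c, K, hc, hK, hip⟩ := S.exists_ip_bounds
  obtain ⟨c₂, K₂, hc₂, hK₂, hip₂⟩ := S.exists_ip₂_bounds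
  refine ⟨36 * (K / c₂), by positivity, fun X => ?_⟩
  have hX := testForms_contDiff X
  have hXc := testForms_compact X
  have hcont : Continuous fun x => Real.sqrt K * ‖S.covDeriv X x‖ :=
    continuous_const.mul (continuous_covDeriv hX).norm
  have hcs := hasCompactSupport_covDeriv (S := S) hXc
  -- Kato's inequality in squared form: with `u = |X|²` and `w = √K ‖∇X‖`, Cauchy–Schwarz applied to
  -- `∂_i|X|² = 2⟨∇_iX, X⟩` gives the hypothesis `|∂_i u| ≤ 2√u w` without dividing by `|X|`.
  have h := hardy_general (u := fun x => S.ip x ((X : Chart → Cov) x) ((X : Chart → Cov) x))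
    (w := fun x => Real.sqrt K * ‖S.covDeriv X x‖) p (contDiff_ip hX)
    (hasCompactSupport_of_zero hXc fun x hx => by simp [ip, hx])
    (fun x => S.ip_nonneg x _) hcont
    (hasCompactSupport_of_zero hcs fun x hx => by simp [hx])
    (fun x i => ?_)
  · refine h.trans ?_
    rw [ENNReal.ofReal_mul (by norm_num), mul_assoc,
      ← lintegral_const_mul' (ENNReal.ofReal (K / c₂)) _ ENNReal.ofReal_ne_top]
    · rw [ENNReal.ofReal_ofNat]
      refine mul_le_mul_right (lintegral_mono fun x => ?_) _
      rw [← ENNReal.ofReal_mul (by positivity)]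
      refine ENNReal.ofReal_le_ofReal ?_
      rw [mul_pow, Real.sq_sqrt hK.le, div_mul_eq_mul_div, mul_div_assoc]
      gcongr
      rw [le_div_iff₀ hc₂, mul_comm]
      exact (hip₂ x _).1
  · rw [pd_ip hX, abs_mul, abs_two]
    suffices h : |S.ip x (S.covDeriv X x i) ((X : Chart → Cov) x)|
        ≤ Real.sqrt (S.ip x ((X : Chart → Cov) x) ((X : Chart → Cov) x))
          * (Real.sqrt K * ‖S.covDeriv X x‖) by linarith
    have h1 := S.ip_sq_le x (S.covDeriv X x i) ((X : Chart → Cov) x)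
    have h2 : S.ip x (S.covDeriv X x i) (S.covDeriv X x i) ≤ K * ‖S.covDeriv X x‖ ^ 2 :=
      (hip x _).2.trans (by gcongr; exact norm_le_pi_norm _ i)
    refine Real.abs_le_sqrt (h1.trans (mul_le_mul_of_nonneg_right h2 (S.ip_nonneg x _)))
      |>.trans (le_of_eq ?_)
    rw [Real.sqrt_mul (by positivity), Real.sqrt_mul hK.le, Real.sqrt_sq (norm_nonneg _)]
    ring

/-- Hardy's inequality for test functions. -/
theorem hardy_functions (p : Chart) {f : Chart → ℝ} (hf : ContDiff ℝ ∞ f)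
    (hfc : HasCompactSupport f) :
    ∫⁻ x, ENNReal.ofReal (f x ^ 2 / ‖x - p‖ ^ 2)
      ≤ 36 * ∫⁻ x, ENNReal.ofReal (‖grad f x‖ ^ 2) := by
  have hf1 := contDiff_infty.1 hf 1
  refine hardy_general p (hf1.pow 2) (hasCompactSupport_of_zero hfc fun x hx => by simp [hx])
    (fun x => sq_nonneg _) (contDiff_grad hf).continuous.norm
    (hasCompactSupport_of_zero (hasCompactSupport_grad hfc) fun x hx => by simp [hx])
    fun x i => ?_
  have hd := hf1.differentiable one_ne_zero x
  simp only [sq]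
  rw [pd_mul hd hd, Real.sqrt_mul_self_eq_abs, show pd i f x * f x + f x * pd i f x
    = 2 * (f x * pd i f x) by ring, abs_mul, abs_mul, abs_two, mul_assoc]
  gcongr
  exact norm_le_pi_norm (grad f x) i

end InitialSurface

namespace InitialSurface

variable {S : InitialSurface} {r : Chart → ℝ}

/-! ### The radius function and the best constant in Hardy's inequality -/

theorem IsRadius.nonneg (hr : S.IsRadius r) (x : Chart) : 0 ≤ r x := by
  obtain ⟨c, hc, p, h⟩ := hr.lower_bound
  exact le_trans (by positivity) (h x)

theorem IsRadius.ae_pos (hr : S.IsRadius r) : ∀ᵐ x, 0 < r x := by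
  obtain ⟨c, hc, p, h⟩ := hr.lower_bound
  have : ∀ᵐ x : Chart, x ≠ p := by
    rw [ae_iff]; simp
  filter_upwards [this] with x hx
  have : 0 < ‖x - p‖ := norm_pos_iff.2 (sub_ne_zero.2 hx)
  exact lt_of_lt_of_le (by positivity) (h x)

theorem lintegral_energy_ne_top (X : testForms) :
    ∫⁻ x, ENNReal.ofReal (S.ip₂ x (S.covDeriv X x) (S.covDeriv X x)) ∂S.vol ≠ ⊤ := by
  have hX := testForms_contDiff X
  have hXc := testForms_compact X
  have h : Integrable (fun x => S.ip₂ x (S.covDeriv X x) (S.covDeriv X x)) S.vol := by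
    rw [integrable_vol_iff]
    refine Continuous.integrable_of_hasCompactSupport ?_ ?_
    · have h1 := S.continuous_sqrtDet
      have h2 := S.continuous_hinv
      have h3 := continuous_covDeriv (S := S) hX
      unfold ip₂
      fun_prop
    · exact hasCompactSupport_of_zero (hasCompactSupport_covDeriv (S := S) hXc) fun x hx => by
        simp [hx, ip₂]
  rw [← ofReal_integral_eq_lintegral_ofReal h (Eventually.of_forall fun x => S.ip₂_nonneg x _)]
  exact ENNReal.ofReal_ne_top

theorem hardyConstants_nonempty (hr : S.IsRadius r) : (S.hardyConstants r).Nonempty := by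
  obtain ⟨c, hc, p, h⟩ := hr.lower_bound
  obtain ⟨K, hK, hH⟩ := S.exists_hardy_forms p
  obtain ⟨a, b, ha, hb, hab⟩ := S.exists_sqrtDet_bounds
  -- The constant `c` compares `r` with `|x - p|`, the constants `a` and `b` compare the volume
  -- measure with Lebesgue measure, and `K` is the Hardy constant for Lebesgue measure.
  refine ⟨b / c ^ 2 * (K / a), by positivity, fun X => ?_⟩
  set X' : Chart → Cov := X.1
  rw [lintegral_vol, lintegral_vol]
  calc _ ≤ ∫⁻ x, ENNReal.ofReal (b / c ^ 2) * ENNReal.ofReal (S.ip x (X' x) (X' x) / ‖x - p‖ ^ 2) := by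
        refine lintegral_mono_ae ?_
        have : ∀ᵐ x : Chart, x ≠ p := by rw [ae_iff]; simp
        filter_upwards [this] with x hx
        have hx' : 0 < ‖x - p‖ := norm_pos_iff.2 (sub_ne_zero.2 hx)
        rw [← ENNReal.ofReal_mul (S.sqrtDet_pos x).le, ← ENNReal.ofReal_mul (by positivity)]
        refine ENNReal.ofReal_le_ofReal ?_
        have hip := S.ip_nonneg x (X' x)
        calc _ ≤ b * (S.ip x (X' x) (X' x) / (c * ‖x - p‖) ^ 2) := by
              have h1 := (hab x).2
              have h2 := h x
              have h3 : 0 ≤ S.ip x (X' x) (X' x) / r x ^ 2 := by positivity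
              gcongr
          _ = _ := by field_simp
    _ = ENNReal.ofReal (b / c ^ 2) * ∫⁻ x, ENNReal.ofReal (S.ip x (X' x) (X' x) / ‖x - p‖ ^ 2) :=
        lintegral_const_mul' _ _ ENNReal.ofReal_ne_top
    _ ≤ ENNReal.ofReal (b / c ^ 2) * (ENNReal.ofReal K *
        ∫⁻ x, ENNReal.ofReal (S.ip₂ x (S.covDeriv X x) (S.covDeriv X x))) := by
        gcongr; exact hH X
    _ = ENNReal.ofReal (b / c ^ 2 * (K / a)) * ∫⁻ x, ENNReal.ofReal a *
        ENNReal.ofReal (S.ip₂ x (S.covDeriv X x) (S.covDeriv X x)) := by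
        rw [lintegral_const_mul' _ _ ENNReal.ofReal_ne_top, ← mul_assoc, ← mul_assoc,
          ← ENNReal.ofReal_mul (by positivity), ← ENNReal.ofReal_mul (by positivity)]
        congr 2
        field_simp
    _ ≤ _ := by
        gcongr with x
        exact (hab x).1

/-- Each test form imposes a closed condition on the constant, because its energy is finite; so the
infimum of the admissible constants is itself admissible. -/
theorem exists_isLeast_hardyConstants (hr : S.IsRadius r) :
    ∃ C, IsLeast (S.hardyConstants r) C := by
  have hne := hardyConstants_nonempty hr
  have hbdd : BddBelow (S.hardyConstants r) := ⟨0, fun C hC => hC.1⟩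
  refine ⟨sInf (S.hardyConstants r), ⟨le_csInf hne fun C hC => hC.1, fun X => ?_⟩,
    fun C hC => csInf_le hbdd hC⟩
  have ht : Tendsto (fun n : ℕ => ENNReal.ofReal (sInf (S.hardyConstants r) + 1 / ((n : ℝ) + 1)) *
      ∫⁻ x, ENNReal.ofReal (S.ip₂ x (S.covDeriv X x) (S.covDeriv X x)) ∂S.vol) atTop
      (𝓝 (ENNReal.ofReal (sInf (S.hardyConstants r)) *
      ∫⁻ x, ENNReal.ofReal (S.ip₂ x (S.covDeriv X x) (S.covDeriv X x)) ∂S.vol)) := by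
    refine ENNReal.Tendsto.mul_const (ENNReal.tendsto_ofReal ?_)
      (Or.inr (lintegral_energy_ne_top X))
    simpa using (tendsto_one_div_add_atTop_nhds_zero_nat (𝕜 := ℝ)).const_add
      (sInf (S.hardyConstants r))
  refine ge_of_tendsto' ht fun n => ?_
  obtain ⟨C, hC, hlt⟩ := exists_lt_of_csInf_lt hne
    (lt_add_of_pos_right (sInf (S.hardyConstants r)) (by positivity : 0 < 1 / ((n : ℝ) + 1)))
  refine (hC.2 X).trans ?_
  gcongr

/-- With constant zero every test form would vanish almost everywhere, which a bump function
refutes. Positivity is needed because `0 · ∞ = 0` in `ℝ≥0∞`: without it `Cδ < 1` would not exclude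
`δ = ∞`. -/
theorem pos_of_mem_hardyConstants (hr : S.IsRadius r) {C : ℝ} (hC : C ∈ S.hardyConstants r) :
    0 < C := by
  refine lt_of_le_of_ne hC.1 fun h0 => ?_
  have hb : ContDiffBump (0 : Chart) := ⟨1, 2, one_pos, one_lt_two⟩
  set X : Chart → Cov := fun x _ => hb x with hXdef
  have hX : ContDiff ℝ ∞ X := contDiff_pi.2 fun _ => hb.contDiff
  have hXc : HasCompactSupport X :=
    hasCompactSupport_of_zero hb.hasCompactSupport fun x hx => by funext i; simp [hXdef, hx]
  have h := hC.2 ⟨X, hX, hXc⟩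
  rw [← h0, ENNReal.ofReal_zero, zero_mul, nonpos_iff_eq_zero] at h
  have hm : Measurable fun x => S.ip x (X x) (X x) := by
    have h2 := S.continuous_hinv
    have h3 := hX.continuous
    have : Continuous fun x => S.ip x (X x) (X x) := by unfold ip; fun_prop
    exact this.measurable
  have hmr : Measurable r := hr.continuous.measurable
  rw [lintegral_eq_zero_iff (by fun_prop)] at h
  have h' := S.ae_vol_iff.1 h
  have hae : X =ᵐ[volume] fun _ => 0 := by
    filter_upwards [h', hr.ae_pos] with x hx hrx
    by_contra hne
    have := S.ip_pos x hne
    simp only [Pi.zero_apply, ENNReal.ofReal_eq_zero] at hx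
    exact absurd hx (not_le.2 (by positivity))
  have heq := (hX.continuous.ae_eq_iff_eq volume continuous_const).1 hae
  have := congrFun (congrFun heq 0) 0
  have h1 : hb 0 = 1 := hb.one_of_mem_closedBall (by simp [hb.rIn_pos.le])
  simp [hXdef, h1] at this

end InitialSurface

/-! ### Convergence in `L²` -/

section L2

variable {E F : Type*} [NormedAddCommGroup E] [NormedAddCommGroup F]

/-- Convergence in `L²` with respect to Lebesgue measure. -/
def TendstoL2 (f : ℕ → Chart → E) (g : Chart → E) : Prop :=
  Tendsto (fun n => eLpNorm (f n - g) 2 (volume : Measure Chart)) atTop (𝓝 0)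

theorem TendstoL2.memLp {f : ℕ → Chart → E} {g : Chart → E} (h : TendstoL2 f g)
    (hf : ∀ n, MemLp (f n) 2 volume) (hg : AEStronglyMeasurable g volume) : MemLp g 2 volume := by
  obtain ⟨n, hn⟩ := ((tendsto_order.1 h).2 1 one_pos).exists
  have h1 : MemLp (f n - g) 2 volume := ⟨(hf n).1.sub hg, hn.trans ENNReal.one_lt_top⟩
  have := (hf n).sub h1
  simpa using this

theorem TendstoL2.add {f f' : ℕ → Chart → E} {g g' : Chart → E} (h : TendstoL2 f g)
    (h' : TendstoL2 f' g') (hf : ∀ n, AEStronglyMeasurable (f n - g) volume)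
    (hf' : ∀ n, AEStronglyMeasurable (f' n - g') volume) :
    TendstoL2 (fun n x => f n x + f' n x) (fun x => g x + g' x) := by
  have := Tendsto.add h h'
  rw [add_zero] at this
  refine tendsto_of_tendsto_of_tendsto_of_le_of_le tendsto_const_nhds this (fun _ => zero_le)
    fun n => ?_
  refine le_trans (le_of_eq ?_) (eLpNorm_add_le (hf n) (hf' n) one_le_two)
  congr 1; funext x; simp only [Pi.add_apply, Pi.sub_apply]; abel

theorem TendstoL2.neg {f : ℕ → Chart → E} {g : Chart → E} (h : TendstoL2 f g) :
    TendstoL2 (fun n x => -f n x) (fun x => -g x) := by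
  unfold TendstoL2 at *
  refine h.congr fun n => ?_
  rw [← eLpNorm_neg]
  congr 1; funext x; simp only [Pi.neg_apply, Pi.sub_apply]; abel

theorem TendstoL2.of_le {f : ℕ → Chart → E} {g : Chart → E} {f' : ℕ → Chart → F}
    {g' : Chart → F} (h : TendstoL2 f g) (c : ℝ)
    (hle : ∀ n, ∀ᵐ x, ‖f' n x - g' x‖ ≤ c * ‖f n x - g x‖) : TendstoL2 f' g' := by
  have := ENNReal.Tendsto.const_mul (a := ENNReal.ofReal c) h (Or.inr ENNReal.ofReal_ne_top)
  rw [mul_zero] at this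
  exact tendsto_of_tendsto_of_tendsto_of_le_of_le tendsto_const_nhds this (fun _ => zero_le)
    fun n => eLpNorm_le_mul_eLpNorm_of_ae_le_mul (hle n) 2

theorem exists_tendstoL2 [CompleteSpace E] {f : ℕ → Chart → E} (hf : ∀ n, MemLp (f n) 2 volume)
    (hc : Tendsto (fun n : ℕ × ℕ => eLpNorm (f n.1 - f n.2) 2 (volume : Measure Chart)) atTop
      (𝓝 0)) : ∃ g, MemLp g 2 volume ∧ TendstoL2 f g := by
  have h1 : CauchySeq fun n => (hf n).toLp (f n) := by
    rw [Lp.cauchySeq_Lp_iff_cauchySeq_eLpNorm]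
    refine hc.congr fun n => eLpNorm_congr_ae ?_
    exact (((hf n.1).coeFn_toLp).sub ((hf n.2).coeFn_toLp)).symm
  obtain ⟨g, hg⟩ := cauchySeq_tendsto_of_complete h1
  refine ⟨g, Lp.memLp g, ?_⟩
  rw [Lp.tendsto_Lp_iff_tendsto_eLpNorm'] at hg
  exact hg.congr fun n => eLpNorm_congr_ae (((hf n).coeFn_toLp).sub EventuallyEq.rfl)

theorem TendstoL2.cauchy {f : ℕ → Chart → E} {g : Chart → E} (h : TendstoL2 f g)
    (hf : ∀ n, AEStronglyMeasurable (f n - g) volume) :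
    Tendsto (fun n : ℕ × ℕ => eLpNorm (f n.1 - f n.2) 2 (volume : Measure Chart)) atTop
      (𝓝 0) := by
  have h1 : Tendsto (fun n : ℕ × ℕ => eLpNorm (f n.1 - g) 2 (volume : Measure Chart)
      + eLpNorm (f n.2 - g) 2 (volume : Measure Chart)) atTop (𝓝 (0 + 0)) :=
    (h.comp (tendsto_fst.mono_left prod_atTop_atTop_eq.ge)).add
      (h.comp (tendsto_snd.mono_left prod_atTop_atTop_eq.ge))
  rw [add_zero] at h1
  refine tendsto_of_tendsto_of_tendsto_of_le_of_le tendsto_const_nhds h1 (fun _ => zero_le)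
    fun n => ?_
  refine le_trans (le_of_eq ?_) (eLpNorm_sub_le (hf n.1) (hf n.2) one_le_two)
  congr 1; funext x; simp

theorem eLpNorm_two_sq {μ : Measure Chart} (f : Chart → E) :
    eLpNorm f 2 μ ^ 2 = ∫⁻ x, ENNReal.ofReal (‖f x‖ ^ 2) ∂μ := by
  have h := eLpNorm_nnreal_pow_eq_lintegral (f := f) (μ := μ) (p := 2) two_ne_zero
  simp only [NNReal.coe_ofNat, ENNReal.rpow_ofNat, ENNReal.coe_ofNat] at h
  rw [h]
  refine lintegral_congr fun x => ?_
  rw [ENNReal.ofReal_pow (norm_nonneg _), ofReal_norm]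

theorem le_of_sq_le_mul_sq {a b : ℝ≥0∞} {c K : ℝ} (hc : 0 < c) (hK : 0 ≤ K)
    (h : ENNReal.ofReal c * a ^ 2 ≤ ENNReal.ofReal K * b ^ 2) :
    a ≤ ENNReal.ofReal (Real.sqrt (K / c)) * b := by
  have h1 : a ^ 2 ≤ (ENNReal.ofReal (Real.sqrt (K / c)) * b) ^ 2 := by
    rw [mul_pow, ← ENNReal.ofReal_pow (Real.sqrt_nonneg _), Real.sq_sqrt (by positivity)]
    calc a ^ 2 = ENNReal.ofReal c⁻¹ * (ENNReal.ofReal c * a ^ 2) := by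
          rw [← mul_assoc, ← ENNReal.ofReal_mul (by positivity), inv_mul_cancel₀ hc.ne']; simp
      _ ≤ ENNReal.ofReal c⁻¹ * (ENNReal.ofReal K * b ^ 2) := by gcongr
      _ = _ := by
          rw [← mul_assoc, ← ENNReal.ofReal_mul (by positivity)]
          congr 2; field_simp
  exact (ENNReal.pow_le_pow_left_iff two_ne_zero).1 h1

/-- Exchanges the squared metric integrals of the definitions for Lebesgue norms `eLpNorm`. -/
theorem tendsto_zero_iff_of_sq_bounds {a b : ℕ → ℝ≥0∞} {c K : ℝ} (hc : 0 < c)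
    (h1 : ∀ n, ENNReal.ofReal c * a n ^ 2 ≤ b n) (h2 : ∀ n, b n ≤ ENNReal.ofReal K * a n ^ 2) :
    Tendsto b atTop (𝓝 0) ↔ Tendsto a atTop (𝓝 0) := by
  constructor
  · intro h
    have h3 := ENNReal.Tendsto.const_mul (a := ENNReal.ofReal c⁻¹) h
      (Or.inr ENNReal.ofReal_ne_top)
    rw [mul_zero] at h3
    have h4 : Tendsto (fun n => a n ^ 2) atTop (𝓝 0) := by
      refine tendsto_of_tendsto_of_tendsto_of_le_of_le tendsto_const_nhds h3 (fun _ => zero_le)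
        fun n => ?_
      calc a n ^ 2 = ENNReal.ofReal c⁻¹ * (ENNReal.ofReal c * a n ^ 2) := by
            rw [← mul_assoc, ← ENNReal.ofReal_mul (by positivity), inv_mul_cancel₀ hc.ne']; simp
        _ ≤ _ := by gcongr; exact h1 n
    have h5 := h4.ennrpow_const (1 / 2)
    simp only [← ENNReal.rpow_natCast, ← ENNReal.rpow_mul] at h5
    simpa using h5
  · intro h
    have h3 := ENNReal.Tendsto.const_mul (a := ENNReal.ofReal K) (ENNReal.Tendsto.pow (n := 2) h)
      (Or.inr ENNReal.ofReal_ne_top)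
    rw [zero_pow two_ne_zero, mul_zero] at h3
    exact tendsto_of_tendsto_of_tendsto_of_le_of_le tendsto_const_nhds h3 (fun _ => zero_le) h2

/-! ### Bounded bilinear densities -/

/-- A measurable, essentially bounded family of biadditive forms. -/
structure BddBilin (β : Chart → E → F → ℝ) : Prop where
  sub_left : ∀ x a b c, β x (a - b) c = β x a c - β x b c
  sub_right : ∀ x a b c, β x a (b - c) = β x a b - β x a c
  bound : ∃ K : ℝ, 0 ≤ K ∧ ∀ᵐ x, ∀ a b, |β x a b| ≤ K * ‖a‖ * ‖b‖
  meas : ∀ f g, AEStronglyMeasurable f volume → AEStronglyMeasurable g volume →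
    AEStronglyMeasurable (fun x => β x (f x) (g x)) volume

namespace BddBilin

variable {β : Chart → E → F → ℝ}

theorem exists_eLpNorm_le (hβ : BddBilin β) : ∃ K : ℝ, 0 ≤ K ∧
    ∀ f g, AEStronglyMeasurable f volume → AEStronglyMeasurable g volume →
      eLpNorm (fun x => β x (f x) (g x)) 1 volume
        ≤ ENNReal.ofReal K * (eLpNorm f 2 volume * eLpNorm g 2 volume) := by
  obtain ⟨K, hK, hb⟩ := hβ.bound
  refine ⟨K, hK, fun f g hf hg => ?_⟩
  have h1 := eLpNorm_le_mul_eLpNorm_of_ae_le_mul (μ := volume) (c := K)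
    (f := fun x => β x (f x) (g x)) (g := fun x => ‖f x‖ * ‖g x‖)
    (hb.mono fun x hx => by
      have := hx (f x) (g x)
      rw [norm_mul, norm_norm, norm_norm, Real.norm_eq_abs]
      linarith) 1
  refine h1.trans ?_
  gcongr
  have h2 := eLpNorm_le_eLpNorm_mul_eLpNorm'_of_norm (p := 2) (q := 2) (r := 1) hf.norm hg.norm
    (fun a b : ℝ => a * b) 1 (by simp)
  simpa using h2

theorem integrable (hβ : BddBilin β) {f : Chart → E} {g : Chart → F}
    (hf : MemLp f 2 volume) (hg : MemLp g 2 volume) : Integrable (fun x => β x (f x) (g x)) := by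
  obtain ⟨K, hK, hb⟩ := hβ.exists_eLpNorm_le
  rw [← memLp_one_iff_integrable]
  refine ⟨hβ.meas f g hf.1 hg.1, (hb f g hf.1 hg.1).trans_lt ?_⟩
  exact ENNReal.mul_lt_top ENNReal.ofReal_lt_top (ENNReal.mul_lt_top hf.2 hg.2)

theorem exists_integral_le (hβ : BddBilin β) : ∃ K : ℝ, 0 ≤ K ∧
    ∀ f g, MemLp f 2 volume → MemLp g 2 volume →
      |∫ x, β x (f x) (g x)| ≤ K * ((eLpNorm f 2 volume).toReal * (eLpNorm g 2 volume).toReal) := by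
  obtain ⟨K, hK, hb⟩ := hβ.exists_eLpNorm_le
  refine ⟨K, hK, fun f g hf hg => ?_⟩
  have h := enorm_integral_le_lintegral_enorm (μ := volume) (fun x => β x (f x) (g x))
  rw [← eLpNorm_one_eq_lintegral_enorm] at h
  have h2 := ENNReal.toReal_mono
    (ENNReal.mul_ne_top ENNReal.ofReal_ne_top (ENNReal.mul_ne_top hf.2.ne hg.2.ne))
    (h.trans (hb f g hf.1 hg.1))
  simpa [ENNReal.toReal_ofReal hK] using h2

/-- This carries every integral identity from test forms to `Ḣ¹`: all the forms involved are bounded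
bilinear in `∇A` or in `A/r`, and both converge in `L²`. -/
theorem tendsto_integral (hβ : BddBilin β) {f : ℕ → Chart → E} {f₀ : Chart → E}
    {g : ℕ → Chart → F} {g₀ : Chart → F} (hf : TendstoL2 f f₀) (hg : TendstoL2 g g₀)
    (hfm : ∀ n, MemLp (f n) 2 volume) (hgm : ∀ n, MemLp (g n) 2 volume)
    (hf₀ : MemLp f₀ 2 volume) (hg₀ : MemLp g₀ 2 volume) :
    Tendsto (fun n => ∫ x, β x (f n x) (g n x)) atTop (𝓝 (∫ x, β x (f₀ x) (g₀ x))) := by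
  obtain ⟨K, hK, hb⟩ := hβ.exists_eLpNorm_le
  refine tendsto_integral_of_L1' _ (hβ.meas _ _ hf₀.1 hg₀.1)
    (Eventually.of_forall fun n => hβ.integrable (hfm n) (hgm n)) ?_
  have hlim : Tendsto (fun n => ENNReal.ofReal K * (eLpNorm (f n - f₀) 2 volume *
      (eLpNorm (g n - g₀) 2 volume + eLpNorm g₀ 2 volume))
      + ENNReal.ofReal K * (eLpNorm f₀ 2 volume * eLpNorm (g n - g₀) 2 volume)) atTop
      (𝓝 (ENNReal.ofReal K * (0 * (0 + eLpNorm g₀ 2 volume))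
        + ENNReal.ofReal K * (eLpNorm f₀ 2 volume * 0))) := by
    refine Tendsto.add ?_ ?_
    · refine ENNReal.Tendsto.const_mul ?_ (Or.inr ENNReal.ofReal_ne_top)
      refine ENNReal.Tendsto.mul hf (Or.inr ?_) (Tendsto.add hg tendsto_const_nhds)
        (Or.inr ENNReal.zero_ne_top)
      simpa using hg₀.2.ne
    · refine ENNReal.Tendsto.const_mul ?_ (Or.inr ENNReal.ofReal_ne_top)
      exact ENNReal.Tendsto.const_mul hg (Or.inr hf₀.2.ne)
  simp only [zero_mul, mul_zero, add_zero] at hlim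
  refine tendsto_of_tendsto_of_tendsto_of_le_of_le tendsto_const_nhds hlim (fun _ => zero_le)
    fun n => ?_
  -- The difference is split as `β(fₙ - f₀, gₙ) + β(f₀, gₙ - g₀)`, and each term is estimated by
  -- Cauchy–Schwarz.
  have e : (fun x => β x (f n x) (g n x)) - (fun x => β x (f₀ x) (g₀ x))
      = (fun x => β x ((f n - f₀) x) (g n x)) + (fun x => β x (f₀ x) ((g n - g₀) x)) := by
    funext x
    simp only [Pi.sub_apply, Pi.add_apply, hβ.sub_left, hβ.sub_right]; ring
  rw [e]
  have m1 : AEStronglyMeasurable (f n - f₀) volume := (hfm n).1.sub hf₀.1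
  have m2 : AEStronglyMeasurable (g n - g₀) volume := (hgm n).1.sub hg₀.1
  refine (eLpNorm_add_le (hβ.meas _ _ m1 (hgm n).1) (hβ.meas _ _ hf₀.1 m2) le_rfl).trans ?_
  refine add_le_add ((hb _ _ m1 (hgm n).1).trans ?_) (hb _ _ hf₀.1 m2)
  gcongr
  calc eLpNorm (g n) 2 volume = eLpNorm ((g n - g₀) + g₀) 2 volume := by simp
    _ ≤ _ := eLpNorm_add_le m2 hg₀.1 one_le_two

theorem tendsto_integral_left (hβ : BddBilin β) {f : ℕ → Chart → E} {f₀ : Chart → E}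
    {g₀ : Chart → F} (hf : TendstoL2 f f₀) (hfm : ∀ n, MemLp (f n) 2 volume)
    (hf₀ : MemLp f₀ 2 volume) (hg₀ : MemLp g₀ 2 volume) :
    Tendsto (fun n => ∫ x, β x (f n x) (g₀ x)) atTop (𝓝 (∫ x, β x (f₀ x) (g₀ x))) :=
  hβ.tendsto_integral (g := fun _ => g₀) hf (by simp [TendstoL2]) hfm (fun _ => hg₀) hf₀ hg₀

end BddBilin

end L2

namespace InitialSurface

variable {S : InitialSurface} {r : Chart → ℝ}

/-! ### The homogeneous Sobolev space in weighted `L²` terms -/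

variable (S) in
-- The density `q` is left general so that `1`-forms and `2`-tensors are treated together, and the
-- set `s` is free because `IsH1` uses local convergence.
theorem lintegral_vol_bounds {E : Type*} [NormedAddCommGroup E] {q : Chart → E → ℝ} {c K : ℝ}
    (hc : 0 < c) (hK : 0 < K) (h : ∀ x a, c * ‖a‖ ^ 2 ≤ q x a ∧ q x a ≤ K * ‖a‖ ^ 2) :
    ∃ c' K' : ℝ, 0 < c' ∧ 0 < K' ∧ ∀ s, MeasurableSet s → ∀ F : Chart → E,
      ENNReal.ofReal c' * eLpNorm F 2 (volume.restrict s) ^ 2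
        ≤ ∫⁻ x in s, ENNReal.ofReal (q x (F x)) ∂S.vol ∧
      ∫⁻ x in s, ENNReal.ofReal (q x (F x)) ∂S.vol
        ≤ ENNReal.ofReal K' * eLpNorm F 2 (volume.restrict s) ^ 2 := by
  obtain ⟨a, b, ha, hb, hab⟩ := S.exists_sqrtDet_bounds
  refine ⟨a * c, b * K, by positivity, by positivity, fun s hs F => ?_⟩
  rw [eLpNorm_two_sq, S.setLIntegral_vol _ hs, ← lintegral_const_mul' _ _ ENNReal.ofReal_ne_top,
    ← lintegral_const_mul' _ _ ENNReal.ofReal_ne_top]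
  constructor
  · refine lintegral_mono fun x => ?_
    rw [← ENNReal.ofReal_mul (by positivity), ← ENNReal.ofReal_mul (S.sqrtDet_pos x).le, mul_assoc]
    exact ENNReal.ofReal_le_ofReal
      (mul_le_mul (hab x).1 (h x _).1 (by positivity) (S.sqrtDet_pos x).le)
  · refine lintegral_mono fun x => ?_
    rw [← ENNReal.ofReal_mul (S.sqrtDet_pos x).le,
      ← ENNReal.ofReal_mul (p := b * K) (by positivity), mul_assoc]
    have h0 : 0 ≤ q x (F x) := le_trans (by positivity) (h x _).1
    exact ENNReal.ofReal_le_ofReal (mul_le_mul (hab x).2 (h x _).2 h0 hb.le)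

theorem memLp_covDeriv (X : testForms) : MemLp (S.covDeriv X) 2 volume :=
  (continuous_covDeriv (testForms_contDiff X)).memLp_of_hasCompactSupport
    (hasCompactSupport_covDeriv (testForms_compact X))

theorem memLp_testForm (X : testForms) : MemLp (X : Chart → Cov) 2 volume :=
  (testForms_contDiff X).continuous.memLp_of_hasCompactSupport (testForms_compact X)

theorem covDeriv_sub (X Y : testForms) (x : Chart) :
    S.covDeriv (X - Y : testForms) x = S.covDeriv X x - S.covDeriv Y x := by
  funext i j
  have h1 := differentiableAt_comp (testForms_contDiff X) j x
  have h2 := differentiableAt_comp (testForms_contDiff Y) j x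
  have e : (fun y => ((X - Y : testForms) : Chart → Cov) y j)
      = fun y => (X : Chart → Cov) y j - (Y : Chart → Cov) y j := rfl
  simp only [covDeriv, e, pd_sub h1 h2, Pi.sub_apply]
  have : ∀ k, ((X - Y : testForms) : Chart → Cov) x k
      = (X : Chart → Cov) x k - (Y : Chart → Cov) x k := fun k => rfl
  simp only [this, mul_sub, Finset.sum_sub_distrib]
  ring

theorem covDeriv_add (X Y : testForms) (x : Chart) :
    S.covDeriv (X + Y : testForms) x = S.covDeriv X x + S.covDeriv Y x := by
  have := S.covDeriv_sub (X + Y) Y x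
  rw [add_sub_cancel_right] at this
  rw [this]; abel

theorem covDeriv_smul (c : ℝ) (X : testForms) (x : Chart) :
    S.covDeriv (c • X : testForms) x = c • S.covDeriv X x := by
  funext i j
  have h1 := differentiableAt_comp (testForms_contDiff X) j x
  have e : (fun y => ((c • X : testForms) : Chart → Cov) y j)
      = fun y => c * (X : Chart → Cov) y j := rfl
  have e' : ∀ k, ((c • X : testForms) : Chart → Cov) x k = c * (X : Chart → Cov) x k :=
    fun k => rfl
  simp only [covDeriv, e, pd_const_mul c h1, Pi.smul_apply, smul_eq_mul, e', mul_sub,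
    Finset.mul_sum]
  congr 1
  refine Finset.sum_congr rfl fun _ _ => by ring

theorem ip_div_sq (x : Chart) (a : Cov) (t : ℝ) :
    S.ip x a a / t ^ 2 = S.ip x (t⁻¹ • a) (t⁻¹ • a) := by
  rw [ip_smul_smul]
  rw [div_eq_mul_inv, ← inv_pow]; ring

/-- For questions of convergence any Hardy constant will do; the sharp one matters only for
coercivity. -/
theorem exists_hardy_eLpNorm (hr : S.IsRadius r) : ∃ K : ℝ, ∀ X : testForms,
    eLpNorm (fun x => (r x)⁻¹ • (X : Chart → Cov) x) 2 volume
      ≤ ENNReal.ofReal K * eLpNorm (S.covDeriv X) 2 volume := by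
  obtain ⟨C, hC⟩ := hardyConstants_nonempty hr
  obtain ⟨c, K, hc, hK, h⟩ := S.exists_ip_bounds
  obtain ⟨c', K', hc', hK', h'⟩ := S.lintegral_vol_bounds hc hK h
  obtain ⟨c₂, K₂, hc₂, hK₂, h₂⟩ := S.exists_ip₂_bounds
  obtain ⟨c₂', K₂', hc₂', hK₂', h₂'⟩ := S.lintegral_vol_bounds hc₂ hK₂ h₂
  refine ⟨Real.sqrt (C * K₂' / c'), fun X => ?_⟩
  refine le_of_sq_le_mul_sq hc' (mul_nonneg hC.1 hK₂'.le) ?_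
  have e1 := (h' Set.univ .univ fun x => (r x)⁻¹ • (X : Chart → Cov) x).1
  have e2 := (h₂' Set.univ .univ (S.covDeriv X)).2
  simp only [Measure.restrict_univ] at e1 e2
  refine e1.trans ?_
  have e3 := hC.2 X
  simp only [ip_div_sq] at e3
  refine e3.trans ?_
  rw [ENNReal.ofReal_mul hC.1, mul_assoc]
  gcongr

theorem memLp_weighted (hr : S.IsRadius r) (X : testForms) :
    MemLp (fun x => (r x)⁻¹ • (X : Chart → Cov) x) 2 volume := by
  obtain ⟨K, hK⟩ := exists_hardy_eLpNorm hr
  refine ⟨?_, (hK X).trans_lt (ENNReal.mul_lt_top ENNReal.ofReal_lt_top (memLp_covDeriv X).2)⟩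
  have h1 : Measurable r := hr.continuous.measurable
  have h2 : Measurable (X : Chart → Cov) := (testForms_contDiff X).continuous.measurable
  exact (h1.inv.smul h2).aestronglyMeasurable

/-- `φ` converges to `A` in `Ḣ¹`, with covariant derivatives converging to `G`. -/
structure TendstoH1 (S : InitialSurface) (r : Chart → ℝ) (φ : ℕ → testForms) (A : Chart → Cov)
    (G : Chart → Ten) : Prop where
  deriv : TendstoL2 (fun n => S.covDeriv (φ n)) G
  weighted : TendstoL2 (fun n x => (r x)⁻¹ • (φ n : Chart → Cov) x) (fun x => (r x)⁻¹ • A x)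

theorem exists_weighted_limit (hr : S.IsRadius r) {φ : ℕ → testForms}
    (h : Tendsto (fun n : ℕ × ℕ => eLpNorm (S.covDeriv (φ n.1) - S.covDeriv (φ n.2)) 2
      (volume : Measure Chart)) atTop (𝓝 0)) :
    ∃ a : Chart → Cov, MemLp a 2 volume ∧
      TendstoL2 (fun n x => (r x)⁻¹ • (φ n : Chart → Cov) x) a := by
  obtain ⟨K, hK⟩ := exists_hardy_eLpNorm hr
  refine exists_tendstoL2 (fun n => memLp_weighted hr (φ n)) ?_
  have h' := ENNReal.Tendsto.const_mul (a := ENNReal.ofReal K) h (Or.inr ENNReal.ofReal_ne_top)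
  rw [mul_zero] at h'
  refine tendsto_of_tendsto_of_tendsto_of_le_of_le tendsto_const_nhds h' (fun _ => zero_le)
    fun n => ?_
  have := hK (φ n.1 - φ n.2)
  rw [show S.covDeriv (φ n.1 - φ n.2 : testForms) = S.covDeriv (φ n.1) - S.covDeriv (φ n.2) from
    funext fun x => covDeriv_sub _ _ x] at this
  refine le_trans (le_of_eq ?_) this
  congr 1; funext x
  simp only [Pi.sub_apply, ← smul_sub]
  rfl

theorem isH1_tendsto_iff {A : FormField} {G : TensorField} :
    S.IsH1 A G ↔ ∃ φ : ℕ → testForms, TendstoL2 (fun n => S.covDeriv (φ n)) G ∧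
      ∀ K : Set Chart, IsCompact K → Tendsto (fun n => eLpNorm ((φ n : Chart → Cov) - ⇑A) 2
        (volume.restrict K)) atTop (𝓝 0) := by
  obtain ⟨c, K, hc, hK, h⟩ := S.exists_ip_bounds
  obtain ⟨c', K', hc', hK', h'⟩ := S.lintegral_vol_bounds hc hK h
  obtain ⟨c₂, K₂, hc₂, hK₂, h₂⟩ := S.exists_ip₂_bounds
  obtain ⟨c₂', K₂', hc₂', hK₂', h₂'⟩ := S.lintegral_vol_bounds hc₂ hK₂ h₂
  refine exists_congr fun φ => and_congr ?_ (forall_congr' fun K => forall_congr' fun hcK => ?_)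
  · refine tendsto_zero_iff_of_sq_bounds (K := K₂') hc₂' (fun n => ?_) (fun n => ?_)
    · have := (h₂' Set.univ .univ (S.covDeriv (φ n) - G)).1
      simpa only [Measure.restrict_univ, Pi.sub_apply] using this
    · have := (h₂' Set.univ .univ (S.covDeriv (φ n) - G)).2
      simpa only [Measure.restrict_univ, Pi.sub_apply] using this
  · exact tendsto_zero_iff_of_sq_bounds hc'
      (fun n => (h' K hcK.measurableSet ((φ n : Chart → Cov) - ⇑A)).1)
      (fun n => (h' K hcK.measurableSet ((φ n : Chart → Cov) - ⇑A)).2)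

theorem aestronglyMeasurable_weighted (hr : S.IsRadius r) {A : Chart → Cov}
    (hA : AEStronglyMeasurable A volume) :
    AEStronglyMeasurable (fun x => (r x)⁻¹ • A x) volume := by
  have h1 : Measurable r := hr.continuous.measurable
  exact (h1.inv.aestronglyMeasurable).smul hA

/-- Hardy makes `φₙ/r` Cauchy in `L²`, and its limit must be `A/r` since `r` is bounded on compact
sets and `φₙ → A` there. Conversely, weighted convergence implies local convergence because `r` is
locally bounded. -/
theorem isH1_iff (hr : S.IsRadius r) {A : FormField} {G : TensorField} :
    S.IsH1 A G ↔ ∃ φ : ℕ → testForms, S.TendstoH1 r φ A G := by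
  rw [isH1_tendsto_iff]
  have hloc : ∀ K : Set Chart, IsCompact K → ∃ M : ℝ, ∀ a b : Chart → Cov,
      eLpNorm (a - b) 2 (volume.restrict K) ≤ ENNReal.ofReal M *
        eLpNorm (fun x => (r x)⁻¹ • a x - (r x)⁻¹ • b x) 2 volume := by
    intro K hK
    obtain ⟨M, hM⟩ := hK.bddAbove_image hr.continuous.continuousOn
    refine ⟨M, fun a b => ?_⟩
    calc _ ≤ ENNReal.ofReal M *
        eLpNorm (fun x => (r x)⁻¹ • a x - (r x)⁻¹ • b x) 2 (volume.restrict K) := by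
          refine eLpNorm_le_mul_eLpNorm_of_ae_le_mul ?_ 2
          filter_upwards [ae_restrict_of_ae hr.ae_pos, ae_restrict_mem hK.measurableSet]
            with x hx hxK
          rw [← smul_sub, norm_smul, norm_inv, Real.norm_eq_abs, abs_of_pos hx, Pi.sub_apply]
          have h1 : r x ≤ M := hM (Set.mem_image_of_mem r hxK)
          calc ‖a x - b x‖ = r x * ((r x)⁻¹ * ‖a x - b x‖) := by field_simp
            _ ≤ _ := by gcongr
      _ ≤ _ := by
          gcongr
          exact Measure.restrict_le_self
  constructor
  · rintro ⟨φ, h1, h2⟩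
    refine ⟨φ, h1, ?_⟩
    have hG : AEStronglyMeasurable (G : Chart → Ten) volume := G.aestronglyMeasurable
    obtain ⟨a, ha, hlim⟩ := exists_weighted_limit hr
      (h1.cauchy fun n => (memLp_covDeriv (φ n)).1.sub hG)
    suffices hae : a =ᵐ[volume] fun x => (r x)⁻¹ • A x by
      unfold TendstoL2 at hlim ⊢
      exact hlim.congr fun n => eLpNorm_congr_ae (EventuallyEq.rfl.sub hae)
    have hra : AEStronglyMeasurable (fun x => r x • a x) volume :=
      hr.continuous.aestronglyMeasurable.smul ha.1
    -- On `K` both `A` and `r a` are `L²` limits of `φₙ`, so they agree almost everywhere there.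
    have hzero : ∀ K : Set Chart, IsCompact K → ∀ᵐ x ∂volume.restrict K, A x = r x • a x := by
      intro K hK
      obtain ⟨M, hM⟩ := hloc K hK
      have e : eLpNorm (fun x => A x - r x • a x) 2 (volume.restrict K) = 0 := by
        have hl : Tendsto (fun n => eLpNorm ((φ n : Chart → Cov) - ⇑A) 2 (volume.restrict K)
            + ENNReal.ofReal M * eLpNorm ((fun x => (r x)⁻¹ • (φ n : Chart → Cov) x) - a) 2 volume)
            atTop (𝓝 (0 + ENNReal.ofReal M * 0)) :=
          (h2 K hK).add (ENNReal.Tendsto.const_mul hlim (Or.inr ENNReal.ofReal_ne_top))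
        rw [mul_zero, add_zero] at hl
        refine le_antisymm (ge_of_tendsto' hl fun n => ?_) zero_le
        have m1 : AEStronglyMeasurable ((φ n : Chart → Cov) - ⇑A) (volume.restrict K) :=
          ((memLp_testForm (φ n)).1.sub A.aestronglyMeasurable).restrict
        have m2 : AEStronglyMeasurable ((φ n : Chart → Cov) - fun x => r x • a x)
            (volume.restrict K) := ((memLp_testForm (φ n)).1.sub hra).restrict
        have h3 := hM (φ n : Chart → Cov) (fun x => r x • a x)
        have h4 : eLpNorm (fun x => (r x)⁻¹ • (φ n : Chart → Cov) x - (r x)⁻¹ • (r x • a x)) 2 volume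
            = eLpNorm ((fun x => (r x)⁻¹ • (φ n : Chart → Cov) x) - a) 2 volume := by
          refine eLpNorm_congr_ae ?_
          filter_upwards [hr.ae_pos] with x hx
          simp [smul_smul, hx.ne']
        rw [h4] at h3
        calc _ = eLpNorm (((φ n : Chart → Cov) - fun x => r x • a x)
              - ((φ n : Chart → Cov) - ⇑A)) 2 (volume.restrict K) := by
              congr 1; funext x; simp
          _ ≤ _ := eLpNorm_sub_le m2 m1 one_le_two
          _ ≤ _ := by rw [add_comm]; gcongr
      rw [eLpNorm_eq_zero_iff ((A.aestronglyMeasurable.fun_sub hra).restrict) two_ne_zero] at e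
      filter_upwards [e] with x hx
      simpa [sub_eq_zero] using hx
    -- The chart is exhausted by countably many closed balls.
    have hall : ∀ᵐ x, A x = r x • a x := by
      have : ∀ n : ℕ, ∀ᵐ x ∂volume, x ∈ Metric.closedBall (0 : Chart) n → A x = r x • a x :=
        fun n => (ae_restrict_iff' measurableSet_closedBall).1
          (hzero _ (isCompact_closedBall _ _))
      filter_upwards [ae_all_iff.2 this] with x hx
      obtain ⟨n, hn⟩ := exists_nat_ge ‖x‖
      exact hx n (by simpa using hn)
    filter_upwards [hall, hr.ae_pos] with x hx hx0
    rw [hx, smul_smul, inv_mul_cancel₀ hx0.ne', one_smul]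
  · rintro ⟨φ, h⟩
    refine ⟨φ, h.deriv, fun K hK => ?_⟩
    obtain ⟨M, hM⟩ := hloc K hK
    have hl := ENNReal.Tendsto.const_mul (a := ENNReal.ofReal M) h.weighted
      (Or.inr ENNReal.ofReal_ne_top)
    rw [mul_zero] at hl
    exact tendsto_of_tendsto_of_tendsto_of_le_of_le tendsto_const_nhds hl (fun _ => zero_le)
      fun n => hM (φ n : Chart → Cov) A

theorem IsH1.memLp {A : FormField} {G : TensorField} (h : S.IsH1 A G) : MemLp G 2 volume := by
  obtain ⟨φ, h1, -⟩ := isH1_tendsto_iff.1 h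
  exact h1.memLp (fun n => memLp_covDeriv (φ n)) G.aestronglyMeasurable

theorem IsH1.memLp_weighted (hr : S.IsRadius r) {A : FormField} {G : TensorField}
    (h : S.IsH1 A G) : MemLp (fun x => (r x)⁻¹ • A x) 2 volume := by
  obtain ⟨φ, h1⟩ := (isH1_iff hr).1 h
  exact h1.weighted.memLp (fun n => InitialSurface.memLp_weighted hr (φ n))
    (aestronglyMeasurable_weighted hr A.aestronglyMeasurable)

/-- Completeness of `Ḣ¹` as a space of fields: the limit `a` of `φₙ/r` is turned back into the field
`r a`. -/
theorem exists_isH1 (hr : S.IsRadius r) {φ : ℕ → testForms}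
    (h : Tendsto (fun n : ℕ × ℕ => eLpNorm (S.covDeriv (φ n.1) - S.covDeriv (φ n.2)) 2
      (volume : Measure Chart)) atTop (𝓝 0)) :
    ∃ (A : FormField) (G : TensorField), S.TendstoH1 r φ A G := by
  obtain ⟨a, ha, hlim⟩ := exists_weighted_limit hr h
  obtain ⟨G, hG, hGlim⟩ := exists_tendstoL2 (fun n => memLp_covDeriv (φ n)) h
  have hra : AEStronglyMeasurable (fun x => r x • a x) volume :=
    hr.continuous.aestronglyMeasurable.smul ha.1
  refine ⟨AEEqFun.mk _ hra, AEEqFun.mk G hG.1, ⟨?_, ?_⟩⟩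
  · unfold TendstoL2 at hGlim ⊢
    exact hGlim.congr fun n => eLpNorm_congr_ae (EventuallyEq.rfl.sub (AEEqFun.coeFn_mk G hG.1).symm)
  · unfold TendstoL2 at hlim ⊢
    refine hlim.congr fun n => eLpNorm_congr_ae (EventuallyEq.rfl.sub ?_)
    filter_upwards [AEEqFun.coeFn_mk _ hra, hr.ae_pos] with x hx hx0
    rw [hx, smul_smul, inv_mul_cancel₀ hx0.ne', one_smul]

theorem IsH1.sub (hr : S.IsRadius r) {A A' : FormField} {G G' : TensorField} (h : S.IsH1 A G)
    (h' : S.IsH1 A' G') : S.IsH1 (A - A') (G - G') := by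
  obtain ⟨φ, h1⟩ := (isH1_iff hr).1 h
  obtain ⟨φ', h1'⟩ := (isH1_iff hr).1 h'
  refine (isH1_iff hr).2 ⟨fun n => φ n - φ' n, ⟨?_, ?_⟩⟩
  · have := h1.deriv.add h1'.deriv.neg
      (fun n => (memLp_covDeriv (φ n)).1.sub G.aestronglyMeasurable)
      (fun n => (memLp_covDeriv (φ' n)).1.neg.sub G'.aestronglyMeasurable.neg)
    unfold TendstoL2 at this ⊢
    refine this.congr fun n => eLpNorm_congr_ae ?_
    filter_upwards [AEEqFun.coeFn_sub G G'] with x hx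
    simp only [Pi.sub_apply, hx, covDeriv_sub]; abel
  · have := h1.weighted.add h1'.weighted.neg
      (fun n => (InitialSurface.memLp_weighted hr (φ n)).1.sub
        (aestronglyMeasurable_weighted hr A.aestronglyMeasurable))
      (fun n => (InitialSurface.memLp_weighted hr (φ' n)).1.neg.sub
        (aestronglyMeasurable_weighted hr A'.aestronglyMeasurable).neg)
    unfold TendstoL2 at this ⊢
    refine this.congr fun n => eLpNorm_congr_ae ?_
    filter_upwards [AEEqFun.coeFn_sub A A'] with x hx
    simp only [Pi.sub_apply, hx]
    rw [show ((φ n - φ' n : testForms) : Chart → Cov) x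
      = (φ n : Chart → Cov) x - (φ' n : Chart → Cov) x from rfl]
    simp only [smul_sub]; abel

end InitialSurface

/-! ### Bounded bilinear densities of the geometry. -/

theorem BddBilin.mk_of_continuous {E F : Type*} [NormedAddCommGroup E] [NormedAddCommGroup F]
    [SecondCountableTopology E] [SecondCountableTopology F] {β : Chart → E → F → ℝ}
    (h1 : ∀ x a b c, β x (a - b) c = β x a c - β x b c)
    (h2 : ∀ x a b c, β x a (b - c) = β x a b - β x a c)
    (h3 : ∃ K : ℝ, 0 ≤ K ∧ ∀ᵐ x, ∀ a b, |β x a b| ≤ K * ‖a‖ * ‖b‖)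
    (h4 : Continuous fun p : Chart × E × F => β p.1 p.2.1 p.2.2) : BddBilin β :=
  ⟨h1, h2, h3, fun _ _ hf hg =>
    h4.comp_aestronglyMeasurable (aestronglyMeasurable_id.prodMk (hf.prodMk hg))⟩

theorem abs_sum_le {f : Fin 3 → ℝ} {M : ℝ} (h : ∀ i, |f i| ≤ M) : |∑ i, f i| ≤ 3 * M := by
  refine (Finset.abs_sum_le_sum_abs _ _).trans ?_
  refine (Finset.sum_le_sum fun i _ => h i).trans ?_
  simp

theorem abs_ten_le (T : Ten) (i j : Fin 3) : |T i j| ≤ ‖T‖ :=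
  (norm_le_pi_norm (T i) j).trans (norm_le_pi_norm T i)

theorem abs_cov_le (a : Cov) (i : Fin 3) : |a i| ≤ ‖a‖ := norm_le_pi_norm a i

namespace InitialSurface

variable {S : InitialSurface} {r : Chart → ℝ}

theorem continuous_fst_hinv {Y : Type*} [TopologicalSpace Y] (i j : Fin 3) :
    Continuous fun p : Chart × Y => S.hinv p.1 i j :=
  (S.continuous_hinv i j).comp continuous_fst

theorem continuous_fst_sqrtDet {Y : Type*} [TopologicalSpace Y] :
    Continuous fun p : Chart × Y => S.sqrtDet p.1 :=
  S.continuous_sqrtDet.comp continuous_fst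

theorem exists_abs_ip_le : ∃ K : ℝ, 0 ≤ K ∧ ∀ x a b, |S.ip x a b| ≤ K * ‖a‖ * ‖b‖ := by
  obtain ⟨K, hK, h⟩ := S.exists_hinv_bound
  refine ⟨9 * K, by positivity, fun x a b => ?_⟩
  calc |S.ip x a b| ≤ 3 * (3 * (K * ‖a‖ * ‖b‖)) := by
        refine abs_sum_le fun i => abs_sum_le fun j => ?_
        rw [abs_mul, abs_mul]
        gcongr
        exacts [h x i j, abs_cov_le a i, abs_cov_le b j]
    _ = _ := by ring

theorem exists_abs_ip₂_le : ∃ K : ℝ, 0 ≤ K ∧ ∀ x T U, |S.ip₂ x T U| ≤ K * ‖T‖ * ‖U‖ := by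
  obtain ⟨K, hK, h⟩ := S.exists_hinv_bound
  refine ⟨81 * (K * K), by positivity, fun x T U => ?_⟩
  calc |S.ip₂ x T U| ≤ 3 * (3 * (3 * (3 * (K * K * ‖T‖ * ‖U‖)))) := by
        refine abs_sum_le fun i => abs_sum_le fun j => abs_sum_le fun k => abs_sum_le fun l => ?_
        rw [abs_mul, abs_mul, abs_mul]
        gcongr
        exacts [h x i k, h x j l, abs_ten_le T i j, abs_ten_le U k l]
    _ = _ := by ring

theorem exists_abs_raiseSnd_le :
    ∃ K : ℝ, 0 ≤ K ∧ ∀ x T i j, |S.raiseSnd x T i j| ≤ K * ‖T‖ := by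
  obtain ⟨K, hK, h⟩ := S.exists_hinv_bound
  refine ⟨3 * K, by positivity, fun x T i j => ?_⟩
  calc |S.raiseSnd x T i j| ≤ 3 * (K * ‖T‖) := by
        refine abs_sum_le fun l => ?_
        rw [abs_mul]
        gcongr
        exacts [h x j l, abs_ten_le T i l]
    _ = _ := by ring

theorem exists_abs_trace_le : ∃ K : ℝ, 0 ≤ K ∧ ∀ x T, |S.trace x T| ≤ K * ‖T‖ := by
  obtain ⟨K, hK, h⟩ := exists_abs_raiseSnd_le (S := S)
  refine ⟨3 * K, by positivity, fun x T => ?_⟩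
  rw [trace_eq, mul_assoc]
  exact abs_sum_le fun i => h x T i i

theorem exists_abs_sqrtDet_mul_le {E F : Type*} [NormedAddCommGroup E] [NormedAddCommGroup F]
    {β : Chart → E → F → ℝ} (h : ∃ K : ℝ, 0 ≤ K ∧ ∀ᵐ x, ∀ a b, |β x a b| ≤ K * ‖a‖ * ‖b‖) :
    ∃ K : ℝ, 0 ≤ K ∧ ∀ᵐ x, ∀ a b, |S.sqrtDet x * β x a b| ≤ K * ‖a‖ * ‖b‖ := by
  obtain ⟨K, hK, h⟩ := h
  obtain ⟨_, b, _, hb, hab⟩ := S.exists_sqrtDet_bounds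
  refine ⟨b * K, by positivity, h.mono fun x hx u v => ?_⟩
  rw [abs_mul, abs_of_pos (S.sqrtDet_pos x), mul_assoc, mul_assoc, ← mul_assoc K]
  exact mul_le_mul (hab x).2 (hx u v) (abs_nonneg _) hb.le

theorem ip₂_sub_left (x : Chart) (T U V : Ten) :
    S.ip₂ x (T - U) V = S.ip₂ x T V - S.ip₂ x U V := by
  simp only [ip₂, ← Finset.sum_sub_distrib, Pi.sub_apply]
  refine Finset.sum_congr rfl fun i _ => Finset.sum_congr rfl fun j _ =>
    Finset.sum_congr rfl fun k _ => Finset.sum_congr rfl fun l _ => by ring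

theorem ip₂_sub_right (x : Chart) (T U V : Ten) :
    S.ip₂ x T (U - V) = S.ip₂ x T U - S.ip₂ x T V := by
  simp only [ip₂, ← Finset.sum_sub_distrib, Pi.sub_apply]
  refine Finset.sum_congr rfl fun i _ => Finset.sum_congr rfl fun j _ =>
    Finset.sum_congr rfl fun k _ => Finset.sum_congr rfl fun l _ => by ring

theorem alt_sub (T U : Ten) : alt (T - U) = alt T - alt U := by
  funext i
  simp only [alt, ← Finset.sum_sub_distrib, Pi.sub_apply]
  refine Finset.sum_congr rfl fun j _ => Finset.sum_congr rfl fun k _ => by ring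

theorem epsContract_sub (x : Chart) (T U : Ten) :
    S.epsContract x (T - U) = S.epsContract x T - S.epsContract x U := by
  funext i
  simp only [epsContract_eq, alt_sub, Pi.sub_apply, ← Finset.sum_sub_distrib]
  refine Finset.sum_congr rfl fun j _ => by ring

theorem trace_sub (x : Chart) (T U : Ten) : S.trace x (T - U) = S.trace x T - S.trace x U := by
  simp only [trace, ← Finset.sum_sub_distrib, Pi.sub_apply]
  refine Finset.sum_congr rfl fun i _ => Finset.sum_congr rfl fun j _ => by ring

theorem abs_alt_le (T : Ten) (i : Fin 3) : |alt T i| ≤ 9 * ‖T‖ := by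
  have hp : ∀ i j k, |perm i j k| ≤ 1 := by
    intro i j k
    fin_cases i <;> fin_cases j <;> fin_cases k <;> norm_num [perm]
  calc |alt T i| ≤ 3 * (3 * (1 * ‖T‖)) := by
        refine abs_sum_le fun j => abs_sum_le fun k => ?_
        rw [abs_mul]
        gcongr
        exacts [hp i j k, abs_ten_le T j k]
    _ = _ := by ring

theorem continuous_alt (i : Fin 3) : Continuous fun T : Ten => alt T i := by
  unfold alt; fun_prop

variable (S) in
theorem bddBilin_ip : BddBilin fun x (a b : Cov) => S.sqrtDet x * S.ip x a b := by
  obtain ⟨K, hK, h⟩ := exists_abs_ip_le (S := S)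
  refine .mk_of_continuous (fun x a b c => by rw [ip_sub_left]; ring)
    (fun x a b c => by rw [ip_sub_right]; ring)
    (exists_abs_sqrtDet_mul_le ⟨K, hK, Eventually.of_forall h⟩) ?_
  have h1 := continuous_fst_hinv (S := S) (Y := Cov × Cov)
  have h2 := continuous_fst_sqrtDet (S := S) (Y := Cov × Cov)
  unfold ip
  fun_prop

variable (S) in
theorem bddBilin_ip₂ : BddBilin fun x (T U : Ten) => S.sqrtDet x * S.ip₂ x T U := by
  obtain ⟨K, hK, h⟩ := exists_abs_ip₂_le (S := S)
  refine .mk_of_continuous (fun x a b c => by rw [ip₂_sub_left]; ring)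
    (fun x a b c => by rw [ip₂_sub_right]; ring)
    (exists_abs_sqrtDet_mul_le ⟨K, hK, Eventually.of_forall h⟩) ?_
  have h1 := continuous_fst_hinv (S := S) (Y := Ten × Ten)
  have h2 := continuous_fst_sqrtDet (S := S) (Y := Ten × Ten)
  unfold ip₂
  fun_prop

variable (S) in
theorem bddBilin_trace : BddBilin fun x (T : Ten) (s : ℝ) => S.sqrtDet x * (S.trace x T * s) := by
  obtain ⟨K, hK, h⟩ := exists_abs_trace_le (S := S)
  refine .mk_of_continuous (fun x a b c => by rw [trace_sub]; ring)
    (fun x a b c => by ring)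
    (exists_abs_sqrtDet_mul_le ⟨K, hK, Eventually.of_forall fun x T s => ?_⟩) ?_
  · rw [abs_mul]
    exact mul_le_mul_of_nonneg_right (h x T) (abs_nonneg s)
  have h1 := continuous_fst_hinv (S := S) (Y := Ten × ℝ)
  have h2 := continuous_fst_sqrtDet (S := S) (Y := Ten × ℝ)
  unfold trace
  fun_prop

variable (S) in
theorem bddBilin_eps :
    BddBilin fun x (T : Ten) (a : Cov) => S.sqrtDet x * S.ip x (S.epsContract x T) a := by
  refine .mk_of_continuous (fun x a b c => by rw [epsContract_sub, ip_sub_left]; ring)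
    (fun x a b c => by rw [ip_sub_right]; ring)
    -- No metric constant appears, because the weighted pairing is metric free: three components,
    -- each bounded by `9 ‖T‖ ‖a‖`.
    ⟨27, by norm_num, Eventually.of_forall fun x T a => ?_⟩ ?_
  · rw [ip_symm, sqrtDet_mul_ip_epsContract]
    refine (abs_sum_le (M := ‖a‖ * (9 * ‖T‖)) fun i => ?_).trans (le_of_eq (by ring))
    rw [abs_mul]
    exact mul_le_mul (abs_cov_le a i) (abs_alt_le T i) (abs_nonneg _) (norm_nonneg _)
  · simp only [S.ip_symm _ (S.epsContract _ _) _, sqrtDet_mul_ip_epsContract]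
    have h1 := fun i => (continuous_alt i).comp
      ((continuous_fst (X := Ten) (Y := Cov)).comp (continuous_snd (X := Chart)))
    simp only [Function.comp_def] at h1
    fun_prop

variable (S) in
/-- The Hodge energy density `⟨curl A, curl X⟩ + div A div X`, as a form in `∇A` and `∇X`. -/
theorem bddBilin_hodge : BddBilin fun x (T U : Ten) => S.sqrtDet x *
    (S.ip x (S.epsContract x T) (S.epsContract x U) + S.trace x T * S.trace x U) := by
  obtain ⟨K, hK, h⟩ := exists_abs_trace_le (S := S)
  obtain ⟨K₂, hK₂, h₂⟩ := exists_abs_ip₂_le (S := S)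
  obtain ⟨K₃, hK₃, h₃⟩ := exists_abs_raiseSnd_le (S := S)
  refine .mk_of_continuous (fun x a b c => by rw [epsContract_sub, ip_sub_left, trace_sub]; ring)
    (fun x a b c => by rw [epsContract_sub, ip_sub_right, trace_sub]; ring)
    (exists_abs_sqrtDet_mul_le ⟨K₂ + 9 * (K₃ * K₃) + K * K, by positivity,
      Eventually.of_forall fun x T U => ?_⟩) ?_
  · have e := S.ip₂_eq x T U
    have h4 : |∑ i, ∑ j, S.raiseSnd x T i j * S.raiseSnd x U j i|
        ≤ 3 * (3 * (K₃ * ‖T‖ * (K₃ * ‖U‖))) := by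
      refine abs_sum_le fun i => abs_sum_le fun j => ?_
      rw [abs_mul]
      exact mul_le_mul (h₃ x T i j) (h₃ x U j i) (abs_nonneg _) (by positivity)
    have h5 : |S.trace x T * S.trace x U| ≤ K * ‖T‖ * (K * ‖U‖) := by
      rw [abs_mul]
      exact mul_le_mul (h x T) (h x U) (abs_nonneg _) (by positivity)
    -- The curl product is expressed through `ip₂_eq`, so that only bounds on `h⁻¹` are needed and
    -- none on `h`.
    rw [show S.ip x (S.epsContract x T) (S.epsContract x U) = S.ip₂ x T U
      - ∑ i, ∑ j, S.raiseSnd x T i j * S.raiseSnd x U j i by rw [e]; ring]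
    calc _ ≤ |S.ip₂ x T U| + |∑ i, ∑ j, S.raiseSnd x T i j * S.raiseSnd x U j i|
          + |S.trace x T * S.trace x U| :=
          (abs_add_le _ _).trans (add_le_add_left (abs_sub _ _) _)
      _ ≤ K₂ * ‖T‖ * ‖U‖ + 3 * (3 * (K₃ * ‖T‖ * (K₃ * ‖U‖))) + K * ‖T‖ * (K * ‖U‖) := by
          gcongr
          exact h₂ x T U
      _ = _ := by ring
  · have h1 := continuous_fst_hinv (S := S) (Y := Ten × Ten)
    have h2 := continuous_fst_sqrtDet (S := S) (Y := Ten × Ten)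
    have e : ∀ x T U, S.ip x (S.epsContract x T) (S.epsContract x U) = S.ip₂ x T U
        - ∑ i, ∑ j, S.raiseSnd x T i j * S.raiseSnd x U j i := by
      intro x T U; rw [S.ip₂_eq x T U]; ring
    simp only [e]
    unfold ip₂ trace raiseSnd
    fun_prop

/-! ### The Ricci form -/

theorem ricForm_symm (x : Chart) (a b : Cov) : S.ricForm x a b = S.ricForm x b a := by
  simp only [ricForm]
  rw [Finset.sum_comm]
  refine Finset.sum_congr rfl fun i _ => Finset.sum_congr rfl fun j _ => ?_
  rw [S.ricci_symm j i]; ring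

theorem raise_sub (x : Chart) (a b : Cov) (i : Fin 3) :
    S.raise x (a - b) i = S.raise x a i - S.raise x b i := by
  simp only [raise, ← Finset.sum_sub_distrib, Pi.sub_apply, mul_sub]

theorem raise_smul (x : Chart) (c : ℝ) (a : Cov) (i : Fin 3) :
    S.raise x (c • a) i = c * S.raise x a i := by
  simp only [raise, Finset.mul_sum, Pi.smul_apply, smul_eq_mul]
  refine Finset.sum_congr rfl fun j _ => by ring

theorem ricForm_sub_left (x : Chart) (a b c : Cov) :
    S.ricForm x (a - b) c = S.ricForm x a c - S.ricForm x b c := by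
  simp only [ricForm, ← Finset.sum_sub_distrib, raise_sub]
  refine Finset.sum_congr rfl fun i _ => Finset.sum_congr rfl fun j _ => by ring

theorem ricForm_sub_right (x : Chart) (a b c : Cov) :
    S.ricForm x a (b - c) = S.ricForm x a b - S.ricForm x a c := by
  rw [ricForm_symm, ricForm_sub_left, S.ricForm_symm x b, S.ricForm_symm x c]

theorem ricForm_smul_smul (x : Chart) (s t : ℝ) (a b : Cov) :
    S.ricForm x (s • a) (t • b) = s * t * S.ricForm x a b := by
  simp only [ricForm, Finset.mul_sum, raise_smul]
  refine Finset.sum_congr rfl fun i _ => Finset.sum_congr rfl fun j _ => by ring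

/-- Normalising `a` to unit length brings in the pointwise norm, which the essential supremum
controls outside one null set valid for all `a` at once. -/
theorem ae_ricForm_le (hδ : S.curvatureSize r ≠ ⊤) : ∀ᵐ x, ∀ a,
    r x ^ 2 * |S.ricForm x a a| ≤ (S.curvatureSize r).toReal * S.ip x a a := by
  have h := S.ae_vol_iff.1
    (ENNReal.ae_le_essSup (μ := S.vol) fun x => ENNReal.ofReal (r x ^ 2) * S.ricNorm x)
  filter_upwards [h] with x hx a
  rcases eq_or_ne a 0 with rfl | ha
  · simp [ricForm, raise, ip]
  have hip := S.ip_pos x ha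
  have hs : 0 < Real.sqrt (S.ip x a a) := Real.sqrt_pos.2 hip
  have hs2 : Real.sqrt (S.ip x a a) * Real.sqrt (S.ip x a a) = S.ip x a a :=
    Real.mul_self_sqrt hip.le
  set s := Real.sqrt (S.ip x a a)
  have h1 : S.ip x (s⁻¹ • a) (s⁻¹ • a) = 1 := by
    rw [ip_smul_smul, ← hs2]; field_simp
  have h2 : ENNReal.ofReal |S.ricForm x (s⁻¹ • a) (s⁻¹ • a)| ≤ S.ricNorm x :=
    le_iSup₂ (f := fun (b : Cov) (_ : S.ip x b b = 1) => ENNReal.ofReal |S.ricForm x b b|) _ h1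
  have h3 : ENNReal.ofReal (r x ^ 2 * |S.ricForm x (s⁻¹ • a) (s⁻¹ • a)|) ≤ S.curvatureSize r := by
    rw [ENNReal.ofReal_mul (sq_nonneg _)]
    exact (mul_le_mul_right h2 _).trans hx
  have h4 := (ENNReal.ofReal_le_iff_le_toReal hδ).1 h3
  rw [ricForm_smul_smul, abs_mul, abs_of_pos (by positivity)] at h4
  calc r x ^ 2 * |S.ricForm x a a|
      = r x ^ 2 * (s⁻¹ * s⁻¹ * |S.ricForm x a a|) * (s * s) := by field_simp
    _ ≤ (S.curvatureSize r).toReal * (s * s) := by gcongr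
    _ = _ := by rw [hs2]

theorem bddBilin_ric (hr : S.IsRadius r) (hδ : S.curvatureSize r ≠ ⊤) :
    BddBilin fun x (a b : Cov) => S.sqrtDet x * (r x ^ 2 * S.ricForm x a b) := by
  obtain ⟨_, K, _, hK, hip⟩ := S.exists_ip_bounds
  set δ := (S.curvatureSize r).toReal
  have hδ0 : 0 ≤ δ := ENNReal.toReal_nonneg
  refine .mk_of_continuous (fun x a b c => by rw [ricForm_sub_left]; ring)
    (fun x a b c => by rw [ricForm_sub_right]; ring)
    (exists_abs_sqrtDet_mul_le ⟨2 * (δ * K), by positivity, ?_⟩) ?_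
  · filter_upwards [ae_ricForm_le hδ] with x hx a b
    have hx' : ∀ a, |r x ^ 2 * S.ricForm x a a| ≤ δ * K * ‖a‖ ^ 2 := by
      intro a
      rw [abs_mul, abs_of_nonneg (sq_nonneg (r x)), mul_assoc]
      exact (hx a).trans (mul_le_mul_of_nonneg_left (hip x a).2 hδ0)
    -- The essential bound concerns the quadratic form only; polarisation extends it to the bilinear
    -- form. Writing `a + b` as `a - -b` makes the subtraction lemmas sufficient. Applied to unit
    -- vectors, it yields the factor `2`.
    have hpol : ∀ a b : Cov, 4 * |r x ^ 2 * S.ricForm x a b|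
        ≤ 2 * (δ * K) * (‖a‖ + ‖b‖) ^ 2 := by
      intro a b
      have e : 4 * (r x ^ 2 * S.ricForm x a b) = r x ^ 2 * S.ricForm x (a - -b) (a - -b)
          - r x ^ 2 * S.ricForm x (a - b) (a - b) := by
        have hn : ∀ c, S.ricForm x c (-b) = -S.ricForm x c b := fun c => by
          have := S.ricForm_smul_smul x 1 (-1) c b
          simpa using this
        simp only [ricForm_sub_left, ricForm_sub_right, hn, S.ricForm_symm x (-b) a,
          S.ricForm_symm x b a, S.ricForm_symm x (-b) b]
        ring
      have h1 := hx' (a - -b)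
      have h2 := hx' (a - b)
      have h3 : ‖a - -b‖ ^ 2 ≤ (‖a‖ + ‖b‖) ^ 2 := by
        gcongr; simpa using norm_sub_le a (-b)
      have h4 : ‖a - b‖ ^ 2 ≤ (‖a‖ + ‖b‖) ^ 2 := by
        gcongr; exact norm_sub_le a b
      have hp : 0 ≤ δ * K := by positivity
      calc 4 * |r x ^ 2 * S.ricForm x a b| = |4 * (r x ^ 2 * S.ricForm x a b)| := by
            rw [abs_mul 4, abs_of_pos (by norm_num : (0 : ℝ) < 4)]
        _ ≤ _ := by
            rw [e]
            refine (abs_sub _ _).trans ?_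
            nlinarith [mul_le_mul_of_nonneg_left h3 hp, mul_le_mul_of_nonneg_left h4 hp]
    rcases eq_or_ne a 0 with rfl | ha
    · simp [ricForm, raise]
    rcases eq_or_ne b 0 with rfl | hb
    · simp [ricForm, raise]
    have hna : 0 < ‖a‖ := norm_pos_iff.2 ha
    have hnb : 0 < ‖b‖ := norm_pos_iff.2 hb
    have h := hpol (‖a‖⁻¹ • a) (‖b‖⁻¹ • b)
    rw [ricForm_smul_smul, norm_smul, norm_smul, norm_inv, norm_inv, norm_norm, norm_norm,
      inv_mul_cancel₀ hna.ne', inv_mul_cancel₀ hnb.ne', mul_left_comm, abs_mul,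
      abs_of_pos (by positivity)] at h
    have h' : ‖a‖⁻¹ * ‖b‖⁻¹ * |r x ^ 2 * S.ricForm x a b| ≤ 2 * (δ * K) := by linarith
    calc |r x ^ 2 * S.ricForm x a b|
        = (‖a‖⁻¹ * ‖b‖⁻¹ * |r x ^ 2 * S.ricForm x a b|) * ‖a‖ * ‖b‖ := by field_simp
      _ ≤ _ := mul_le_mul_of_nonneg_right (mul_le_mul_of_nonneg_right h' hna.le) hnb.le
  · have h1 := continuous_fst_hinv (S := S) (Y := Cov × Cov)
    have h2 := continuous_fst_sqrtDet (S := S) (Y := Cov × Cov)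
    have h3 : ∀ i j, Continuous fun p : Chart × Cov × Cov => S.ricci i j p.1 := fun i j =>
      (S.continuous_ricci i j).comp continuous_fst
    have h4 : Continuous fun p : Chart × Cov × Cov => r p.1 := hr.continuous.comp continuous_fst
    have h5 : ∀ i, Continuous fun p : Chart × Cov × Cov => S.raise p.1 p.2.1 i := by
      unfold raise; fun_prop
    have h6 : ∀ i, Continuous fun p : Chart × Cov × Cov => S.raise p.1 p.2.2 i := by
      unfold raise; fun_prop
    unfold ricForm
    exact h2.mul ((h4.pow 2).mul (continuous_finsetSum _ fun i _ => continuous_finsetSum _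
      fun j _ => ((h3 i j).mul (h5 i)).mul (h6 j)))

end InitialSurface

/-! ### Minimisation of quadratic functionals -/

/-- Riesz representation without completeness: a sequence minimising `a(v, v) - 2 l(v)` is Cauchy
for the energy by the parallelogram law, and satisfies the Euler–Lagrange equation in the limit.
Working on test forms alone, it avoids building the completed Hilbert space. -/
theorem exists_minimizing_sequence {V : Type*} [AddCommGroup V] [Module ℝ V]
    (a : V →ₗ[ℝ] V →ₗ[ℝ] ℝ) (hs : ∀ u v, a u v = a v u) (hp : ∀ v, 0 ≤ a v v)
    (l : V →ₗ[ℝ] ℝ) {M : ℝ} (hl : ∀ v, |l v| ≤ M * Real.sqrt (a v v)) :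
    ∃ φ : ℕ → V,
      Tendsto (fun n : ℕ × ℕ => a (φ n.1 - φ n.2) (φ n.1 - φ n.2)) atTop (𝓝 0) ∧
      ∀ v, Tendsto (fun n => a (φ n) v) atTop (𝓝 (l v)) := by
  set J : V → ℝ := fun v => a v v - 2 * l v with hJ
  have hbdd : BddBelow (Set.range J) := by
    refine ⟨-M ^ 2, ?_⟩
    rintro _ ⟨v, rfl⟩
    have h1 := (abs_le.1 (hl v)).2
    have h2 := Real.sq_sqrt (hp v)
    simp only [hJ]
    nlinarith [sq_nonneg (Real.sqrt (a v v) - M)]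
  set m := ⨅ v, J v
  have hm : ∀ v, m ≤ J v := fun v => ciInf_le hbdd v
  have hex : ∀ n : ℕ, ∃ v, J v < m + 1 / ((n : ℝ) + 1) := fun n =>
    exists_lt_of_ciInf_lt (lt_add_of_pos_right m (by positivity))
  choose φ hφ using hex
  have h0 := tendsto_one_div_add_atTop_nhds_zero_nat (𝕜 := ℝ)
  refine ⟨φ, ?_, fun v => ?_⟩
  · have hlim : Tendsto (fun n : ℕ × ℕ => 2 * (1 / ((n.1 : ℝ) + 1) + 1 / ((n.2 : ℝ) + 1))) atTop
        (𝓝 (2 * (0 + 0))) :=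
      ((h0.comp (tendsto_fst.mono_left prod_atTop_atTop_eq.ge)).add
        (h0.comp (tendsto_snd.mono_left prod_atTop_atTop_eq.ge))).const_mul 2
    rw [add_zero, mul_zero] at hlim
    refine squeeze_zero (fun n => hp _) (fun n => ?_) hlim
    have h1 := hφ n.1
    have h2 := hφ n.2
    -- The value at the midpoint is at least the infimum, which by the parallelogram law bounds the
    -- energy of the difference.
    have h3 := hm ((1 / 2 : ℝ) • (φ n.1 + φ n.2))
    simp only [hJ, map_smul, map_add, map_sub, LinearMap.add_apply, LinearMap.sub_apply,
      LinearMap.smul_apply, smul_eq_mul] at h1 h2 h3 ⊢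
    linarith
  · have key : ∀ n, (a (φ n) v - l v) ^ 2 ≤ 1 / ((n : ℝ) + 1) * a v v := by
      intro n
      have h1 := hφ n
      -- Near-minimality along the line `φₙ + t v` gives a nonnegative quadratic in `t`; its
      -- discriminant bounds `a(φₙ, v) - l(v)`.
      have hq : ∀ t : ℝ, 0 ≤ a v v * (t * t) + 2 * (a (φ n) v - l v) * t + 1 / ((n : ℝ) + 1) := by
        intro t
        have h3 := hm (φ n + t • v)
        simp only [hJ, map_smul, map_add, LinearMap.add_apply, LinearMap.smul_apply,
          smul_eq_mul, hs v (φ n)] at h1 h3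
        linarith
      have := discrim_le_zero hq
      rw [discrim] at this
      linarith
    have hlim : Tendsto (fun n : ℕ => 1 / ((n : ℝ) + 1) * a v v) atTop (𝓝 0) := by
      simpa using h0.mul_const (a v v)
    have hsq := squeeze_zero (fun n => sq_nonneg _) key hlim
    rw [tendsto_iff_dist_tendsto_zero]
    have := hsq.sqrt
    rw [Real.sqrt_zero] at this
    refine this.congr fun n => ?_
    rw [Real.sqrt_sq_eq_abs, Real.dist_eq]

theorem toReal_eLpNorm_sq {E : Type*} [NormedAddCommGroup E] {f : Chart → E}
    (hf : MemLp f 2 volume) : (eLpNorm f 2 volume).toReal ^ 2 = ∫ x, ‖f x‖ ^ 2 := by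
  rw [← ENNReal.toReal_pow, eLpNorm_two_sq,
    integral_eq_lintegral_of_nonneg_ae (Eventually.of_forall fun x => sq_nonneg _)
      (hf.1.norm.pow 2)]

theorem BddBilin.le_integral {E : Type*} [NormedAddCommGroup E] {β : Chart → E → E → ℝ}
    (hβ : BddBilin β) {c : ℝ} (hc : ∀ x a, c * ‖a‖ ^ 2 ≤ β x a a) {f : Chart → E}
    (hf : MemLp f 2 volume) : c * (eLpNorm f 2 volume).toReal ^ 2 ≤ ∫ x, β x (f x) (f x) := by
  rw [toReal_eLpNorm_sq hf, ← integral_const_mul]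
  exact integral_mono (((memLp_two_iff_integrable_sq_norm hf.1).1 hf).const_mul c)
    (hβ.integrable hf hf) fun x => hc x (f x)

namespace InitialSurface

variable {S : InitialSurface} {r : Chart → ℝ}

theorem normSq₂_eq (G : Chart → Ten) :
    S.normSq₂ G = ∫ x, S.sqrtDet x * S.ip₂ x (G x) (G x) := integral_vol S _

theorem exists_le_normSq₂ : ∃ c : ℝ, 0 < c ∧ ∀ G, MemLp G 2 volume →
    c * (eLpNorm G 2 volume).toReal ^ 2 ≤ S.normSq₂ G := by
  obtain ⟨c, K, hc, -, h⟩ := S.exists_ip₂_bounds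
  obtain ⟨a, b, ha, -, hab⟩ := S.exists_sqrtDet_bounds
  refine ⟨a * c, by positivity, fun G hG => ?_⟩
  rw [normSq₂_eq]
  refine S.bddBilin_ip₂.le_integral (fun x T => ?_) hG
  rw [mul_assoc]
  exact mul_le_mul (hab x).1 (h x T).1 (by positivity) (S.sqrtDet_pos x).le

theorem exists_le_integral_ip : ∃ c : ℝ, 0 < c ∧ ∀ a : Chart → Cov, MemLp a 2 volume →
    c * (eLpNorm a 2 volume).toReal ^ 2 ≤ ∫ x, S.sqrtDet x * S.ip x (a x) (a x) := by
  obtain ⟨c, K, hc, -, h⟩ := S.exists_ip_bounds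
  obtain ⟨a, b, ha, -, hab⟩ := S.exists_sqrtDet_bounds
  refine ⟨a * c, by positivity, fun G hG => ?_⟩
  refine S.bddBilin_ip.le_integral (fun x T => ?_) hG
  rw [mul_assoc]
  exact mul_le_mul (hab x).1 (h x T).1 (by positivity) (S.sqrtDet_pos x).le

theorem normSq₂_nonneg (G : Chart → Ten) : 0 ≤ S.normSq₂ G :=
  integral_nonneg fun x => S.ip₂_nonneg x _

theorem exists_eLpNorm_le_sqrt_normSq₂ : ∃ K : ℝ, 0 ≤ K ∧ ∀ G, MemLp G 2 volume →
    (eLpNorm G 2 volume).toReal ≤ K * Real.sqrt (S.normSq₂ G) := by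
  obtain ⟨c, hc, h⟩ := exists_le_normSq₂ (S := S)
  refine ⟨Real.sqrt c⁻¹, Real.sqrt_nonneg _, fun G hG => ?_⟩
  rw [← Real.sqrt_mul (by positivity)]
  refine Real.le_sqrt_of_sq_le ?_
  rw [inv_mul_eq_div, le_div_iff₀ hc, mul_comm]
  exact h G hG

/-! ### The form `⟨(-Δ - σ Ric) A, A'⟩` -/

/-- Puts the form into the two bounded densities `⟨∇A, ∇A'⟩` and `r² Ric(A/r, A'/r)`. -/
theorem sqrtDet_mul_formDensity (hr : S.IsRadius r) (σ : ℝ) (A A' : Chart → Cov)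
    (G G' : Chart → Ten) : (fun x => S.sqrtDet x * S.formDensity σ A G A' G' x) =ᵐ[volume]
      fun x => S.sqrtDet x * S.ip₂ x (G x) (G' x) - σ * (S.sqrtDet x *
        (r x ^ 2 * S.ricForm x ((r x)⁻¹ • A x) ((r x)⁻¹ • A' x))) := by
  filter_upwards [hr.ae_pos] with x hx
  rw [ricForm_smul_smul, formDensity]
  field_simp

section Form

variable {A A' : Chart → Cov} {G G' : Chart → Ten}

theorem integrable_formDensity (hr : S.IsRadius r) (hδ : S.curvatureSize r ≠ ⊤) (σ : ℝ)
    (hG : MemLp G 2 volume) (hG' : MemLp G' 2 volume)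
    (hA : MemLp (fun x => (r x)⁻¹ • A x) 2 volume)
    (hA' : MemLp (fun x => (r x)⁻¹ • A' x) 2 volume) :
    Integrable (S.formDensity σ A G A' G') S.vol := by
  rw [integrable_vol_iff]
  refine Integrable.congr ?_ (sqrtDet_mul_formDensity hr σ A A' G G').symm
  exact (S.bddBilin_ip₂.integrable hG hG').sub
    (((bddBilin_ric hr hδ).integrable hA hA').const_mul σ)

theorem form_eq (hr : S.IsRadius r) (hδ : S.curvatureSize r ≠ ⊤) (σ : ℝ)
    (hG : MemLp G 2 volume) (hG' : MemLp G' 2 volume)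
    (hA : MemLp (fun x => (r x)⁻¹ • A x) 2 volume)
    (hA' : MemLp (fun x => (r x)⁻¹ • A' x) 2 volume) :
    S.form σ A G A' G' = (∫ x, S.sqrtDet x * S.ip₂ x (G x) (G' x)) - σ * ∫ x, S.sqrtDet x *
        (r x ^ 2 * S.ricForm x ((r x)⁻¹ • A x) ((r x)⁻¹ • A' x)) := by
  rw [form, integral_vol, integral_congr_ae (sqrtDet_mul_formDensity hr σ A A' G G'),
    integral_sub (S.bddBilin_ip₂.integrable hG hG')
      (((bddBilin_ric hr hδ).integrable hA hA').const_mul σ), integral_const_mul]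

theorem form_symm (σ : ℝ) : S.form σ A G A' G' = S.form σ A' G' A G := by
  simp only [form, formDensity]
  congr 1; funext x
  rw [ricForm_symm]
  congr 1
  simp only [ip₂]
  simp only [Fin.sum_univ_three, S.hinv_symm x 1 0, S.hinv_symm x 2 0, S.hinv_symm x 2 1]
  ring

theorem tendsto_form (hr : S.IsRadius r) (hδ : S.curvatureSize r ≠ ⊤) (σ : ℝ)
    {φ φ' : ℕ → testForms} (h : S.TendstoH1 r φ A G) (h' : S.TendstoH1 r φ' A' G')
    (hG : MemLp G 2 volume) (hG' : MemLp G' 2 volume)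
    (hA : MemLp (fun x => (r x)⁻¹ • A x) 2 volume)
    (hA' : MemLp (fun x => (r x)⁻¹ • A' x) 2 volume) :
    Tendsto (fun n => S.form σ (φ n) (S.covDeriv (φ n)) (φ' n) (S.covDeriv (φ' n))) atTop
      (𝓝 (S.form σ A G A' G')) := by
  rw [form_eq hr hδ σ hG hG' hA hA']
  have e := fun n => form_eq (S := S) hr hδ σ (memLp_covDeriv (S := S) (φ n)) (memLp_covDeriv (S := S) (φ' n))
    (InitialSurface.memLp_weighted hr (φ n)) (InitialSurface.memLp_weighted hr (φ' n))
  simp only [e]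
  exact (S.bddBilin_ip₂.tendsto_integral h.deriv h'.deriv (fun n => memLp_covDeriv (S := S) (φ n))
    (fun n => memLp_covDeriv (S := S) (φ' n)) hG hG').sub
    (((bddBilin_ric hr hδ).tendsto_integral h.weighted h'.weighted
      (fun n => memLp_weighted hr (φ n)) (fun n => memLp_weighted hr (φ' n)) hA hA').const_mul σ)

theorem tendstoH1_const (X : testForms) :
    S.TendstoH1 r (fun _ => X) (X : Chart → Cov) (S.covDeriv X) :=
  ⟨by simp [TendstoL2], by simp [TendstoL2]⟩

end Form

theorem IsH1.tendsto_opPairing (hr : S.IsRadius r) (hδ : S.curvatureSize r ≠ ⊤) (σ : ℝ)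
    {A : FormField} {G : TensorField} (h : S.IsH1 A G) {φ : ℕ → testForms}
    (hφ : S.TendstoH1 r φ A G) (X : testForms) :
    Tendsto (fun n => S.form σ (φ n) (S.covDeriv (φ n)) X (S.covDeriv X)) atTop
      (𝓝 (S.opPairing σ A G X)) :=
  tendsto_form hr hδ σ hφ (tendstoH1_const X) h.memLp (memLp_covDeriv (S := S) X) (h.memLp_weighted hr)
    (InitialSurface.memLp_weighted hr X)

theorem hardy_test_real {C : ℝ} (hr : S.IsRadius r) (hC : C ∈ S.hardyConstants r)
    (X : testForms) :
    ∫ x, S.sqrtDet x * S.ip x ((r x)⁻¹ • (X : Chart → Cov) x) ((r x)⁻¹ • (X : Chart → Cov) x)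
      ≤ C * S.normSq₂ (S.covDeriv X) := by
  have h := hC.2 X
  have hi1 := (integrable_vol_iff S _).2
    (S.bddBilin_ip.integrable (InitialSurface.memLp_weighted hr X) (InitialSurface.memLp_weighted hr X))
  have hi2 := (integrable_vol_iff S _).2
    (S.bddBilin_ip₂.integrable (memLp_covDeriv (S := S) X) (memLp_covDeriv (S := S) X))
  simp only [ip_div_sq] at h
  rw [← ofReal_integral_eq_lintegral_ofReal hi1 (Eventually.of_forall fun x => S.ip_nonneg x _),
    ← ofReal_integral_eq_lintegral_ofReal hi2 (Eventually.of_forall fun x => S.ip₂_nonneg x _),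
    ← ENNReal.ofReal_mul hC.1] at h
  rw [← integral_vol]
  exact (ENNReal.ofReal_le_ofReal_iff (mul_nonneg hC.1 (normSq₂_nonneg _))).1 h

theorem IsH1.hardy {C : ℝ} (hr : S.IsRadius r) (hC : C ∈ S.hardyConstants r)
    {A : FormField} {G : TensorField} (h : S.IsH1 A G) :
    ∫ x, S.sqrtDet x * S.ip x ((r x)⁻¹ • A x) ((r x)⁻¹ • A x) ≤ C * S.normSq₂ G := by
  obtain ⟨φ, hφ⟩ := (isH1_iff hr).1 h
  have h1 := S.bddBilin_ip.tendsto_integral hφ.weighted hφ.weighted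
    (fun n => InitialSurface.memLp_weighted hr (φ n))
    (fun n => InitialSurface.memLp_weighted hr (φ n)) (h.memLp_weighted hr) (h.memLp_weighted hr)
  have h2 := (S.bddBilin_ip₂.tendsto_integral hφ.deriv hφ.deriv (fun n => memLp_covDeriv (S := S) (φ n))
    (fun n => memLp_covDeriv (S := S) (φ n)) h.memLp h.memLp).const_mul C
  refine (le_of_tendsto_of_tendsto' h1 h2 fun n => ?_).trans (le_of_eq ?_)
  · rw [← normSq₂_eq]; exact hardy_test_real hr hC (φ n)
  · rw [normSq₂_eq]

theorem curvatureSize_ne_top {C : ℝ} (hr : S.IsRadius r) (hC : C ∈ S.hardyConstants r)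
    (hlt : ENNReal.ofReal C * S.curvatureSize r < 1) : S.curvatureSize r ≠ ⊤ := by
  intro h
  rw [h, ENNReal.mul_top (by simpa using pos_of_mem_hardyConstants hr hC)] at hlt
  exact absurd hlt (by simp)

theorem one_sub_mul_pos {C : ℝ} (hr : S.IsRadius r) (hC : C ∈ S.hardyConstants r)
    (hlt : ENNReal.ofReal C * S.curvatureSize r < 1) :
    0 < 1 - C * (S.curvatureSize r).toReal := by
  have hδ := curvatureSize_ne_top hr hC hlt
  have h := (ENNReal.toReal_lt_toReal (ENNReal.mul_ne_top ENNReal.ofReal_ne_top hδ)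
    ENNReal.one_ne_top).2 hlt
  rw [ENNReal.toReal_mul, ENNReal.toReal_ofReal hC.1, ENNReal.toReal_one] at h
  linarith

theorem exists_form_bound (hr : S.IsRadius r) (hδ : S.curvatureSize r ≠ ⊤) (σ : ℝ) :
    ∃ M : ℝ, ∀ A G A' G', S.IsH1 A G → S.IsH1 A' G' →
      Integrable (S.formDensity σ A G A' G') S.vol ∧
      |S.form σ A G A' G'| ≤ M * Real.sqrt (S.normSq₂ G) * Real.sqrt (S.normSq₂ G') := by
  obtain ⟨K₁, hK₁, h₁⟩ := S.bddBilin_ip₂.exists_integral_le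
  obtain ⟨K₂, hK₂, h₂⟩ := (bddBilin_ric hr hδ).exists_integral_le
  obtain ⟨K₃, hK₃, h₃⟩ := exists_eLpNorm_le_sqrt_normSq₂ (S := S)
  obtain ⟨C, hC⟩ := hardyConstants_nonempty hr
  obtain ⟨c, hc, h₄⟩ := exists_le_integral_ip (S := S)
  have h₅ : ∀ {A G}, S.IsH1 A G → (eLpNorm (fun x => (r x)⁻¹ • A x) 2 volume).toReal
      ≤ Real.sqrt (C / c) * Real.sqrt (S.normSq₂ G) := by
    intro A G h
    rw [← Real.sqrt_mul (div_nonneg hC.1 hc.le)]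
    refine Real.le_sqrt_of_sq_le ?_
    rw [div_mul_eq_mul_div, le_div_iff₀ hc, mul_comm]
    exact (h₄ _ (h.memLp_weighted hr)).trans (h.hardy hr hC)
  refine ⟨K₁ * (K₃ * K₃) + |σ| * (K₂ * (Real.sqrt (C / c) * Real.sqrt (C / c))),
    fun A G A' G' h h' => ⟨integrable_formDensity hr hδ σ h.memLp h'.memLp (h.memLp_weighted hr)
      (h'.memLp_weighted hr), ?_⟩⟩
  rw [form_eq hr hδ σ h.memLp h'.memLp (h.memLp_weighted hr) (h'.memLp_weighted hr)]
  refine (abs_sub _ _).trans ?_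
  rw [abs_mul]
  have e₁ := h₁ _ _ h.memLp h'.memLp
  have e₂ := h₂ _ _ (h.memLp_weighted hr) (h'.memLp_weighted hr)
  have e₃ := mul_le_mul (h₃ _ h.memLp) (h₃ _ h'.memLp) ENNReal.toReal_nonneg (by positivity)
  have e₄ := mul_le_mul (h₅ h) (h₅ h') ENNReal.toReal_nonneg (by positivity)
  have e₅ := e₁.trans (mul_le_mul_of_nonneg_left e₃ hK₁)
  have e₆ := mul_le_mul_of_nonneg_left (e₂.trans (mul_le_mul_of_nonneg_left e₄ hK₂)) (abs_nonneg σ)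
  refine (add_le_add e₅ e₆).trans (le_of_eq ?_)
  ring

/-- The Ricci term is at most `δ ∫ |A|²/r²` in absolute value, so its sign is irrelevant. Hardy is
taken as a hypothesis on `A`, so that the estimate serves test forms as well as limits. -/
theorem form_coercive {C : ℝ} (hr : S.IsRadius r) (hδ : S.curvatureSize r ≠ ⊤)
    {σ : ℝ} (hσ : σ = 1 ∨ σ = -1) {A : Chart → Cov} {G : Chart → Ten} (hG : MemLp G 2 volume)
    (hA : MemLp (fun x => (r x)⁻¹ • A x) 2 volume)
    (hH : ∫ x, S.sqrtDet x * S.ip x ((r x)⁻¹ • A x) ((r x)⁻¹ • A x) ≤ C * S.normSq₂ G) :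
    (1 - C * (S.curvatureSize r).toReal) * S.normSq₂ G ≤ S.form σ A G A G := by
  rw [form_eq hr hδ σ hG hG hA hA, ← normSq₂_eq]
  set δ := (S.curvatureSize r).toReal
  set I := ∫ x, S.sqrtDet x * (r x ^ 2 * S.ricForm x ((r x)⁻¹ • A x) ((r x)⁻¹ • A x))
  have h1 : |I| ≤ δ * ∫ x, S.sqrtDet x * S.ip x ((r x)⁻¹ • A x) ((r x)⁻¹ • A x) := by
    rw [← integral_const_mul]
    rw [← Real.norm_eq_abs]
    refine norm_integral_le_of_norm_le ((S.bddBilin_ip.integrable hA hA).const_mul δ) ?_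
    filter_upwards [ae_ricForm_le hδ] with x hx
    have := hx ((r x)⁻¹ • A x)
    rw [Real.norm_eq_abs, abs_mul, abs_of_pos (S.sqrtDet_pos x), abs_mul,
      abs_of_nonneg (sq_nonneg (r x)), mul_left_comm δ]
    exact mul_le_mul_of_nonneg_left this (S.sqrtDet_pos x).le
  have h2 : δ * ∫ x, S.sqrtDet x * S.ip x ((r x)⁻¹ • A x) ((r x)⁻¹ • A x)
      ≤ δ * (C * S.normSq₂ G) := mul_le_mul_of_nonneg_left hH ENNReal.toReal_nonneg
  have h3 : σ * I ≤ |I| := by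
    rcases hσ with rfl | rfl
    · simpa using le_abs_self I
    · simpa using neg_le_abs I
  linarith

theorem IsH1.coercive {C : ℝ} (hr : S.IsRadius r) (hC : C ∈ S.hardyConstants r)
    (hδ : S.curvatureSize r ≠ ⊤) {σ : ℝ} (hσ : σ = 1 ∨ σ = -1)
    {A : FormField} {G : TensorField} (h : S.IsH1 A G) :
    (1 - C * (S.curvatureSize r).toReal) * S.normSq₂ G ≤ S.form σ A G A G :=
  form_coercive hr hδ hσ h.memLp (h.memLp_weighted hr) (h.hardy hr hC)

theorem IsH1.eq_zero_of_normSq₂ (hr : S.IsRadius r) {A : FormField} {G : TensorField}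
    (h : S.IsH1 A G) (hG : S.normSq₂ G ≤ 0) : A = 0 := by
  obtain ⟨C, hC⟩ := hardyConstants_nonempty hr
  obtain ⟨c, hc, h₄⟩ := exists_le_integral_ip (S := S)
  have hA := h.memLp_weighted hr
  have h1 := (h₄ _ hA).trans (h.hardy hr hC)
  have h2 : C * S.normSq₂ G ≤ 0 := mul_nonpos_of_nonneg_of_nonpos hC.1 hG
  have h3 : (eLpNorm (fun x => (r x)⁻¹ • A x) 2 volume).toReal ^ 2 ≤ 0 := by
    by_contra hne
    rw [not_le] at hne
    nlinarith [mul_pos hc hne]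
  have h4 : eLpNorm (fun x => (r x)⁻¹ • A x) 2 volume = 0 := by
    have := pow_eq_zero_iff two_ne_zero |>.1 (le_antisymm h3 (sq_nonneg _))
    rcases (ENNReal.toReal_eq_zero_iff _).1 this with h | h
    · exact h
    · exact absurd h hA.2.ne
  rw [eLpNorm_eq_zero_iff hA.1 two_ne_zero] at h4
  refine AEEqFun.ext ?_
  filter_upwards [h4, hr.ae_pos, AEEqFun.coeFn_zero (β := Cov) (μ := (volume : Measure Chart))]
    with x hx hx0 hz
  rw [hz]
  simpa [hx0.ne'] using hx

/-- Testing against an approximating sequence of `A` itself gives `⟨(-Δ - R)A, A⟩ = 0`; coercivity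
and Hardy then give `A = 0`. -/
theorem IsH1.eq_zero_of_opPairing {C : ℝ} (hr : S.IsRadius r) (hC : C ∈ S.hardyConstants r)
    (hlt : ENNReal.ofReal C * S.curvatureSize r < 1) {σ : ℝ} (hσ : σ = 1 ∨ σ = -1)
    {A : FormField} {G : TensorField} (h : S.IsH1 A G) (h0 : ∀ X, S.opPairing σ A G X = 0) :
    A = 0 := by
  have hδ := curvatureSize_ne_top hr hC hlt
  obtain ⟨φ, hφ⟩ := (isH1_iff hr).1 h
  have hform : S.form σ A G A G = 0 := by
    have hA := h.memLp_weighted hr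
    have e : ∀ n, S.opPairing σ A G (φ n) = (∫ x, S.sqrtDet x * S.ip₂ x (G x) (S.covDeriv (φ n) x))
        - σ * ∫ x, S.sqrtDet x * (r x ^ 2 * S.ricForm x ((r x)⁻¹ • A x)
          ((r x)⁻¹ • (φ n : Chart → Cov) x)) := fun n =>
      form_eq hr hδ σ h.memLp (memLp_covDeriv (S := S) (φ n)) hA (InitialSurface.memLp_weighted hr (φ n))
    have hl : Tendsto (fun n => S.opPairing σ A G (φ n)) atTop (𝓝 (S.form σ A G A G)) := by
      rw [form_eq hr hδ σ h.memLp h.memLp hA hA]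
      simp only [e]
      exact (S.bddBilin_ip₂.tendsto_integral (f := fun _ => G) (by simp [TendstoL2]) hφ.deriv
        (fun _ => h.memLp) (fun n => memLp_covDeriv (S := S) (φ n)) h.memLp h.memLp).sub
        (((bddBilin_ric hr hδ).tendsto_integral (f := fun _ x => (r x)⁻¹ • A x)
          (by simp [TendstoL2]) hφ.weighted (fun _ => hA)
          (fun n => InitialSurface.memLp_weighted hr (φ n)) hA hA).const_mul σ)
    simp only [h0] at hl
    exact tendsto_nhds_unique hl tendsto_const_nhds
  have hco := h.coercive hr hC hδ hσ
  rw [hform] at hco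
  exact h.eq_zero_of_normSq₂ hr (nonpos_of_mul_nonpos_right hco (one_sub_mul_pos hr hC hlt))

/-- The form on test forms is symmetric and coercive, so the minimising sequence for `l` is Cauchy
in `Ḣ¹`, and its limit solves the equation against every test form. -/
theorem exists_isH1_opPairing_eq {C : ℝ} (hr : S.IsRadius r) (hC : C ∈ S.hardyConstants r)
    (hlt : ENNReal.ofReal C * S.curvatureSize r < 1) {σ : ℝ} (hσ : σ = 1 ∨ σ = -1)
    {l : testForms →ₗ[ℝ] ℝ} (hl : S.IsHMinus1 l) :
    ∃ A G, S.IsH1 A G ∧ ∀ X, S.opPairing σ A G X = l X := by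
  have hδ := curvatureSize_ne_top hr hC hlt
  have hpos := one_sub_mul_pos hr hC hlt
  have hint := fun X Y : testForms => integrable_formDensity (S := S) hr hδ σ (memLp_covDeriv (S := S) X)
    (memLp_covDeriv (S := S) Y) (InitialSurface.memLp_weighted hr X) (InitialSurface.memLp_weighted hr Y)
  have hadd : ∀ X X' Y : testForms, S.form σ (X + X' : testForms) (S.covDeriv (X + X' : testForms))
      Y (S.covDeriv Y) = S.form σ X (S.covDeriv X) Y (S.covDeriv Y)
        + S.form σ X' (S.covDeriv X') Y (S.covDeriv Y) := by
    intro X X' Y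
    simp only [form]
    rw [← integral_add (hint X Y) (hint X' Y)]
    congr 1; funext x
    have e1 : ∀ T U V : Ten, S.ip₂ x (T + U) V = S.ip₂ x T V + S.ip₂ x U V := fun T U V => by
      have := S.ip₂_sub_left x (T + U) U V
      rw [add_sub_cancel_right] at this; linarith
    have e2 : ∀ a b c : Cov, S.ricForm x (a + b) c = S.ricForm x a c + S.ricForm x b c :=
      fun a b c => by
        have := S.ricForm_sub_left x (a + b) b c
        rw [add_sub_cancel_right] at this; linarith
    simp only [formDensity, covDeriv_add, e1]
    rw [show ((X + X' : testForms) : Chart → Cov) x = (X : Chart → Cov) x + (X' : Chart → Cov) x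
      from rfl, e2]
    ring
  have hsmul : ∀ (c : ℝ) (X Y : testForms), S.form σ (c • X : testForms)
      (S.covDeriv (c • X : testForms)) Y (S.covDeriv Y)
        = c * S.form σ X (S.covDeriv X) Y (S.covDeriv Y) := by
    intro c X Y
    simp only [form]
    rw [← integral_const_mul]
    congr 1; funext x
    simp only [formDensity, covDeriv_smul]
    rw [show ((c • X : testForms) : Chart → Cov) x = c • (X : Chart → Cov) x from rfl]
    have e1 := S.ricForm_smul_smul x c 1 ((X : Chart → Cov) x) ((Y : Chart → Cov) x)
    rw [one_smul, mul_one] at e1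
    rw [e1]
    have e2 : ∀ T U : Ten, S.ip₂ x (c • T) U = c * S.ip₂ x T U := fun T U => by
      simp only [ip₂, Finset.mul_sum, Pi.smul_apply, smul_eq_mul]
      refine Finset.sum_congr rfl fun i _ => Finset.sum_congr rfl fun j _ =>
        Finset.sum_congr rfl fun k _ => Finset.sum_congr rfl fun l _ => by ring
    rw [e2]; ring
  set a : testForms →ₗ[ℝ] testForms →ₗ[ℝ] ℝ := LinearMap.mk₂ ℝ
    (fun X Y : testForms => S.form σ X (S.covDeriv X) Y (S.covDeriv Y)) hadd hsmul
    (fun X Y Y' => by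
      rw [form_symm, hadd, S.form_symm (A := (Y : Chart → Cov)),
        S.form_symm (A := (Y' : Chart → Cov))])
    (fun c X Y => by rw [form_symm, hsmul, S.form_symm (A := (Y : Chart → Cov))]; rfl) with ha
  have hav : ∀ X Y, a X Y = S.form σ X (S.covDeriv X) Y (S.covDeriv Y) := fun X Y => rfl
  have hco : ∀ X : testForms, (1 - C * (S.curvatureSize r).toReal) * S.normSq₂ (S.covDeriv X)
      ≤ a X X := fun X =>
    form_coercive hr hδ hσ (memLp_covDeriv (S := S) X) (InitialSurface.memLp_weighted hr X) (hardy_test_real hr hC X)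
  set κ := 1 - C * (S.curvatureSize r).toReal
  have hp : ∀ X, 0 ≤ a X X := fun X =>
    le_trans (mul_nonneg hpos.le (normSq₂_nonneg _)) (hco X)
  obtain ⟨M, hM⟩ := hl
  -- Coercivity turns the `Ḣ⁻¹` bound into a bound in the energy norm of the form.
  have hlb : ∀ X, |l X| ≤ (|M| * Real.sqrt κ⁻¹) * Real.sqrt (a X X) := by
    intro X
    refine (hM X).trans ?_
    rw [mul_assoc, ← Real.sqrt_mul (by positivity)]
    refine mul_le_mul (le_abs_self M) (Real.sqrt_le_sqrt ?_) (Real.sqrt_nonneg _) (abs_nonneg M)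
    rw [inv_mul_eq_div, le_div_iff₀ hpos, mul_comm]
    exact hco X
  obtain ⟨φ, hφ1, hφ2⟩ := exists_minimizing_sequence a (fun X Y => form_symm σ) hp l hlb
  obtain ⟨c, hc, hcG⟩ := exists_le_normSq₂ (S := S)
  have hcau : Tendsto (fun n : ℕ × ℕ => eLpNorm (S.covDeriv (φ n.1) - S.covDeriv (φ n.2)) 2
      (volume : Measure Chart)) atTop (𝓝 0) := by
    have h1 : ∀ n : ℕ × ℕ, (eLpNorm (S.covDeriv (φ n.1) - S.covDeriv (φ n.2)) 2 volume).toReal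
        ≤ Real.sqrt ((κ * c)⁻¹ * a (φ n.1 - φ n.2) (φ n.1 - φ n.2)) := by
      intro n
      refine Real.le_sqrt_of_sq_le ?_
      rw [inv_mul_eq_div, le_div_iff₀ (by positivity), mul_comm, mul_assoc]
      refine le_trans (mul_le_mul_of_nonneg_left ?_ hpos.le) (hco _)
      have := hcG (S.covDeriv (φ n.1 - φ n.2 : testForms)) (memLp_covDeriv (S := S) _)
      rwa [show S.covDeriv (φ n.1 - φ n.2 : testForms) = S.covDeriv (φ n.1) - S.covDeriv (φ n.2)
        from funext fun x => covDeriv_sub _ _ x] at this ⊢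
    have h2 : Tendsto (fun n : ℕ × ℕ =>
        Real.sqrt ((κ * c)⁻¹ * a (φ n.1 - φ n.2) (φ n.1 - φ n.2))) atTop (𝓝 0) := by
      simpa using (hφ1.const_mul (κ * c)⁻¹).sqrt
    have h3 := squeeze_zero (fun n => ENNReal.toReal_nonneg) h1 h2
    have h4 := ENNReal.tendsto_ofReal h3
    rw [ENNReal.ofReal_zero] at h4
    refine h4.congr fun n => ENNReal.ofReal_toReal ?_
    exact ((memLp_covDeriv (S := S) (φ n.1)).sub (memLp_covDeriv (S := S) (φ n.2))).2.ne
  obtain ⟨A, G, hAG⟩ := exists_isH1 hr hcau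
  have hH1 : S.IsH1 A G := (isH1_iff hr).2 ⟨φ, hAG⟩
  exact ⟨A, G, hH1, fun X => tendsto_nhds_unique (hH1.tendsto_opPairing hr hδ σ hAG X) (hφ2 X)⟩

end InitialSurface

/-! ### Mollifiers -/

theorem eLpNorm_two_sq_enorm {E : Type*} [NormedAddCommGroup E] {μ : Measure Chart}
    (f : Chart → E) : eLpNorm f 2 μ ^ 2 = ∫⁻ x, ‖f x‖ₑ ^ 2 ∂μ := by
  have h := eLpNorm_nnreal_pow_eq_lintegral (f := f) (μ := μ) (p := 2) two_ne_zero
  simpa only [NNReal.coe_ofNat, ENNReal.rpow_ofNat, ENNReal.coe_ofNat] using h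

/-- Continuity of translations in `L²`, read off from the continuous action of the additive group on
`Lp`. -/
theorem tendsto_eLpNorm_translate_sub {u : Chart → ℝ} (hu : MemLp u 2 volume) :
    Tendsto (fun t : Chart => eLpNorm (fun x => u (x - t) - u x) 2 (volume : Measure Chart)) (𝓝 0)
      (𝓝 0) := by
  have hp : Fact ((2 : ℝ≥0∞) ≠ ⊤) := ⟨ENNReal.ofNat_ne_top⟩
  have hc : Continuous fun t : Chart => DomAddAct.mk (-t) +ᵥ hu.toLp u :=
    (DomAddAct.continuous_mk.comp continuous_neg).vadd continuous_const
  have h := hc.tendsto 0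
  rw [neg_zero, DomAddAct.mk_zero, zero_vadd, Lp.tendsto_Lp_iff_tendsto_eLpNorm'] at h
  refine h.congr fun t => ?_
  rw [DomAddAct.mk_vadd_toLp,
    eLpNorm_congr_ae ((MemLp.coeFn_toLp _).sub (MemLp.coeFn_toLp _))]
  congr 1; funext x
  simp only [Pi.sub_apply, vadd_eq_add, neg_add_eq_sub]

theorem sq_setLIntegral_le {s : Set Chart} {f : Chart → ℝ≥0∞}
    (hf : AEMeasurable f (volume.restrict s)) :
    (∫⁻ t in s, f t) ^ 2 ≤ volume s * ∫⁻ t in s, f t ^ 2 := by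
  have h := ENNReal.lintegral_mul_le_Lp_mul_Lq (volume.restrict s) Real.HolderConjugate.two_two
    (f := fun _ => 1) (g := f) aemeasurable_const hf
  simp only [Pi.mul_apply, one_mul, ENNReal.one_rpow, lintegral_const, Measure.restrict_apply_univ]
    at h
  refine (pow_le_pow_left₀ zero_le h 2).trans (le_of_eq ?_)
  rw [mul_pow, ← ENNReal.rpow_natCast, ← ENNReal.rpow_natCast, ← ENNReal.rpow_mul,
    ← ENNReal.rpow_mul]
  norm_num

theorem volume_closedBall_inv (n : ℕ) :
    ENNReal.ofReal (((n : ℝ) + 1) ^ 3) * volume (Metric.closedBall (0 : Chart) (1 / ((n : ℝ) + 1)))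
      = volume (Metric.closedBall (0 : Chart) 1) := by
  rw [Measure.addHaar_closedBall' _ _ (by positivity : (0 : ℝ) ≤ 1 / ((n : ℝ) + 1)), ← mul_assoc,
    ← ENNReal.ofReal_mul (by positivity), finrank_euclideanSpace_fin, ← mul_pow,
    mul_one_div_cancel (by positivity), one_pow, ENNReal.ofReal_one, one_mul]

/-- A family of kernels concentrating at the diagonal. -/
theorem tendsto_eLpNorm_kernel {u : Chart → ℝ} (hu : MemLp u 2 volume)
    {k : ℕ → Chart → Chart → ℝ} {M : ℝ} (hk : ∀ n x t, |k n x t| ≤ M * ((n : ℝ) + 1) ^ 3)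
    (hk0 : ∀ (n : ℕ) x t, 1 / ((n : ℝ) + 1) < ‖t‖ → k n x t = 0) :
    Tendsto (fun n => eLpNorm (fun x => ∫ t, k n x t * (u (x - t) - u x)) 2
      (volume : Measure Chart)) atTop (𝓝 0) := by
  set V := volume (Metric.closedBall (0 : Chart) 1) with hV
  have hVtop : V ≠ ⊤ := measure_closedBall_lt_top.ne
  have hM : 0 ≤ M := by
    have := (abs_nonneg _).trans (hk 0 0 0)
    simpa using this
  set D : ℝ≥0∞ := ENNReal.ofReal M ^ 2 * V ^ 2 with hD
  have hDtop : D ≠ ⊤ := ENNReal.mul_ne_top (by simp) (by simp [hVtop])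
  have hjm : AEMeasurable (fun z : Chart × Chart => ‖u (z.1 - z.2) - u z.1‖ₑ ^ 2)
      ((volume : Measure Chart).prod volume) := by
    have h1 : AEStronglyMeasurable (fun z : Chart × Chart => u (z.1 - z.2))
        ((volume : Measure Chart).prod volume) :=
      hu.1.comp_quasiMeasurePreserving (quasiMeasurePreserving_sub volume volume)
    exact ((h1.sub hu.1.comp_fst).enorm).pow_const 2
  -- Cauchy–Schwarz in `t` on the ball `s` of radius `1/(n + 1)`, then Tonelli. The factor `(M N)²
  -- |s|²` with `N = (n + 1)³` is the constant `M² V²`, as `N |s|` is the volume `V` of the unit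
  -- ball.
  have key : ∀ ε : ℝ≥0∞, ∀ n : ℕ, (∀ t : Chart, ‖t‖ ≤ 1 / ((n : ℝ) + 1) →
      eLpNorm (fun x => u (x - t) - u x) 2 (volume : Measure Chart) ≤ ε) →
      eLpNorm (fun x => ∫ t, k n x t * (u (x - t) - u x)) 2 (volume : Measure Chart) ^ 2
        ≤ D * ε ^ 2 := by
    intro ε n hε
    set s := Metric.closedBall (0 : Chart) (1 / ((n : ℝ) + 1)) with hs
    set N : ℝ≥0∞ := ENNReal.ofReal (((n : ℝ) + 1) ^ 3) with hN
    have hsV : N * volume s = V := volume_closedBall_inv n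
    have hpt : ∀ x, AEMeasurable (fun t => ‖u (x - t) - u x‖ₑ) (volume.restrict s) := by
      intro x
      have h1 : AEStronglyMeasurable (fun t => u (x - t)) (volume : Measure Chart) :=
        hu.1.comp_quasiMeasurePreserving (quasiMeasurePreserving_sub_left volume x)
      exact ((h1.sub aestronglyMeasurable_const).enorm).restrict
    have h1 : ∀ x, ‖∫ t, k n x t * (u (x - t) - u x)‖ₑ ^ 2
        ≤ (ENNReal.ofReal M * N) ^ 2 * (volume s * ∫⁻ t in s, ‖u (x - t) - u x‖ₑ ^ 2) := by
      intro x
      have h2 : ‖∫ t, k n x t * (u (x - t) - u x)‖ₑ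
          ≤ ENNReal.ofReal M * N * ∫⁻ t in s, ‖u (x - t) - u x‖ₑ := by
        refine (enorm_integral_le_lintegral_enorm _).trans ?_
        rw [← lintegral_const_mul'' _ (hpt x), ← lintegral_indicator measurableSet_closedBall]
        refine lintegral_mono fun t => ?_
        by_cases ht : t ∈ s
        · rw [Set.indicator_of_mem ht, enorm_mul]
          gcongr
          rw [Real.enorm_eq_ofReal_abs, ← ENNReal.ofReal_mul hM]
          exact ENNReal.ofReal_le_ofReal (hk n x t)
        · rw [hk0 n x t (by simpa [hs] using ht)]
          simp
      refine (pow_le_pow_left₀ zero_le h2 2).trans ?_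
      rw [mul_pow]
      gcongr
      exact sq_setLIntegral_le (hpt x)
    rw [eLpNorm_two_sq_enorm]
    refine (lintegral_mono h1).trans ?_
    have hC : (ENNReal.ofReal M * N) ^ 2 * volume s ≠ ⊤ :=
      ENNReal.mul_ne_top (by simp [hN, ENNReal.mul_eq_top]) measure_closedBall_lt_top.ne
    simp only [← mul_assoc]
    rw [lintegral_const_mul' _ _ hC]
    rw [lintegral_lintegral_swap (hjm.mono_ac
      ((Measure.AbsolutelyContinuous.refl _).prod Measure.restrict_le_self.absolutelyContinuous))]
    have h3 : ∫⁻ t in s, ∫⁻ x, ‖u (x - t) - u x‖ₑ ^ 2 ≤ volume s * ε ^ 2 := by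
      rw [mul_comm, ← setLIntegral_const]
      refine setLIntegral_mono' measurableSet_closedBall fun t ht => ?_
      rw [← eLpNorm_two_sq_enorm]
      exact pow_le_pow_left₀ zero_le (hε t (by simpa [hs] using ht)) 2
    refine (mul_le_mul_right h3 _).trans (le_of_eq ?_)
    rw [hD, ← hsV]
    ring
  rw [ENNReal.tendsto_nhds_zero]
  intro ε hε
  have hlim := tendsto_eLpNorm_translate_sub hu
  obtain ⟨ε', hε', hle⟩ : ∃ ε' : ℝ≥0∞, 0 < ε' ∧ D * ε' ^ 2 ≤ ε ^ 2 := by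
    have h1 : Tendsto (fun e : ℝ≥0∞ => D * e ^ 2) (𝓝[>] 0) (𝓝 (D * 0 ^ 2)) :=
      (ENNReal.Tendsto.const_mul (((ENNReal.continuous_pow 2).tendsto 0).mono_left
        nhdsWithin_le_nhds) (Or.inr hDtop))
    rw [zero_pow two_ne_zero, mul_zero] at h1
    have h2 := (ENNReal.tendsto_nhds_zero.1 h1) (ε ^ 2) (by positivity)
    obtain ⟨e, he1, he2⟩ := (h2.and self_mem_nhdsWithin).exists
    exact ⟨e, he2, he1⟩
  obtain ⟨d, hd, hdlt⟩ := Metric.eventually_nhds_iff.1 ((ENNReal.tendsto_nhds_zero.1 hlim) ε' hε')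
  have h0 := (tendsto_one_div_add_atTop_nhds_zero_nat (𝕜 := ℝ)).eventually_lt_const hd
  filter_upwards [h0] with n hn
  have := (key ε' n fun t ht => hdlt (by simpa using ht.trans_lt hn)).trans hle
  exact le_of_not_gt fun h => (ENNReal.pow_lt_pow_left two_ne_zero h).not_ge this

/-- The convolution `θ ⋆ u`. -/
noncomputable def moll (θ u : Chart → ℝ) (x : Chart) : ℝ := ∫ t, θ t * u (x - t)

section moll

variable {θ u v : Chart → ℝ}

theorem moll_eq_convolution (θ u : Chart → ℝ) :
    moll θ u = convolution θ u (ContinuousLinearMap.mul ℝ ℝ) volume := rfl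

theorem integrable_moll (hθ : Continuous θ) (hc : HasCompactSupport θ)
    (hu : LocallyIntegrable u volume) (x : Chart) : Integrable fun t => θ t * u (x - t) :=
  hc.convolutionExists_left (ContinuousLinearMap.mul ℝ ℝ) hθ hu x

theorem contDiff_moll (hθ : ContDiff ℝ ∞ θ) (hc : HasCompactSupport θ)
    (hu : LocallyIntegrable u volume) : ContDiff ℝ ∞ (moll θ u) := by
  rw [moll_eq_convolution]
  exact hc.contDiff_convolution_left _ hθ hu

theorem pd_moll (hθ : ContDiff ℝ ∞ θ) (hc : HasCompactSupport θ)
    (hu : LocallyIntegrable u volume) (i : Fin 3) (x : Chart) :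
    pd i (moll θ u) x = moll (pd i θ) u x := by
  have hθ1 : ContDiff ℝ 1 θ := contDiff_infty.1 hθ 1
  have h := hc.hasFDerivAt_convolution_left (ContinuousLinearMap.mul ℝ ℝ) hθ1 hu x
  have hi := (hc.fderiv (𝕜 := ℝ)).convolutionExists_left
    ((ContinuousLinearMap.mul ℝ ℝ).precompL Chart)
    (hθ1.continuous_fderiv one_ne_zero) hu x
  rw [pd, moll_eq_convolution, h.fderiv, convolution, ContinuousLinearMap.integral_apply hi]
  rfl

theorem hasCompactSupport_moll (hc : HasCompactSupport θ) (hu : HasCompactSupport u) :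
    HasCompactSupport (moll θ u) := by
  rw [moll_eq_convolution]
  exact hc.convolution _ hu

theorem integral_mul_sub (hu : LocallyIntegrable u volume) (hθ : Continuous θ)
    (hc : HasCompactSupport θ) (x : Chart) :
    ∫ t, θ t * (u (x - t) - u x) = moll θ u x - (∫ t, θ t) * u x := by
  simp only [mul_sub]
  rw [integral_sub (integrable_moll hθ hc hu x)
    ((hθ.integrable_of_hasCompactSupport hc).mul_const _), integral_mul_const]
  rfl

theorem moll_comm (θ u : Chart → ℝ) (x : Chart) : moll θ u x = ∫ y, θ (x - y) * u y := by
  rw [moll, ← integral_sub_left_eq_self _ volume x]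
  simp

theorem moll_eq_zero {R ε : ℝ} (hθ : ∀ t, ε < ‖t‖ → θ t = 0) (hu : ∀ x, R < ‖x‖ → u x = 0)
    {x : Chart} (hx : R + ε < ‖x‖) : moll θ u x = 0 := by
  rw [moll]
  refine integral_eq_zero_of_ae (Eventually.of_forall fun t => ?_)
  rcases lt_or_ge ε ‖t‖ with h | h
  · simp [hθ t h]
  · have : R < ‖x - t‖ := by
      have := norm_sub_norm_le x t
      linarith
    simp [hu _ this]

end moll

/-- A mollifier: a sequence of smooth functions with integral one concentrating at the origin. -/
structure IsMollifier (η : ℕ → Chart → ℝ) (M : ℝ) : Prop where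
  contDiff : ∀ n, ContDiff ℝ ∞ (η n)
  eq_zero : ∀ (n : ℕ) (t : Chart), 1 / ((n : ℝ) + 1) < ‖t‖ → η n t = 0
  integral : ∀ n, ∫ t, η n t = 1
  nonneg : ∀ n t, 0 ≤ η n t
  bound : ∀ n t, |η n t| ≤ M * ((n : ℝ) + 1) ^ 3
  pd_bound : ∀ i n t, ‖t‖ * |pd i (η n) t| ≤ M * ((n : ℝ) + 1) ^ 3

theorem pd_comp_smul {f : Chart → ℝ} (hf : Differentiable ℝ f) (c : ℝ) (i : Fin 3) (x : Chart) :
    pd i (fun y => f (c • y)) x = c * pd i f (c • x) := by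
  have h : HasFDerivAt (fun y : Chart => f (c • y))
      ((fderiv ℝ f (c • x)).comp (c • ContinuousLinearMap.id ℝ Chart)) x :=
    (hf (c • x)).hasFDerivAt.comp x ((hasFDerivAt_id x).const_smul c)
  rw [pd, h.fderiv]
  simp [pd]

theorem pd_eq_zero_of_norm {f : Chart → ℝ} {R : ℝ} (h : ∀ x, R < ‖x‖ → f x = 0) {x : Chart}
    (hx : R < ‖x‖) (i : Fin 3) : pd i f x = 0 := by
  have : f =ᶠ[𝓝 x] fun _ => 0 :=
    Filter.mem_of_superset ((isOpen_lt continuous_const continuous_norm).mem_nhds hx) h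
  rw [pd, this.fderiv_eq]
  simp

theorem hasCompactSupport_of_norm {E : Type*} [Zero E] {f : Chart → E} {R : ℝ}
    (h : ∀ x, R < ‖x‖ → f x = 0) : HasCompactSupport f :=
  HasCompactSupport.intro (isCompact_closedBall (0 : Chart) R) fun x hx => h x (by simpa using hx)

theorem exists_isMollifier : ∃ η M, IsMollifier η M := by
  set b : ContDiffBump (0 : Chart) := ⟨1 / 2, 1, by norm_num, by norm_num⟩
  set f : Chart → ℝ := b.normed volume
  have hf : ContDiff ℝ ∞ f := b.contDiff_normed
  have hf0 : ∀ t : Chart, 1 < ‖t‖ → f t = 0 := by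
    intro t ht
    have := b.support_normed_eq (μ := (volume : Measure Chart))
    by_contra h
    have h' : t ∈ Function.support (b.normed (volume : Measure Chart)) := h
    rw [this, Metric.mem_ball, dist_zero_right] at h'
    exact lt_irrefl _ (h'.trans ht)
  have hcs := hasCompactSupport_of_norm hf0
  have hpc : ∀ i, Continuous (pd i f) := fun i => continuous_pd (contDiff_infty.1 hf 1)
  obtain ⟨M₀, hM₀⟩ := hf.continuous.bounded_above_of_compact_support hcs
  choose D hD using fun i => (hpc i).bounded_above_of_compact_support (hcs.pd (i := i))
  have hM0 : 0 ≤ M₀ := (norm_nonneg _).trans (hM₀ 0)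
  have hD0 : ∀ i, 0 ≤ D i := fun i => (norm_nonneg _).trans (hD i 0)
  have hDs : ∀ i, D i ≤ ∑ j, D j := fun i =>
    Finset.single_le_sum (fun j _ => hD0 j) (Finset.mem_univ i)
  -- The rescaled bump `(n + 1)³ f((n + 1)t)`; one constant bounds `f` and all its first
  -- derivatives.
  refine ⟨fun n t => ((n : ℝ) + 1) ^ 3 * f (((n : ℝ) + 1) • t), M₀ + ∑ i, D i, ?_⟩
  have hpos : ∀ n : ℕ, (0 : ℝ) < (n : ℝ) + 1 := fun n => by positivity
  have hz : ∀ (n : ℕ) (t : Chart), 1 / ((n : ℝ) + 1) < ‖t‖ → 1 < ‖((n : ℝ) + 1) • t‖ := by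
    intro n t ht
    rw [norm_smul, Real.norm_of_nonneg (hpos n).le]
    rwa [div_lt_iff₀ (hpos n), mul_comm] at ht
  constructor
  · intro n
    exact contDiff_const.mul (hf.comp (contDiff_const_smul _))
  · intro n t ht
    rw [hf0 _ (hz n t ht), mul_zero]
  · intro n
    rw [integral_const_mul, Measure.integral_comp_smul, b.integral_normed,
      finrank_euclideanSpace_fin, smul_eq_mul, mul_one, abs_of_pos (by positivity),
      mul_inv_cancel₀ (by positivity)]
  · intro n t
    exact mul_nonneg (by positivity) (b.nonneg_normed _)
  · intro n t
    rw [abs_mul, abs_of_pos (pow_pos (hpos n) 3), mul_comm]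
    refine mul_le_mul_of_nonneg_right ((hM₀ _).trans ?_) (by positivity)
    exact le_add_of_nonneg_right (Finset.sum_nonneg fun i _ => hD0 i)
  · intro i n t
    have hd : Differentiable ℝ f := hf.differentiable (by simp)
    have hd' : DifferentiableAt ℝ (fun t => f (((n : ℝ) + 1) • t)) t :=
      (hd.comp (differentiable_id.const_smul ((n : ℝ) + 1))) t
    rw [pd_const_mul _ hd',
      pd_comp_smul hd, abs_mul, abs_mul, abs_of_pos (pow_pos (hpos n) 3), abs_of_pos (hpos n)]
    rcases lt_or_ge (1 / ((n : ℝ) + 1)) ‖t‖ with h | h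
    · rw [pd_eq_zero_of_norm hf0 (hz n t h) i, abs_zero]
      simp only [mul_zero]
      exact mul_nonneg (add_nonneg hM0 (Finset.sum_nonneg fun i _ => hD0 i)) (by positivity)
    -- Differentiation costs a factor `n + 1`, which `‖t‖ ≤ 1/(n + 1)` on the support pays for.
    · rw [le_div_iff₀ (hpos n)] at h
      have h1 : |pd i f (((n : ℝ) + 1) • t)| ≤ M₀ + ∑ i, D i :=
        ((hD i _).trans (hDs i)).trans (le_add_of_nonneg_left hM0)
      calc ‖t‖ * (((n : ℝ) + 1) ^ 3 * (((n : ℝ) + 1) * |pd i f (((n : ℝ) + 1) • t)|))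
          = (‖t‖ * ((n : ℝ) + 1)) * (|pd i f (((n : ℝ) + 1) • t)| * ((n : ℝ) + 1) ^ 3) := by ring
        _ ≤ 1 * ((M₀ + ∑ i, D i) * ((n : ℝ) + 1) ^ 3) := by
            gcongr
        _ = _ := one_mul _

namespace IsMollifier

variable {η : ℕ → Chart → ℝ} {M : ℝ}

theorem hasCompactSupport (hη : IsMollifier η M) (n : ℕ) : HasCompactSupport (η n) :=
  hasCompactSupport_of_norm (hη.eq_zero n)

theorem continuous_pd (hη : IsMollifier η M) (i : Fin 3) (n : ℕ) : Continuous (pd i (η n)) :=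
  _root_.continuous_pd (contDiff_infty.1 (hη.contDiff n) 1)

theorem tendstoL2 (hη : IsMollifier η M) {u : Chart → ℝ} (hu : MemLp u 2 volume) :
    TendstoL2 (fun n => moll (η n) u) u := by
  refine (tendsto_eLpNorm_kernel hu (k := fun n _ t => η n t) (fun n _ t => hη.bound n t)
    (fun n _ t => hη.eq_zero n t)).congr fun n => ?_
  congr 1; funext x
  rw [integral_mul_sub (hu.locallyIntegrable one_le_two) (hη.contDiff n).continuous
    (hη.hasCompactSupport n), hη.integral, one_mul]
  rfl

/-- Friedrichs' lemma on the commutator of a mollifier and a differential operator. -/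
theorem tendsto_commutator (hη : IsMollifier η M) {u c : Chart → ℝ} (hu : MemLp u 2 volume)
    (hc : ContDiff ℝ 1 c) (hcs : HasCompactSupport c) (i : Fin 3) :
    TendstoL2 (fun n x => pd i (fun y => c y * moll (η n) u y) x
      - moll (pd i (η n)) (fun y => c y * u y) x) 0 := by
  have hul := hu.locallyIntegrable one_le_two
  have hcul : LocallyIntegrable (fun y => c y * u y) volume := by
    simpa only [smul_eq_mul, mul_comm] using hul.smul_continuous hc.continuous
  have hpc := _root_.continuous_pd (i := i) hc
  obtain ⟨L, hL⟩ := hc.lipschitzWith_of_hasCompactSupport hcs one_ne_zero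
  obtain ⟨D, hD⟩ := hpc.bounded_above_of_compact_support hcs.pd
  have hD0 : 0 ≤ D := (norm_nonneg _).trans (hD 0)
  have hunif : UniformContinuous (pd i c) :=
    hpc.uniformContinuous_of_tendsto_cocompact (x := 0) (hcs.pd (i := i)).is_zero_at_infty
  -- The commutator is `∫ k(x, t) u(x - t) dt`. The Lipschitz difference `c(x) - c(x - t)`
  -- compensates the extra factor in `∂η`, so `k` obeys the bounds of `tendsto_eLpNorm_kernel`.
  set k : ℕ → Chart → Chart → ℝ := fun n x t =>
    pd i c x * η n t + (c x - c (x - t)) * pd i (η n) t with hk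
  set ε : ℕ → Chart → ℝ := fun n x => ∫ t, k n x t with hε
  have hkc : ∀ n x, Continuous (k n x) := fun n x =>
    ((hη.contDiff n).continuous.const_mul _).add
      ((continuous_const.sub (hc.continuous.comp (continuous_const.sub continuous_id))).mul
        (hη.continuous_pd i n))
  have hk0 : ∀ (n : ℕ) x t, 1 / ((n : ℝ) + 1) < ‖t‖ → k n x t = 0 := by
    intro n x t ht
    simp only [hk, hη.eq_zero n t ht, pd_eq_zero_of_norm (hη.eq_zero n) ht, mul_zero, add_zero]
  have hkb : ∀ (n : ℕ) x t, |k n x t| ≤ (D * M + L * M) * ((n : ℝ) + 1) ^ 3 := by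
    intro n x t
    have h1 : |c x - c (x - t)| ≤ L * ‖t‖ := by
      have := hL.dist_le_mul x (x - t)
      rwa [Real.dist_eq, dist_eq_norm, sub_sub_cancel] at this
    refine (abs_add_le _ _).trans ?_
    rw [abs_mul, abs_mul, add_mul]
    refine add_le_add ?_ ?_
    · rw [mul_assoc]
      exact mul_le_mul (hD x) (hη.bound n t) (abs_nonneg _) hD0
    · refine (mul_le_mul_of_nonneg_right h1 (abs_nonneg _)).trans ?_
      rw [mul_assoc, mul_assoc]
      exact mul_le_mul_of_nonneg_left (hη.pd_bound i n t) L.2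
  -- Writing `u(x - t) = (u(x - t) - u(x)) + u(x)` leaves a concentrating kernel, which tends to
  -- zero, and the total mass `ε n x` of `k` times `u`.
  have hsplit : ∀ n x, pd i (fun y => c y * moll (η n) u y) x
      - moll (pd i (η n)) (fun y => c y * u y) x
        = (∫ t, k n x t * (u (x - t) - u x)) + ε n x * u x := by
    intro n x
    have hηs := contDiff_infty.1 (hη.contDiff n) 1
    rw [integral_mul_sub hul (hkc n x) (hasCompactSupport_of_norm (hk0 n x)), sub_add_cancel,
      pd_mul (hc.differentiable one_ne_zero x)
        ((contDiff_moll (hη.contDiff n) (hη.hasCompactSupport n) hul).differentiable (by simp) x),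
      pd_moll (hη.contDiff n) (hη.hasCompactSupport n) hul]
    simp only [moll, hk]
    have i1 := (integrable_moll (hη.contDiff n).continuous (hη.hasCompactSupport n) hul x).const_mul
      (pd i c x)
    have i2 := (integrable_moll (hη.continuous_pd i n) (hη.hasCompactSupport n).pd hul x).const_mul
      (c x)
    have i3 := integrable_moll (hη.continuous_pd i n) (hη.hasCompactSupport n).pd hcul x
    have i12 : Integrable (fun t => pd i c x * (η n t * u (x - t))
        + c x * (pd i (η n) t * u (x - t))) := i1.add i2
    rw [← integral_const_mul, ← integral_const_mul, ← integral_add i1 i2, ← integral_sub i12 i3]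
    congr 1; funext t
    ring
  -- Integrating `∂η` by parts shows that the mass is an average of `∂c(x) - ∂c(x - t)`; it tends to
  -- zero uniformly, as `∂c` is uniformly continuous. Only `c ∈ C¹` is used.
  have hεeq : ∀ n x, ε n x = ∫ t, η n t * (pd i c x - pd i c (x - t)) := by
    intro n x
    have hηs := contDiff_infty.1 (hη.contDiff n) 1
    have j0 := (hη.contDiff n).continuous.integrable_of_hasCompactSupport (hη.hasCompactSupport n)
      (μ := volume)
    have j1 := (hη.continuous_pd i n).integrable_of_hasCompactSupport (hη.hasCompactSupport n).pd
      (μ := volume)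
    have j2 := integrable_moll (hη.contDiff n).continuous (hη.hasCompactSupport n)
      (hpc.locallyIntegrable (μ := volume)) x
    have j3 := integrable_moll (hη.continuous_pd i n) (hη.hasCompactSupport n).pd
      (hc.continuous.locallyIntegrable (μ := volume)) x
    have hg : ContDiff ℝ 1 fun t : Chart => c (x - t) := hc.comp (contDiff_const.sub contDiff_id)
    have hpg : ∀ t, pd i (fun t : Chart => c (x - t)) t = -pd i c (x - t) := by
      intro t
      have h : HasFDerivAt (fun y : Chart => c (x - y))
          ((fderiv ℝ c (x - t)).comp (-ContinuousLinearMap.id ℝ Chart)) t :=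
        (hc.differentiable one_ne_zero (x - t)).hasFDerivAt.comp t ((hasFDerivAt_id t).const_sub x)
      rw [pd, h.fderiv]
      simp [pd]
    have hp := InitialSurface.integral_pd_mul i hηs hg (Or.inl (hη.hasCompactSupport n))
    have hz := integral_pd_eq_zero (i := i) hηs (hη.hasCompactSupport n)
    simp only [hpg, mul_neg, integral_neg, neg_neg] at hp
    have e1 : ε n x = pd i c x * (∫ t, η n t) + (c x * (∫ t, pd i (η n) t)
        - ∫ t, pd i (η n) t * c (x - t)) := by
      have j13 : Integrable fun t => c x * pd i (η n) t - pd i (η n) t * c (x - t) :=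
        (j1.const_mul _).sub j3
      rw [← integral_const_mul, ← integral_const_mul, ← integral_sub (j1.const_mul _) j3,
        ← integral_add (j0.const_mul _) j13]
      exact integral_congr_ae (Eventually.of_forall fun t => by simp only [hk]; ring)
    have e2 : ∫ t, η n t * (pd i c x - pd i c (x - t))
        = (∫ t, η n t) * pd i c x - ∫ t, η n t * pd i c (x - t) := by
      rw [← integral_mul_const, ← integral_sub (j0.mul_const _) j2]
      congr 1; funext t; ring
    rw [e1, e2, hz, hp]; ring
  have hεlim : ∀ e : ℝ, 0 < e → ∀ᶠ n in atTop, ∀ x, |ε n x| ≤ e := by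
    intro e he
    obtain ⟨d, hd, hd'⟩ := Metric.uniformContinuous_iff.1 hunif e he
    filter_upwards [(tendsto_one_div_add_atTop_nhds_zero_nat (𝕜 := ℝ)).eventually_lt_const hd]
      with n hn x
    rw [hεeq, ← Real.norm_eq_abs]
    have j0 := (hη.contDiff n).continuous.integrable_of_hasCompactSupport (hη.hasCompactSupport n)
      (μ := volume)
    refine (norm_integral_le_of_norm_le (j0.mul_const e) (Eventually.of_forall fun t => ?_)).trans
      (by rw [integral_mul_const, hη.integral, one_mul])
    rw [norm_mul, Real.norm_of_nonneg (hη.nonneg n t)]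
    rcases lt_or_ge (1 / ((n : ℝ) + 1)) ‖t‖ with h | h
    · simp [hη.eq_zero n t h]
    · refine mul_le_mul_of_nonneg_left ?_ (hη.nonneg n t)
      rw [← dist_eq_norm]
      refine (hd' ?_).le
      rw [dist_eq_norm, sub_sub_cancel]
      exact h.trans_lt hn
  have hεu : TendstoL2 (fun n x => ε n x * u x) 0 := by
    unfold TendstoL2
    rw [ENNReal.tendsto_nhds_zero]
    intro a ha
    obtain ⟨e, he, hle⟩ : ∃ e : ℝ, 0 < e ∧ ENNReal.ofReal e * eLpNorm u 2 volume ≤ a := by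
      have h1 : Tendsto (fun e : ℝ => ENNReal.ofReal e * eLpNorm u 2 volume) (𝓝[>] 0)
          (𝓝 (ENNReal.ofReal 0 * eLpNorm u 2 volume)) :=
        ENNReal.Tendsto.mul_const ((ENNReal.continuous_ofReal.tendsto 0).mono_left
          nhdsWithin_le_nhds) (Or.inr hu.2.ne)
      rw [ENNReal.ofReal_zero, zero_mul] at h1
      obtain ⟨e, he1, he2⟩ := ((ENNReal.tendsto_nhds_zero.1 h1 a ha).and self_mem_nhdsWithin).exists
      exact ⟨e, he2, he1⟩
    filter_upwards [hεlim e he] with n hn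
    refine (eLpNorm_le_mul_eLpNorm_of_ae_le_mul (Eventually.of_forall fun x => ?_) 2).trans hle
    simp only [Pi.sub_apply, Pi.zero_apply, sub_zero, norm_mul]
    exact mul_le_mul_of_nonneg_right (hn x) (norm_nonneg _)
  have hw : ∀ n, Continuous fun x => pd i (fun y => c y * moll (η n) u y) x
      - moll (pd i (η n)) (fun y => c y * u y) x := fun n =>
    (_root_.continuous_pd (hc.mul (contDiff_infty.1 (contDiff_moll (hη.contDiff n)
      (hη.hasCompactSupport n) hul) 1))).sub
      (contDiff_moll (contDiff_pd (hη.contDiff n) (by simp)) (hη.hasCompactSupport n).pd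
        hcul).continuous
  have hεm : ∀ n, AEStronglyMeasurable (fun x => ε n x * u x) volume := by
    intro n
    refine AEStronglyMeasurable.mul (Continuous.aestronglyMeasurable ?_) hu.1
    have : ε n = fun x => pd i c x - moll (η n) (pd i c) x := by
      funext x
      rw [hεeq]
      have j0 := (hη.contDiff n).continuous.integrable_of_hasCompactSupport
        (hη.hasCompactSupport n) (μ := volume)
      have j2 := integrable_moll (hη.contDiff n).continuous (hη.hasCompactSupport n)
        (hpc.locallyIntegrable (μ := volume)) x
      simp only [mul_sub]
      rw [integral_sub (j0.mul_const _) j2, integral_mul_const, hη.integral, one_mul]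
      rfl
    rw [this]
    exact hpc.sub (contDiff_moll (hη.contDiff n) (hη.hasCompactSupport n)
      hpc.locallyIntegrable).continuous
  have hI : TendstoL2 (fun n x => ∫ t, k n x t * (u (x - t) - u x)) 0 :=
    (tendsto_eLpNorm_kernel hu hkb hk0).congr fun n => by rw [sub_zero]
  have hIm : ∀ n, AEStronglyMeasurable (fun x => ∫ t, k n x t * (u (x - t) - u x)) volume := by
    intro n
    refine ((hw n).aestronglyMeasurable.sub (hεm n)).congr (Eventually.of_forall fun x => ?_)
    simp only [Pi.sub_apply, hsplit, add_sub_cancel_right]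
  have := hI.add hεu (fun n => by simpa using hIm n) (fun n => by simpa using hεm n)
  simp only [hsplit]
  simp only [Pi.zero_apply, add_zero] at this
  exact this

end IsMollifier

theorem TendstoL2.sum_zero {ι : Type*} (s : Finset ι) {f : ι → ℕ → Chart → ℝ}
    (h : ∀ i, TendstoL2 (f i) 0) (hm : ∀ i n, AEStronglyMeasurable (f i n) volume) :
    TendstoL2 (fun n x => ∑ i ∈ s, f i n x) 0 := by
  classical
  induction s using Finset.induction_on with
  | empty =>
    have : (fun (n : ℕ) (x : Chart) => ∑ i ∈ (∅ : Finset ι), f i n x) = fun _ => 0 := by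
      funext n x; simp
    rw [this]; simp [TendstoL2]
  | insert a s ha ih =>
    simp only [Finset.sum_insert ha]
    have := (h a).add ih (fun n => by simpa using hm a n) fun n => by
      rw [sub_zero]
      exact Finset.aestronglyMeasurable_fun_sum s fun i _ => hm i n
    simp only [Pi.zero_apply, add_zero] at this
    exact this

theorem exists_cutoff (R : ℝ) : ∃ χ : Chart → ℝ, ContDiff ℝ ∞ χ ∧ HasCompactSupport χ ∧
    ∀ x, ‖x‖ ≤ R → χ x = 1 := by
  set b : ContDiffBump (0 : Chart) :=
    ⟨max R 1, max R 1 + 1, lt_max_of_lt_right one_pos, lt_add_one _⟩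
  refine ⟨b, b.contDiff, b.hasCompactSupport, fun x hx => b.one_of_mem_closedBall ?_⟩
  rw [mem_closedBall_zero_iff]
  exact hx.trans (le_max_left R 1)

namespace IsMollifier

variable {η : ℕ → Chart → ℝ} {M : ℝ}

theorem moll_eq_zero (hη : IsMollifier η M) {u : Chart → ℝ} {R : ℝ}
    (hR : ∀ x, R < ‖x‖ → u x = 0) (n : ℕ) {x : Chart} (hx : R + 1 < ‖x‖) :
    moll (η n) u x = 0 := by
  refine _root_.moll_eq_zero (ε := 1) (fun t ht => hη.eq_zero n t (lt_of_le_of_lt ?_ ht)) hR hx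
  rw [div_le_one (by positivity)]
  have : (0 : ℝ) ≤ n := n.cast_nonneg
  linarith

/-- The coefficient may be cut off freely outside the ball of radius `R + 1`, which contains the
supports of `u` and of its mollifications. -/
theorem tendsto_commutator_of_support (hη : IsMollifier η M) {u c : Chart → ℝ}
    (hu : MemLp u 2 volume) {R : ℝ} (hR : ∀ x, R < ‖x‖ → u x = 0) (hc : ContDiff ℝ 1 c)
    (i : Fin 3) :
    TendstoL2 (fun n x => pd i (fun y => c y * moll (η n) u y) x
      - moll (pd i (η n)) (fun y => c y * u y) x) 0 := by
  obtain ⟨χ, hχ, hχc, hχ1⟩ := exists_cutoff (R + 1)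
  have h := hη.tendsto_commutator hu ((contDiff_infty.1 hχ 1).mul hc) hχc.mul_right i
  have e1 : ∀ n, (fun y => χ y * c y * moll (η n) u y) = fun y => c y * moll (η n) u y := by
    intro n; funext y
    rcases le_or_gt ‖y‖ (R + 1) with hy | hy
    · rw [hχ1 y hy, one_mul]
    · simp [hη.moll_eq_zero hR n hy]
  have e2 : (fun y => χ y * c y * u y) = fun y => c y * u y := by
    funext y
    rcases le_or_gt ‖y‖ (R + 1) with hy | hy
    · rw [hχ1 y hy, one_mul]
    · simp [hR y (by linarith)]
  simpa only [e1, e2] using h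

/-- A weak solution of a first order system in divergence form is a strong solution. -/
theorem tendsto_divergence (hη : IsMollifier η M) {ι : Type*} [Fintype ι] {u : ι → Chart → ℝ}
    {c : ι → Fin 3 → Chart → ℝ} {g : Chart → ℝ} (hu : ∀ α, MemLp (u α) 2 volume) {R : ℝ}
    (hR : ∀ α x, R < ‖x‖ → u α x = 0) (hc : ∀ α i, ContDiff ℝ 1 (c α i)) (hg : MemLp g 2 volume)
    (h : ∀ ψ : Chart → ℝ, ContDiff ℝ ∞ ψ → HasCompactSupport ψ →
      ∫ x, ∑ α, ∑ i, c α i x * u α x * pd i ψ x = ∫ x, g x * ψ x) :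
    TendstoL2 (fun n x => ∑ α, ∑ i, pd i (fun y => c α i y * moll (η n) (u α) y) x)
      (fun x => -g x) := by
  have hul := fun α => (hu α).locallyIntegrable one_le_two
  have hcul : ∀ α i, LocallyIntegrable (fun y => c α i y * u α y) volume := fun α i => by
    simpa only [smul_eq_mul, mul_comm] using (hul α).smul_continuous (hc α i).continuous
  set w : ι → Fin 3 → ℕ → Chart → ℝ := fun α i n x =>
    pd i (fun y => c α i y * moll (η n) (u α) y) x
      - moll (pd i (η n)) (fun y => c α i y * u α y) x
  have hwm : ∀ α i n, AEStronglyMeasurable (w α i n) volume := fun α i n =>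
    ((_root_.continuous_pd ((hc α i).mul (contDiff_infty.1 (contDiff_moll (hη.contDiff n)
      (hη.hasCompactSupport n) (hul α)) 1))).sub
      (contDiff_moll (contDiff_pd (hη.contDiff n) (by simp)) (hη.hasCompactSupport n).pd
        (hcul α i)).continuous).aestronglyMeasurable
  have hw : TendstoL2 (fun n x => ∑ α, ∑ i, w α i n x) 0 :=
    TendstoL2.sum_zero _ (fun α => TendstoL2.sum_zero _ (fun i =>
      hη.tendsto_commutator_of_support (hu α) (hR α) (hc α i) i) (hwm α)) fun α n =>
      Finset.aestronglyMeasurable_fun_sum _ fun i _ => hwm α i n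
  have hsum : ∀ n x, ∑ α, ∑ i, moll (pd i (η n)) (fun y => c α i y * u α y) x
      = -moll (η n) g x := by
    intro n x
    -- The weak equation is tested with `y ↦ η n (x - y)`; this mollifies it exactly, and passing to
    -- `∂_i(c · (η ⋆ u))` costs only commutators.
    have hψ : ContDiff ℝ ∞ fun y : Chart => η n (x - y) :=
      (hη.contDiff n).comp (contDiff_const.sub contDiff_id)
    have hψc : HasCompactSupport fun y : Chart => η n (x - y) :=
      (hη.hasCompactSupport n).comp_homeomorph (Homeomorph.subLeft x)
    have hpd : ∀ i y, pd i (fun y : Chart => η n (x - y)) y = -pd i (η n) (x - y) := by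
      intro i y
      have h : HasFDerivAt (fun y : Chart => η n (x - y))
          ((fderiv ℝ (η n) (x - y)).comp (-ContinuousLinearMap.id ℝ Chart)) y :=
        ((hη.contDiff n).differentiable (by simp) (x - y)).hasFDerivAt.comp y
          ((hasFDerivAt_id y).const_sub x)
      rw [pd, h.fderiv]
      simp [pd]
    have hint : ∀ α i, Integrable (fun y => pd i (η n) (x - y) * (c α i y * u α y)) volume := by
      intro α i
      have := (integrable_moll (hη.continuous_pd i n) (hη.hasCompactSupport n).pd
        (hcul α i) x).comp_sub_left x
      simpa using this
    rw [moll_comm, ← integral_neg]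
    have e := h _ hψ hψc
    simp only [hpd] at e
    simp only [moll_comm]
    simp only [← integral_finsetSum _ fun i _ => hint _ i]
    rw [← integral_finsetSum _ fun α _ => integrable_finsetSum _ fun i _ => hint α i]
    rw [integral_neg, ← integral_congr_ae (Eventually.of_forall fun y => mul_comm (g y) _), ← e,
      ← integral_neg]
    congr 1; funext y
    simp only [← Finset.sum_neg_distrib]
    refine Finset.sum_congr rfl fun α _ => Finset.sum_congr rfl fun i _ => by ring
  have hgl := (hη.tendstoL2 hg).neg
  have := hw.add hgl (fun n => by
    rw [sub_zero]
    exact Finset.aestronglyMeasurable_fun_sum _ fun α _ =>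
      Finset.aestronglyMeasurable_fun_sum _ fun i _ => hwm α i n) fun n =>
    (contDiff_moll (hη.contDiff n) (hη.hasCompactSupport n)
      (hg.locallyIntegrable one_le_two)).continuous.neg.aestronglyMeasurable.sub hg.1.neg
  have e : (fun (n : ℕ) x => ∑ α, ∑ i, w α i n x + -moll (η n) g x)
      = fun n x => ∑ α, ∑ i, pd i (fun y => c α i y * moll (η n) (u α) y) x := by
    funext n x
    rw [← hsum]
    simp only [w, Finset.sum_sub_distrib, sub_add_cancel]
  rw [e] at this
  simpa only [Pi.zero_apply, zero_add] using this

end IsMollifier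

namespace InitialSurface

variable {S : InitialSurface} {r : Chart → ℝ}

/-! ### The first order elliptic system `(X, ψ) ↦ (∇ × X - dψ, ∇ · X)` -/

variable (S) in
/-- The vector density `√h (∇ × X - dψ)^k`. -/
noncomputable def curlSubGrad (X : Chart → Cov) (ψ : Chart → ℝ) (x : Chart) : Cov := fun k =>
  alt (S.covDeriv X x) k - S.sqrtDet x * S.raise x (grad ψ x) k

variable (S) in
/-- The density `√h ∇ · X`. -/
noncomputable def divDensity (X : Chart → Cov) (x : Chart) : ℝ :=
  S.sqrtDet x * S.trace x (S.covDeriv X x)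

theorem continuous_curl {X : Chart → Cov} (hX : ContDiff ℝ ∞ X) : Continuous (S.curl X) := by
  have h1 := continuous_covDeriv (S := S) hX
  refine continuous_pi fun i => ?_
  simp only [curl, epsContract_eq]
  refine continuous_finsetSum _ fun l _ => ((S.h_contDiff i l).continuous).mul ?_
  exact ((continuous_alt l).comp h1).div S.continuous_sqrtDet fun x => (S.sqrtDet_pos x).ne'

theorem hasCompactSupport_curl {X : Chart → Cov} (hX : HasCompactSupport X) :
    HasCompactSupport (S.curl X) :=
  hasCompactSupport_of_zero (hasCompactSupport_covDeriv (S := S) hX) fun x hx => by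
    funext i; simp [curl, epsContract, hx]

theorem memLp_curl (X : testForms) : MemLp (S.curl X) 2 volume :=
  (continuous_curl (testForms_contDiff X)).memLp_of_hasCompactSupport
    (hasCompactSupport_curl (testForms_compact X))

theorem memLp_grad {ψ : Chart → ℝ} (hψ : ContDiff ℝ ∞ ψ) (hc : HasCompactSupport ψ) :
    MemLp (grad ψ) 2 volume :=
  (contDiff_grad hψ).continuous.memLp_of_hasCompactSupport (hasCompactSupport_grad hc)

theorem continuous_divDensity {X : Chart → Cov} (hX : ContDiff ℝ ∞ X) :
    Continuous (S.divDensity X) := by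
  have h1 := fun i j => (contDiff_covDeriv (S := S) hX i j).continuous
  have h2 := S.continuous_hinv
  have h3 := S.continuous_sqrtDet
  unfold divDensity trace
  fun_prop

theorem memLp_divDensity (X : testForms) : MemLp (S.divDensity X) 2 volume :=
  (continuous_divDensity (testForms_contDiff X)).memLp_of_hasCompactSupport
    (hasCompactSupport_of_zero (hasCompactSupport_covDeriv (S := S) (testForms_compact X))
      fun x hx => by simp [divDensity, trace, hx])

theorem curlSubGrad_eq (X : Chart → Cov) (ψ : Chart → ℝ) (x : Chart) (k : Fin 3) :
    S.curlSubGrad X ψ x k = S.sqrtDet x * S.raise x (S.curl X x - grad ψ x) k := by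
  have := (S.sqrtDet_pos x).ne'
  rw [curlSubGrad, raise_sub, curl, raise_epsContract]
  field_simp

/-- Returns from the vector density, which is convenient for mollification, to the `1`-form whose
norm enters the energy identity. -/
theorem exists_norm_le_curlSubGrad : ∃ K : ℝ, 0 ≤ K ∧ ∀ X ψ x,
    ‖S.curl X x - grad ψ x‖ ≤ K * ‖S.curlSubGrad X ψ x‖ := by
  obtain ⟨c, d, hc, -, h⟩ := S.exists_ip_bounds
  obtain ⟨a, b, ha, -, hab⟩ := S.exists_sqrtDet_bounds
  refine ⟨3 / (a * c), by positivity, fun X ψ x => ?_⟩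
  set W := S.curl X x - grad ψ x
  have hV : ∀ k, |S.raise x W k| ≤ a⁻¹ * ‖S.curlSubGrad X ψ x‖ := by
    intro k
    have h1 := abs_cov_le (S.curlSubGrad X ψ x) k
    rw [curlSubGrad_eq, abs_mul, abs_of_pos (S.sqrtDet_pos x)] at h1
    rw [inv_mul_eq_div, le_div_iff₀ ha, mul_comm]
    exact (mul_le_mul_of_nonneg_right (hab x).1 (abs_nonneg _)).trans h1
  have h2 : S.ip x W W ≤ 3 * (‖W‖ * (a⁻¹ * ‖S.curlSubGrad X ψ x‖)) := by
    rw [ip_eq_raise]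
    refine (le_abs_self _).trans (abs_sum_le fun i => ?_)
    rw [abs_mul]
    exact mul_le_mul (abs_cov_le W i) (hV i) (abs_nonneg _) (norm_nonneg _)
  have h3 := (h x W).1.trans h2
  rcases (norm_nonneg W).eq_or_lt with h0 | h0
  · rw [← h0]; positivity
  · have h4 : c * ‖W‖ ≤ 3 * (a⁻¹ * ‖S.curlSubGrad X ψ x‖) := by
      refine le_of_mul_le_mul_right ?_ h0
      linarith
    rw [div_mul_eq_mul_div, le_div_iff₀ (by positivity)]
    calc ‖W‖ * (a * c) = a * (c * ‖W‖) := by ring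
      _ ≤ a * (3 * (a⁻¹ * ‖S.curlSubGrad X ψ x‖)) := by gcongr
      _ = _ := by field_simp

theorem continuous_curlSubGrad {X : Chart → Cov} {ψ : Chart → ℝ} (hX : ContDiff ℝ ∞ X)
    (hψ : ContDiff ℝ ∞ ψ) : Continuous (S.curlSubGrad X ψ) := by
  refine continuous_pi fun k => ?_
  have h1 := contDiff_raise (S := S) (contDiff_grad hψ) k
  exact ((continuous_alt k).comp (continuous_covDeriv hX)).sub
    (S.continuous_sqrtDet.mul h1.continuous)

theorem memLp_curlSubGrad (X : testForms) {ψ : Chart → ℝ} (hψ : ContDiff ℝ ∞ ψ)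
    (hc : HasCompactSupport ψ) : MemLp (S.curlSubGrad X ψ) 2 volume := by
  refine (continuous_curlSubGrad (testForms_contDiff X) hψ).memLp_of_hasCompactSupport ?_
  refine HasCompactSupport.intro ((hasCompactSupport_covDeriv (S := S)
    (testForms_compact X)).isCompact.union (hasCompactSupport_grad hc).isCompact) fun x hx => ?_
  rw [Set.mem_union, not_or] at hx
  funext k
  simp [curlSubGrad, alt, raise, image_eq_zero_of_notMem_tsupport hx.1,
    image_eq_zero_of_notMem_tsupport hx.2]

/-- The Hodge form of the energy, with the square of `∇ × X - dψ` completed; the cross term is zero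
by `integral_ip_curl_grad`. -/
theorem form_add_grad_eq (X : testForms) {ψ : Chart → ℝ} (hψ : ContDiff ℝ ∞ ψ)
    (hc : HasCompactSupport ψ) :
    S.form (-1) X (S.covDeriv X) X (S.covDeriv X)
        + ∫ x, S.sqrtDet x * S.ip x (grad ψ x) (grad ψ x)
      = (∫ x, S.sqrtDet x * S.ip x (S.curl X x - grad ψ x) (S.curl X x - grad ψ x))
        + ∫ x, S.sqrtDet x * (S.trace x (S.covDeriv X x) * S.trace x (S.covDeriv X x)) := by
  have hX := testForms_contDiff X
  have hXc := testForms_compact X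
  have c1 := memLp_curl (S := S) X
  have c2 := memLp_grad hψ hc
  have i11 := S.bddBilin_ip.integrable c1 c1
  have i12 := S.bddBilin_ip.integrable c1 c2
  have i22 := S.bddBilin_ip.integrable c2 c2
  have it : Integrable fun x => S.sqrtDet x *
      (S.trace x (S.covDeriv X x) * S.trace x (S.covDeriv X x)) := by
    have h := fun x => (S.sqrtDet_pos x).ne'
    have h1 := continuous_divDensity (S := S) hX
    have : Continuous fun x => S.sqrtDet x *
        (S.trace x (S.covDeriv X x) * S.trace x (S.covDeriv X x)) := by
      have h2 : Continuous fun x => S.divDensity X x * S.divDensity X x / S.sqrtDet x :=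
        (h1.mul h1).div S.continuous_sqrtDet h
      refine h2.congr fun x => ?_
      have := h x
      rw [divDensity]; field_simp
    refine this.integrable_of_hasCompactSupport
      (hasCompactSupport_of_zero (hasCompactSupport_covDeriv (S := S) hXc) fun x hx => ?_)
    simp [trace, hx]
  have hcross : ∫ x, S.sqrtDet x * S.ip x (S.curl X x) (grad ψ x) = 0 := by
    rw [← integral_vol]; exact integral_ip_curl_grad hX hψ hXc
  rw [integral_form_test hX hX hXc, integral_vol]
  simp only [mul_add]
  rw [integral_add i11 it]
  have e : ∀ x, S.sqrtDet x * S.ip x (S.curl X x - grad ψ x) (S.curl X x - grad ψ x)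
      = (S.sqrtDet x * S.ip x (S.curl X x) (S.curl X x)
        + S.sqrtDet x * S.ip x (grad ψ x) (grad ψ x))
        - 2 * (S.sqrtDet x * S.ip x (S.curl X x) (grad ψ x)) := by
    intro x
    rw [ip_sub_left, ip_sub_right, ip_sub_right, S.ip_symm x (grad ψ x) (S.curl X x)]
    ring
  have i3 : Integrable fun x => S.sqrtDet x * S.ip x (S.curl X x) (S.curl X x)
      + S.sqrtDet x * S.ip x (grad ψ x) (grad ψ x) := i11.add i22
  simp only [e]
  rw [integral_sub i3 (i12.const_mul 2), integral_const_mul, hcross, integral_add i11 i22]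
  ring

/-- A priori estimate for the elliptic system. In `form_add_grad_eq` both terms on the left are
nonnegative, the first being coercive for `σ = -1`, so each is bounded by the right-hand side. -/
theorem exists_energy_estimate {C : ℝ} (hr : S.IsRadius r) (hC : C ∈ S.hardyConstants r)
    (hlt : ENNReal.ofReal C * S.curvatureSize r < 1) :
    ∃ K : ℝ, 0 ≤ K ∧ ∀ (X : testForms) (ψ : Chart → ℝ), ContDiff ℝ ∞ ψ → HasCompactSupport ψ →
      (eLpNorm (S.covDeriv X) 2 volume).toReal ≤ K * ((eLpNorm (S.curlSubGrad X ψ) 2 volume).toReal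
        + (eLpNorm (S.divDensity X) 2 volume).toReal) ∧
      (eLpNorm (grad ψ) 2 volume).toReal ≤ K * ((eLpNorm (S.curlSubGrad X ψ) 2 volume).toReal
        + (eLpNorm (S.divDensity X) 2 volume).toReal) := by
  have hδ := curvatureSize_ne_top hr hC hlt
  have hpos := one_sub_mul_pos hr hC hlt
  obtain ⟨K₁, hK₁, h₁⟩ := exists_norm_le_curlSubGrad (S := S)
  obtain ⟨K₂, hK₂, h₂⟩ := S.bddBilin_ip.exists_integral_le
  obtain ⟨c₃, hc₃, h₃⟩ := exists_le_normSq₂ (S := S)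
  obtain ⟨c₄, hc₄, h₄⟩ := exists_le_integral_ip (S := S)
  obtain ⟨a, b, ha, -, hab⟩ := S.exists_sqrtDet_bounds
  set κ := 1 - C * (S.curvatureSize r).toReal
  -- `Q` bounds the right-hand side of the energy identity in terms of the two densities; `q`
  -- dominates its quotients by the two lower constants, `κ c₃` for `∇X` and `c₄` for `dψ`.
  set Q : ℝ := K₂ * (K₁ * K₁) + a⁻¹ with hQ
  have hQ0 : 0 ≤ Q := by positivity
  set q : ℝ := Q / (κ * c₃) + Q / c₄ with hq
  have hq1 : Q / (κ * c₃) ≤ q := le_add_of_nonneg_right (by positivity)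
  have hq2 : Q / c₄ ≤ q := le_add_of_nonneg_left (by positivity)
  refine ⟨Real.sqrt q, Real.sqrt_nonneg _, fun X ψ hψ hc => ?_⟩
  set v := (eLpNorm (S.curlSubGrad X ψ) 2 volume).toReal with hv
  set d := (eLpNorm (S.divDensity X) 2 volume).toReal with hd
  have hv0 : 0 ≤ v := ENNReal.toReal_nonneg
  have hd0 : 0 ≤ d := ENNReal.toReal_nonneg
  have hVm := memLp_curlSubGrad (S := S) X hψ hc
  have hDm := memLp_divDensity (S := S) X
  have hWm : MemLp (fun x => S.curl X x - grad ψ x) 2 volume :=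
    (memLp_curl X).sub (memLp_grad hψ hc)
  have hw : (eLpNorm (fun x => S.curl X x - grad ψ x) 2 volume).toReal ≤ K₁ * v := by
    have := ENNReal.toReal_mono (ENNReal.mul_ne_top ENNReal.ofReal_ne_top hVm.2.ne)
      (eLpNorm_le_mul_eLpNorm_of_ae_le_mul (μ := volume)
        (Eventually.of_forall fun x => h₁ X ψ x) 2)
    rwa [ENNReal.toReal_mul, ENNReal.toReal_ofReal hK₁] at this
  have hW : ∫ x, S.sqrtDet x * S.ip x (S.curl X x - grad ψ x) (S.curl X x - grad ψ x)
      ≤ K₂ * (K₁ * K₁) * v ^ 2 := by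
    refine (le_abs_self _).trans ((h₂ _ _ hWm hWm).trans ?_)
    have := mul_le_mul hw hw ENNReal.toReal_nonneg (by positivity)
    calc _ ≤ K₂ * (K₁ * v * (K₁ * v)) := mul_le_mul_of_nonneg_left this hK₂
      _ = _ := by ring
  have hT : ∫ x, S.sqrtDet x * (S.trace x (S.covDeriv X x) * S.trace x (S.covDeriv X x))
      ≤ a⁻¹ * d ^ 2 := by
    rw [hd, toReal_eLpNorm_sq hDm, ← integral_const_mul]
    refine integral_mono_of_nonneg (Eventually.of_forall fun x =>
      mul_nonneg (S.sqrtDet_pos x).le (mul_self_nonneg _))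
      (((memLp_two_iff_integrable_sq_norm hDm.1).1 hDm).const_mul _)
      (Eventually.of_forall fun x => ?_)
    simp only [divDensity, Real.norm_eq_abs, sq_abs]
    rw [inv_mul_eq_div, le_div_iff₀ ha]
    have := mul_le_mul_of_nonneg_left (hab x).1
      (mul_nonneg (S.sqrtDet_pos x).le (mul_self_nonneg (S.trace x (S.covDeriv X x))))
    refine this.trans (le_of_eq ?_)
    ring
  have hform := form_coercive hr hδ (Or.inr rfl : (-1 : ℝ) = 1 ∨ (-1 : ℝ) = -1)
    (memLp_covDeriv (S := S) X) (InitialSurface.memLp_weighted hr X) (hardy_test_real hr hC X)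
  have hid := form_add_grad_eq (S := S) X hψ hc
  have hG := h₃ _ (memLp_covDeriv (S := S) X)
  have hg := h₄ _ (memLp_grad hψ hc)
  have hGn : 0 ≤ S.normSq₂ (S.covDeriv X) := normSq₂_nonneg _
  have hgn : 0 ≤ ∫ x, S.sqrtDet x * S.ip x (grad ψ x) (grad ψ x) :=
    integral_nonneg fun x => mul_nonneg (S.sqrtDet_pos x).le (S.ip_nonneg x _)
  have hκn := mul_nonneg hpos.le hGn
  have hvd : K₂ * (K₁ * K₁) * v ^ 2 + a⁻¹ * d ^ 2 ≤ Q * (v + d) ^ 2 := by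
    have e1 : v ^ 2 ≤ (v + d) ^ 2 := pow_le_pow_left₀ hv0 (le_add_of_nonneg_right hd0) 2
    have e2 : d ^ 2 ≤ (v + d) ^ 2 := pow_le_pow_left₀ hd0 (le_add_of_nonneg_left hv0) 2
    have e3 := mul_le_mul_of_nonneg_left e1 (by positivity : 0 ≤ K₂ * (K₁ * K₁))
    have e4 := mul_le_mul_of_nonneg_left e2 (by positivity : 0 ≤ a⁻¹)
    rw [hQ, add_mul]
    exact add_le_add e3 e4
  have fin : ∀ {s k : ℝ}, 0 < k → 0 ≤ s → k * s ^ 2 ≤ Q * (v + d) ^ 2 → Q / k ≤ q →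
      s ≤ Real.sqrt q * (v + d) := by
    intro s k hk hs h hkq
    refine le_of_sq_le_sq ?_ (by positivity)
    rw [mul_pow, Real.sq_sqrt (by positivity)]
    refine le_trans ?_ (mul_le_mul_of_nonneg_right hkq (sq_nonneg _))
    rw [div_mul_eq_mul_div, le_div_iff₀ hk, mul_comm]
    exact h
  refine ⟨fin (k := κ * c₃) (by positivity) ENNReal.toReal_nonneg ?_ hq1,
    fin hc₄ ENNReal.toReal_nonneg ?_ hq2⟩
  · have := mul_le_mul_of_nonneg_left hG hpos.le
    rw [mul_assoc]
    linarith
  · linarith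

end InitialSurface

theorem memLp_mul_of_hasCompactSupport {φ u : Chart → ℝ} (hφ : Continuous φ)
    (hc : HasCompactSupport φ) (hu : MemLp u 2 volume) : MemLp (fun x => φ x * u x) 2 volume := by
  obtain ⟨K, hK⟩ := hφ.bounded_above_of_compact_support hc
  refine hu.of_le_mul (c := K) (hφ.aestronglyMeasurable.mul hu.1) (Eventually.of_forall fun x => ?_)
  rw [norm_mul]
  exact mul_le_mul_of_nonneg_right (hK x) (norm_nonneg _)

theorem integrable_mul_of_hasCompactSupport {φ u : Chart → ℝ} (hφ : Continuous φ)
    (hc : HasCompactSupport φ) (hu : MemLp u 2 volume) : Integrable fun x => φ x * u x :=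
  (hu.locallyIntegrable one_le_two).integrable_smul_left_of_hasCompactSupport hφ hc

theorem memLp_apply {B : Chart → Cov} (hB : MemLp B 2 volume) (l : Fin 3) :
    MemLp (fun x => B x l) 2 volume :=
  hB.of_le ((continuous_apply l).comp_aestronglyMeasurable hB.1)
    (Eventually.of_forall fun x => norm_le_pi_norm (B x) l)

theorem TendstoL2.pi {f : ℕ → Chart → Cov} {g : Chart → Cov}
    (h : ∀ k, TendstoL2 (fun n x => f n x k) fun x => g x k)
    (hf : ∀ n, AEStronglyMeasurable (f n - g) volume) : TendstoL2 f g := by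
  have hs := tendsto_finsetSum Finset.univ fun k _ => h k
  simp only [Finset.sum_const_zero] at hs
  refine tendsto_of_tendsto_of_tendsto_of_le_of_le tendsto_const_nhds hs (fun _ => zero_le)
    fun n => ?_
  have hm : ∀ k, AEStronglyMeasurable (fun x => ‖(f n - g) x k‖) volume := fun k =>
    ((continuous_apply k).comp_aestronglyMeasurable (hf n)).norm
  refine (eLpNorm_mono_real (g := fun x => ∑ k, ‖(f n - g) x k‖) fun x => ?_).trans ?_
  · refine (pi_norm_le_iff_of_nonneg (Finset.sum_nonneg fun k _ => norm_nonneg _)).2 fun k => ?_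
    exact Finset.single_le_sum (f := fun k => ‖(f n - g) x k‖) (fun k _ => norm_nonneg _)
      (Finset.mem_univ k)
  · have := eLpNorm_sum_le (μ := volume) (p := 2) (s := Finset.univ)
      (f := fun k x => ‖(f n - g) x k‖) (fun k _ => hm k) one_le_two
    rw [Finset.sum_fn] at this
    refine this.trans (le_of_eq (Finset.sum_congr rfl fun k _ => ?_))
    rw [eLpNorm_norm]
    rfl

theorem IsMollifier.tendsto_mul {η : ℕ → Chart → ℝ} {M : ℝ} (hη : IsMollifier η M)
    {u e : Chart → ℝ} (hu : MemLp u 2 volume) {R : ℝ} (hR : ∀ x, R < ‖x‖ → u x = 0)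
    (he : Continuous e) :
    TendstoL2 (fun n x => e x * moll (η n) u x) fun x => e x * u x := by
  obtain ⟨χ, hχ, hχc, hχ1⟩ := exists_cutoff (R + 1)
  obtain ⟨K, hK⟩ := (hχ.continuous.mul he).bounded_above_of_compact_support hχc.mul_right
  refine (hη.tendstoL2 hu).of_le K fun n => Eventually.of_forall fun x => ?_
  rw [← mul_sub, norm_mul]
  rcases le_or_gt ‖x‖ (R + 1) with hx | hx
  · have := hK x
    rw [Pi.mul_apply, hχ1 x hx, one_mul] at this
    exact mul_le_mul_of_nonneg_right this (norm_nonneg _)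
  · simp [hη.moll_eq_zero hR n hx, hR x (by linarith)]

namespace InitialSurface

variable {S : InitialSurface} {r : Chart → ℝ}

variable (S) in
/-- The density `√h h^{ij}`. -/
noncomputable def dens (i j : Fin 3) (x : Chart) : ℝ := S.sqrtDet x * S.hinv x i j

variable (S) in
theorem contDiff_dens (i j : Fin 3) : ContDiff ℝ 1 (S.dens i j) :=
  (S.contDiff_sqrtDet.mul (S.contDiff_hinv i j)).of_le (by norm_num)

theorem pd_single {φ : Chart → ℝ} (k j l : Fin 3) (x : Chart) :
    pd j (fun y => (Pi.single k (φ y) : Cov) l) x = if l = k then pd j φ x else 0 := by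
  split_ifs with h
  · subst h; simp
  · simp only [Pi.single_eq_of_ne h]; exact pd_const 0

/-- Testing with `φ dx^k` extracts the `k`-th scalar equation of the system, in which only partial
derivatives of `φ` and of `√h h^{ik}` remain. -/
theorem sqrtDet_mul_hodge_single {φ : Chart → ℝ} (hφ : ContDiff ℝ ∞ φ) (k : Fin 3) (a : Cov)
    (s : ℝ) (x : Chart) :
    S.sqrtDet x * (S.ip x a (S.curl (fun y => Pi.single k (φ y)) x)
        + s * S.trace x (S.covDeriv (fun y => Pi.single k (φ y)) x))
      = ∑ i, ∑ j, perm i j k * (a i * pd j φ x)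
        + s * ∑ i, (pd i (S.dens i k) x * φ x + S.dens i k x * pd i φ x) := by
  have hX : ContDiff ℝ ∞ fun y => (Pi.single k (φ y) : Cov) := by
    refine contDiff_pi.2 fun l => ?_
    by_cases h : l = k
    · subst h; simpa using hφ
    · simp only [Pi.single_eq_of_ne h]; exact contDiff_const
  rw [mul_add, sqrtDet_mul_ip_curl, mul_left_comm, sqrtDet_mul_trace_covDeriv hX]
  congr 1
  · simp [pd_single]
  · congr 1
    refine Finset.sum_congr rfl fun i _ => ?_
    rw [← pd_mul ((S.contDiff_dens i k).differentiable one_ne_zero x)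
      (hφ.differentiable (by simp) x)]
    congr 1; funext y
    simp [raise, dens, Pi.single_apply]
    ring

/-! ### Localisation of weak solutions and their approximation by test data. -/

section Approximation

variable {B : Chart → Cov} {f : Chart → ℝ}

variable (S) in
/-- The commutator of a cutoff function and the first order system. -/
noncomputable def cutoffCurl (B : Chart → Cov) (f χ : Chart → ℝ) (x : Chart) : Cov := fun k =>
  -(∑ i, ∑ j, perm i j k * (B x i * pd j χ x) + ∑ i, S.dens i k x * (f x * pd i χ x))

variable (S) in
/-- The commutator of a cutoff function and the divergence. -/
noncomputable def cutoffDiv (B : Chart → Cov) (χ : Chart → ℝ) (x : Chart) : ℝ :=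
  ∑ l, ∑ j, S.dens l j x * (B x l * pd j χ x)

theorem memLp_cutoffDiv (hB : MemLp B 2 volume) {χ : Chart → ℝ} (hχ : ContDiff ℝ ∞ χ)
    (hχc : HasCompactSupport χ) : MemLp (S.cutoffDiv B χ) 2 volume := by
  have hχd := fun i => continuous_pd (i := i) (contDiff_infty.1 hχ 1)
  refine memLp_finsetSum _ fun l _ => memLp_finsetSum _ fun j _ => ?_
  refine (memLp_mul_of_hasCompactSupport ((S.contDiff_dens l j).continuous.mul (hχd j))
    (hχc.pd (i := j)).mul_left (memLp_apply hB l)).ae_eq (Eventually.of_forall fun x => ?_)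
  simp only [Pi.mul_apply]; ring

theorem memLp_cutoffCurl (hB : MemLp B 2 volume) (hf : MemLp f 2 volume) {χ : Chart → ℝ}
    (hχ : ContDiff ℝ ∞ χ) (hχc : HasCompactSupport χ) (k : Fin 3) :
    MemLp (fun x => S.cutoffCurl B f χ x k) 2 volume := by
  have hχd := fun i => continuous_pd (i := i) (contDiff_infty.1 hχ 1)
  refine MemLp.neg (MemLp.add (memLp_finsetSum _ fun i _ => memLp_finsetSum _ fun j _ => ?_)
    (memLp_finsetSum _ fun i _ => ?_))
  · refine (memLp_mul_of_hasCompactSupport ((hχd j).const_mul (perm i j k))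
      (hχc.pd (i := j)).mul_left (memLp_apply hB i)).ae_eq (Eventually.of_forall fun x => ?_)
    ring
  · refine (memLp_mul_of_hasCompactSupport ((S.contDiff_dens i k).continuous.mul (hχd i))
      (hχc.pd (i := i)).mul_left hf).ae_eq (Eventually.of_forall fun x => ?_)
    simp only [Pi.mul_apply]; ring

/-- The weak equation for `B` is tested with `χψ`; the product rule moves the term in `dχ` to the
right. -/
theorem weak_div (hB : MemLp B 2 volume)
    (h2 : ∀ ψ : Chart → ℝ, ContDiff ℝ ∞ ψ → HasCompactSupport ψ →
      ∫ x, S.sqrtDet x * S.ip x (B x) (grad ψ x) = 0)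
    {χ : Chart → ℝ} (hχ : ContDiff ℝ ∞ χ) (hχc : HasCompactSupport χ) :
    MemLp (fun x => -S.cutoffDiv B χ x) 2 volume ∧
    ∀ ψ : Chart → ℝ, ContDiff ℝ ∞ ψ → HasCompactSupport ψ →
      ∫ x, ∑ l, ∑ i, S.dens l i x * (χ x * B x l) * pd i ψ x
        = ∫ x, -S.cutoffDiv B χ x * ψ x := by
  have hg : MemLp (fun x => -S.cutoffDiv B χ x) 2 volume := (memLp_cutoffDiv hB hχ hχc).neg
  refine ⟨hg, fun ψ hψ hψc => ?_⟩
  have hψd := fun i => continuous_pd (i := i) (contDiff_infty.1 hψ 1)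
  have iA : Integrable fun x => ∑ l, ∑ i, S.dens l i x * (χ x * B x l) * pd i ψ x := by
    refine integrable_finsetSum _ fun l _ => integrable_finsetSum _ fun i _ => ?_
    refine (integrable_mul_of_hasCompactSupport (((S.contDiff_dens l i).continuous.mul
      hχ.continuous).mul (hψd i)) (hψc.pd (i := i)).mul_left (memLp_apply hB l)).congr
      (Eventually.of_forall fun x => ?_)
    simp only [Pi.mul_apply]; ring
  have iB : Integrable fun x => -S.cutoffDiv B χ x * ψ x :=
    (integrable_mul_of_hasCompactSupport hψ.continuous hψc hg).congr
      (Eventually.of_forall fun x => mul_comm _ _)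
  rw [← sub_eq_zero, ← integral_sub iA iB]
  rw [← h2 (fun x => χ x * ψ x) (hχ.mul hψ) hχc.mul_right]
  congr 1; funext x
  have e : ∀ i, grad (fun x => χ x * ψ x) x i = pd i χ x * ψ x + χ x * pd i ψ x := fun i =>
    pd_mul (hχ.differentiable (by simp) x) (hψ.differentiable (by simp) x)
  simp only [ip, e, cutoffDiv, neg_mul, sub_neg_eq_add, Finset.mul_sum, Finset.sum_mul,
    ← Finset.sum_add_distrib]
  refine Finset.sum_congr rfl fun i _ => Finset.sum_congr rfl fun j _ => ?_
  rw [dens]; ring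

/-- The system is tested with `χψ dx^k`. Besides the terms in `dχ`, the right side receives a zeroth
order term from the derivatives of `√h h^{ik}`, since the left is written in divergence form. -/
theorem weak_curl (hB : MemLp B 2 volume) (hf : MemLp f 2 volume)
    (h1 : ∀ X : testForms, ∫ x, S.sqrtDet x * (S.ip x (B x) (S.curl X x)
      + f x * S.trace x (S.covDeriv X x)) = 0)
    {χ : Chart → ℝ} (hχ : ContDiff ℝ ∞ χ) (hχc : HasCompactSupport χ) (k : Fin 3) :
    MemLp (fun x => S.cutoffCurl B f χ x k - (∑ i, pd i (S.dens i k) x) * (χ x * f x)) 2 volume ∧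
    ∀ ψ : Chart → ℝ, ContDiff ℝ ∞ ψ → HasCompactSupport ψ →
      ∫ x, ((∑ i, ∑ j, perm i j k * (χ x * B x i) * pd j ψ x)
          + ∑ i, S.dens i k x * (χ x * f x) * pd i ψ x)
        = ∫ x, (S.cutoffCurl B f χ x k - (∑ i, pd i (S.dens i k) x) * (χ x * f x)) * ψ x := by
  have hdd := fun i => continuous_pd (i := i) (S.contDiff_dens i k)
  have hg : MemLp (fun x => S.cutoffCurl B f χ x k
      - (∑ i, pd i (S.dens i k) x) * (χ x * f x)) 2 volume := by
    refine (memLp_cutoffCurl hB hf hχ hχc k).sub ?_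
    refine (memLp_mul_of_hasCompactSupport ((continuous_finsetSum Finset.univ
      fun i _ => hdd i).mul hχ.continuous) hχc.mul_left hf).ae_eq (Eventually.of_forall fun x => ?_)
    simp only [Pi.mul_apply]; ring
  refine ⟨hg, fun ψ hψ hψc => ?_⟩
  have hψd := fun i => continuous_pd (i := i) (contDiff_infty.1 hψ 1)
  have iA : Integrable fun x => (∑ i, ∑ j, perm i j k * (χ x * B x i) * pd j ψ x)
      + ∑ i, S.dens i k x * (χ x * f x) * pd i ψ x := by
    refine Integrable.add (integrable_finsetSum _ fun i _ => integrable_finsetSum _ fun j _ => ?_)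
      (integrable_finsetSum _ fun i _ => ?_)
    · refine (integrable_mul_of_hasCompactSupport ((hχ.continuous.const_mul (perm i j k)).mul
        (hψd j)) (hψc.pd (i := j)).mul_left (memLp_apply hB i)).congr
        (Eventually.of_forall fun x => ?_)
      simp only [Pi.mul_apply]; ring
    · refine (integrable_mul_of_hasCompactSupport (((S.contDiff_dens i k).continuous.mul
        hχ.continuous).mul (hψd i)) (hψc.pd (i := i)).mul_left hf).congr
        (Eventually.of_forall fun x => ?_)
      simp only [Pi.mul_apply]; ring
  have iB : Integrable fun x => (S.cutoffCurl B f χ x k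
      - (∑ i, pd i (S.dens i k) x) * (χ x * f x)) * ψ x :=
    (integrable_mul_of_hasCompactSupport hψ.continuous hψc hg).congr
      (Eventually.of_forall fun x => mul_comm _ _)
  have hφ : ContDiff ℝ ∞ fun x => χ x * ψ x := hχ.mul hψ
  have hX : (fun y => Pi.single k (χ y * ψ y) : Chart → Cov) ∈ testForms := by
    refine ⟨contDiff_pi.2 fun l => ?_, hasCompactSupport_of_zero hχc fun x hx => by simp [hx]⟩
    by_cases h : l = k
    · subst h; simpa using hφ
    · simp only [Pi.single_eq_of_ne h]; exact contDiff_const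
  rw [← sub_eq_zero, ← integral_sub iA iB, ← h1 ⟨_, hX⟩]
  congr 1; funext x
  rw [sqrtDet_mul_hodge_single hφ]
  have e : ∀ i, pd i (fun x => χ x * ψ x) x = pd i χ x * ψ x + χ x * pd i ψ x := fun i =>
    pd_mul (hχ.differentiable (by simp) x) (hψ.differentiable (by simp) x)
  simp only [e, cutoffCurl, Fin.sum_univ_three]
  ring

end Approximation

end InitialSurface

namespace InitialSurface

variable {S : InitialSurface} {r : Chart → ℝ}

section Approximation

variable {B : Chart → Cov} {f : Chart → ℝ}

/-- The components of `χB` and `χf` are mollified in the chart. By Friedrichs' lemma the weak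
equations hold strongly in the `L²` limit, although the coefficients are merely `C¹`. -/
theorem exists_approximation (hB : MemLp B 2 volume) (hf : MemLp f 2 volume)
    (h1 : ∀ X : testForms, ∫ x, S.sqrtDet x * (S.ip x (B x) (S.curl X x)
      + f x * S.trace x (S.covDeriv X x)) = 0)
    (h2 : ∀ ψ : Chart → ℝ, ContDiff ℝ ∞ ψ → HasCompactSupport ψ →
      ∫ x, S.sqrtDet x * S.ip x (B x) (grad ψ x) = 0)
    {χ : Chart → ℝ} (hχ : ContDiff ℝ ∞ χ) (hχc : HasCompactSupport χ) :
    ∃ (X : ℕ → testForms) (ψ : ℕ → Chart → ℝ), (∀ n, ContDiff ℝ ∞ (ψ n)) ∧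
      (∀ n, HasCompactSupport (ψ n)) ∧
      TendstoL2 (fun n => (X n : Chart → Cov)) (fun x => χ x • B x) ∧
      TendstoL2 ψ (fun x => χ x * f x) ∧
      TendstoL2 (fun n => S.curlSubGrad (X n) (ψ n)) (S.cutoffCurl B f χ) ∧
      TendstoL2 (fun n => S.divDensity (X n)) (S.cutoffDiv B χ) := by
  obtain ⟨η, M, hη⟩ := exists_isMollifier
  obtain ⟨R, hR⟩ := hχc.isCompact.isBounded.subset_closedBall 0
  have hχ0 : ∀ x, R < ‖x‖ → χ x = 0 := fun x hx =>
    image_eq_zero_of_notMem_tsupport fun h => by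
      have := hR h
      rw [mem_closedBall_zero_iff] at this
      exact absurd hx (not_lt.2 this)
  set b : Fin 3 → Chart → ℝ := fun l y => χ y * B y l with hb
  set φ : Chart → ℝ := fun y => χ y * f y with hφ
  have hbL : ∀ l, MemLp (b l) 2 volume := fun l =>
    memLp_mul_of_hasCompactSupport hχ.continuous hχc (memLp_apply hB l)
  have hφL : MemLp φ 2 volume := memLp_mul_of_hasCompactSupport hχ.continuous hχc hf
  have hb0 : ∀ l x, R < ‖x‖ → b l x = 0 := fun l x hx => by simp [hb, hχ0 x hx]
  have hφ0 : ∀ x, R < ‖x‖ → φ x = 0 := fun x hx => by simp [hφ, hχ0 x hx]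
  have sm : ∀ {u : Chart → ℝ}, MemLp u 2 volume → ∀ n, ContDiff ℝ ∞ (moll (η n) u) :=
    fun hu n => contDiff_moll (hη.contDiff n) (hη.hasCompactSupport n)
      (hu.locallyIntegrable one_le_two)
  have cs : ∀ {u : Chart → ℝ}, (∀ x, R < ‖x‖ → u x = 0) → ∀ n,
      HasCompactSupport (moll (η n) u) := fun hu n =>
    hasCompactSupport_moll (hη.hasCompactSupport n) (hasCompactSupport_of_norm hu)
  have hXm : ∀ n, (fun x l => moll (η n) (b l) x : Chart → Cov) ∈ testForms := fun n =>
    ⟨contDiff_pi.2 fun l => sm (hbL l) n, hasCompactSupport_of_norm (R := R + 1) fun x hx =>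
      funext fun l => hη.moll_eq_zero (hb0 l) n hx⟩
  set X : ℕ → testForms := fun n => ⟨_, hXm n⟩ with hX
  have hXa : ∀ n x l, (X n : Chart → Cov) x l = moll (η n) (b l) x := fun n x l => rfl
  have hXs := fun n => testForms_contDiff (X n)
  have hψs := fun n => sm hφL n
  have dX : ∀ n l x, DifferentiableAt ℝ (moll (η n) (b l)) x := fun n l x =>
    (sm (hbL l) n).differentiable (by simp) x
  have dψ : ∀ n x, DifferentiableAt ℝ (moll (η n) φ) x := fun n x =>
    (sm hφL n).differentiable (by simp) x
  have hχBm : AEStronglyMeasurable (fun x => χ x • B x) volume :=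
    hχ.continuous.aestronglyMeasurable.smul hB.1
  refine ⟨X, fun n => moll (η n) φ, fun n => hψs n, fun n => cs hφ0 n, ?_, hη.tendstoL2 hφL, ?_, ?_⟩
  · refine TendstoL2.pi (fun k => ?_) fun n => (hXs n).continuous.aestronglyMeasurable.sub hχBm
    exact hη.tendstoL2 (hbL k)
  · refine TendstoL2.pi (fun k => ?_) fun n =>
      (continuous_curlSubGrad (hXs n) (hψs n)).aestronglyMeasurable.sub
        (aemeasurable_pi_iff.2 fun k => (memLp_cutoffCurl hB hf hχ hχc k).1.aemeasurable).aestronglyMeasurable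
    have hw := weak_curl hB hf h1 hχ hχc k
    set e : Chart → ℝ := fun x => ∑ i, pd i (S.dens i k) x with he
    have hec : Continuous e :=
      continuous_finsetSum Finset.univ fun i _ => continuous_pd (S.contDiff_dens i k)
    -- The `k`-th equation is a scalar equation in four unknowns: `none` indexes `χf` and `some l`
    -- the component `l` of `χB`.
    have hd := hη.tendsto_divergence (ι := Option (Fin 3)) (R := R)
      (u := fun α => α.elim φ b) (c := fun α i => α.elim (S.dens i k) fun l _ => perm l i k)
      (fun α => by cases α with
        | none => exact hφL
        | some l => exact hbL l)
      (fun α => by cases α with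
        | none => exact hφ0
        | some l => exact hb0 l)
      (fun α i => by cases α with
        | none => exact S.contDiff_dens i k
        | some l => exact contDiff_const)
      hw.1 (fun ψ hψ hψc => by
        rw [← hw.2 ψ hψ hψc]
        congr 1; funext x
        simp only [Fintype.sum_option, Option.elim]
        rw [add_comm])
    -- The divergence form contains the zeroth order term `e · (η ⋆ χf)`, absent from `curlSubGrad`;
    -- adding it back cancels its counterpart in the limit.
    have hm := hη.tendsto_mul hφL hφ0 hec
    have hsum := hm.add hd.neg (fun n => (hec.mul (hψs n).continuous).aestronglyMeasurable.sub
      (hec.aestronglyMeasurable.mul hφL.1)) (fun n => ?_)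
    · refine Tendsto.congr (fun n => ?_) hsum
      congr 1; funext x
      simp only [Pi.sub_apply]
      congr 1
      · simp only [Fintype.sum_option, Option.elim]
        have e1 : ∀ l i, pd i (fun y => perm l i k * moll (η n) (b l) y) x
            = perm l i k * pd i (moll (η n) (b l)) x := fun l i => pd_const_mul _ (dX n l x)
        have e2 : ∀ i, pd i (fun y => S.dens i k y * moll (η n) φ y) x
            = pd i (S.dens i k) x * moll (η n) φ x + S.dens i k x * pd i (moll (η n) φ) x :=
          fun i => pd_mul ((S.contDiff_dens i k).differentiable one_ne_zero x) (dψ n x)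
        have h3 : alt (S.covDeriv (X n) x) k
            = -∑ l, ∑ i, perm l i k * pd i (moll (η n) (b l)) x := by
          rw [alt_covDeriv, Finset.sum_comm, ← Finset.sum_neg_distrib]
          refine Finset.sum_congr rfl fun l _ => ?_
          rw [← Finset.sum_neg_distrib]
          refine Finset.sum_congr rfl fun i _ => ?_
          simp only [hXa, perm]; ring
        have h4 : S.sqrtDet x * S.raise x (grad (moll (η n) φ) x) k
            = ∑ i, S.dens i k x * pd i (moll (η n) φ) x := by
          rw [raise, Finset.mul_sum]
          refine Finset.sum_congr rfl fun i _ => ?_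
          rw [dens, S.hinv_symm x k i, grad]; ring
        simp only [e1, e2, curlSubGrad, h3, h4, Finset.sum_add_distrib, ← Finset.sum_mul, he]
        ring
      · ring
    · have hE : Continuous fun x => ∑ α : Option (Fin 3), ∑ i, pd i (fun y =>
          α.elim (S.dens i k) (fun l _ => perm l i k) y * moll (η n) (α.elim φ b) y) x := by
        refine continuous_finsetSum _ fun α _ => continuous_finsetSum _ fun i _ => continuous_pd ?_
        cases α with
        | none => exact (S.contDiff_dens i k).mul (contDiff_infty.1 (hψs n) 1)
        | some l => exact contDiff_const.mul (contDiff_infty.1 (sm (hbL l) n) 1)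
      exact hE.neg.aestronglyMeasurable.sub hw.1.1.neg.neg
  · have hw := weak_div hB h2 hχ hχc
    have hd := hη.tendsto_divergence (ι := Fin 3) (R := R) (u := b) (c := S.dens) hbL hb0
      S.contDiff_dens hw.1 hw.2
    simp only [neg_neg] at hd
    refine Tendsto.congr (fun n => ?_) hd
    congr 1; funext x
    simp only [Pi.sub_apply]
    congr 1
    rw [divDensity, sqrtDet_mul_trace_covDeriv (hXs n), Finset.sum_comm]
    refine Finset.sum_congr rfl fun i _ => ?_
    rw [← pd_sum]
    · congr 1; funext y
      simp only [raise, dens, hXa, Finset.mul_sum]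
      refine Finset.sum_congr rfl fun l _ => ?_
      rw [S.hinv_symm y i l]; ring
    · intro l _
      exact ((S.contDiff_dens l i).differentiable one_ne_zero x).mul (dX n l x)

end Approximation

end InitialSurface

/-! ### Vanishing of square integrable solutions of the elliptic system. -/

theorem eLpNorm_le_eLpNorm_sub_add {E : Type*} [NormedAddCommGroup E] {a b : Chart → E} (ha : AEStronglyMeasurable a volume)
    (hb : AEStronglyMeasurable b volume) :
    eLpNorm a 2 volume ≤ eLpNorm (a - b) 2 volume + eLpNorm b 2 volume := by
  have := eLpNorm_add_le (ha.sub hb) hb (one_le_two : (1 : ℝ≥0∞) ≤ 2)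
  rwa [sub_add_cancel] at this

section

variable {E E₁ E₂ : Type*} [NormedAddCommGroup E] [NormedSpace ℝ E] [NormedAddCommGroup E₁]
  [NormedAddCommGroup E₂]

/-- An a priori estimate along an approximating sequence survives in the limit; a weight bounded by
one preserves `L²` convergence. -/
theorem TendstoL2.eLpNorm_smul_le {f : ℕ → Chart → E} {g : Chart → E} {V : ℕ → Chart → E₁}
    {v : Chart → E₁} {D : ℕ → Chart → E₂} {d : Chart → E₂} {w : Chart → ℝ} {K : ℝ}
    (hf : TendstoL2 f g) (hV : TendstoL2 V v) (hD : TendstoL2 D d)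
    (hfm : ∀ n, AEStronglyMeasurable (f n) volume) (hg : AEStronglyMeasurable g volume)
    (hVm : ∀ n, AEStronglyMeasurable (V n) volume) (hv : AEStronglyMeasurable v volume)
    (hDm : ∀ n, AEStronglyMeasurable (D n) volume) (hd : AEStronglyMeasurable d volume)
    (hw : AEStronglyMeasurable w volume) (hw1 : ∀ x, |w x| ≤ 1)
    (h : ∀ n, eLpNorm (fun x => w x • f n x) 2 volume
      ≤ ENNReal.ofReal K * (eLpNorm (V n) 2 volume + eLpNorm (D n) 2 volume)) :
    eLpNorm (fun x => w x • g x) 2 volume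
      ≤ ENNReal.ofReal K * (eLpNorm v 2 volume + eLpNorm d 2 volume) := by
  have hlim : Tendsto (fun n => eLpNorm (f n - g) 2 volume + ENNReal.ofReal K *
      ((eLpNorm (V n - v) 2 volume + eLpNorm v 2 volume)
        + (eLpNorm (D n - d) 2 volume + eLpNorm d 2 volume))) atTop
      (𝓝 (0 + ENNReal.ofReal K * ((0 + eLpNorm v 2 volume) + (0 + eLpNorm d 2 volume)))) :=
    Tendsto.add hf (ENNReal.Tendsto.const_mul ((Tendsto.add hV tendsto_const_nhds).add
      (Tendsto.add hD tendsto_const_nhds)) (Or.inr ENNReal.ofReal_ne_top))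
  simp only [zero_add] at hlim
  refine ge_of_tendsto' hlim fun n => ?_
  refine (eLpNorm_le_eLpNorm_sub_add (a := fun x => w x • g x) (b := fun x => w x • f n x) (hw.smul hg)
    (hw.smul (hfm n))).trans ?_
  refine add_le_add ?_ ((h n).trans ?_)
  · rw [eLpNorm_sub_comm]
    refine eLpNorm_mono fun x => ?_
    change ‖w x • f n x - w x • g x‖ ≤ ‖f n x - g x‖
    rw [← smul_sub, norm_smul]
    exact mul_le_of_le_one_left (norm_nonneg _) (hw1 x)
  · exact mul_le_mul' le_rfl (add_le_add (eLpNorm_le_eLpNorm_sub_add (hVm n) hv)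
      (eLpNorm_le_eLpNorm_sub_add (hDm n) hd))

end

theorem ENNReal.le_ofReal_mul_add {a b d : ℝ≥0∞} {K : ℝ} (hK : 0 ≤ K) (ha : a ≠ ⊤) (hb : b ≠ ⊤)
    (hd : d ≠ ⊤) (h : a.toReal ≤ K * (b.toReal + d.toReal)) :
    a ≤ ENNReal.ofReal K * (b + d) := by
  rw [← ENNReal.ofReal_toReal ha, ← ENNReal.ofReal_toReal (ENNReal.add_ne_top.2 ⟨hb, hd⟩),
    ← ENNReal.ofReal_mul hK, ENNReal.toReal_add hb hd]
  exact ENNReal.ofReal_le_ofReal h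

theorem exists_cutoff_sequence : ∃ (χ : ℕ → Chart → ℝ) (K : ℝ), 0 ≤ K ∧
    (∀ n, ContDiff ℝ ∞ (χ n)) ∧ (∀ n, HasCompactSupport (χ n)) ∧
    (∀ n i x, |pd i (χ n) x| ≤ K / ((n : ℝ) + 1)) ∧
    ∀ x, Tendsto (fun n => χ n x) atTop (𝓝 1) := by
  obtain ⟨χ, hχ, hχc, hχ1⟩ := exists_cutoff 1
  have hχd := fun i => continuous_pd (i := i) (contDiff_infty.1 hχ 1)
  choose D hD using fun i => (hχd i).bounded_above_of_compact_support (hχc.pd (i := i))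
  have hD0 : ∀ i, 0 ≤ D i := fun i => (norm_nonneg _).trans (hD i 0)
  have hpos : ∀ n : ℕ, (0 : ℝ) < (n : ℝ) + 1 := fun n => by positivity
  refine ⟨fun n x => χ (((n : ℝ) + 1)⁻¹ • x), ∑ i, D i, Finset.sum_nonneg fun i _ => hD0 i,
    fun n => hχ.comp (contDiff_const_smul _),
    fun n => hχc.comp_smul (inv_ne_zero (hpos n).ne'), fun n i x => ?_, fun x => ?_⟩
  · rw [pd_comp_smul (hχ.differentiable (by simp)), abs_mul, abs_of_pos (inv_pos.2 (hpos n)),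
      inv_mul_eq_div]
    gcongr
    exact (hD i _).trans (Finset.single_le_sum (fun j _ => hD0 j) (Finset.mem_univ i))
  · refine tendsto_const_nhds.congr' ?_
    obtain ⟨N, hN⟩ := exists_nat_gt ‖x‖
    filter_upwards [eventually_ge_atTop N] with n hn
    refine (hχ1 _ ?_).symm
    rw [norm_smul, norm_inv, Real.norm_of_nonneg (hpos n).le, inv_mul_le_one₀ (hpos n)]
    have : (N : ℝ) ≤ n := by exact_mod_cast hn
    linarith

/-- Lower semicontinuity of the `L²` norm under pointwise convergence: `w g` has norm zero and `w`
never vanishes. -/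
theorem ae_eq_zero_of_tendsto_cutoff {E : Type*} [NormedAddCommGroup E] [NormedSpace ℝ E]
    {g : Chart → E} {w : Chart → ℝ} {χ : ℕ → Chart → ℝ} (hg : AEStronglyMeasurable g volume)
    (hw : Continuous w) (hw0 : ∀ x, w x ≠ 0) (hχ : ∀ n, Continuous (χ n))
    (hlim : ∀ x, Tendsto (fun n => χ n x) atTop (𝓝 1))
    (h : Tendsto (fun n => eLpNorm (fun x => w x • χ n x • g x) 2 (volume : Measure Chart)) atTop
      (𝓝 0)) : g =ᵐ[volume] 0 := by
  have hwg : AEStronglyMeasurable (fun x => w x • g x) volume := hw.aestronglyMeasurable.smul hg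
  have h1 := Lp.eLpNorm_lim_le_liminf_eLpNorm (p := 2) (μ := (volume : Measure Chart))
    (f := fun n x => w x • χ n x • g x)
    (fun n => hw.aestronglyMeasurable.smul ((hχ n).aestronglyMeasurable.smul hg))
    (fun x => w x • g x) (Eventually.of_forall fun x => by
      have := ((hlim x).smul_const (g x)).const_smul (w x)
      rwa [one_smul] at this)
  rw [h.liminf_eq, nonpos_iff_eq_zero, eLpNorm_eq_zero_iff hwg two_ne_zero] at h1
  filter_upwards [h1] with x hx
  exact (smul_eq_zero.1 hx).resolve_left (hw0 x)

theorem hardy_functions_eLpNorm {ψ : Chart → ℝ} (hψ : ContDiff ℝ ∞ ψ) (hc : HasCompactSupport ψ) :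
    eLpNorm (fun x => (1 + ‖x‖)⁻¹ • ψ x) 2 volume
      ≤ ENNReal.ofReal 6 * eLpNorm (InitialSurface.grad ψ) 2 volume := by
  refine (ENNReal.pow_le_pow_left_iff two_ne_zero).1 ?_
  rw [mul_pow, eLpNorm_two_sq, eLpNorm_two_sq, ← ENNReal.ofReal_pow (by norm_num)]
  have h := InitialSurface.hardy_functions 0 hψ hc
  refine le_trans (lintegral_mono_ae ?_) (h.trans (le_of_eq ?_))
  · filter_upwards [(Set.countable_singleton (0 : Chart)).ae_notMem volume] with x hx
    have hx0 : 0 < ‖x‖ := norm_pos_iff.2 hx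
    refine ENNReal.ofReal_le_ofReal ?_
    rw [norm_smul, norm_inv, mul_pow, Real.norm_of_nonneg (by positivity), inv_pow, sub_zero,
      inv_mul_eq_div, Real.norm_eq_abs, sq_abs]
    gcongr
    linarith
  · congr 1; norm_num

namespace InitialSurface

variable {S : InitialSurface} {r : Chart → ℝ} {B : Chart → Cov} {f : Chart → ℝ}

theorem abs_perm_le (i j k : Fin 3) : |perm i j k| ≤ 1 := by
  fin_cases i <;> fin_cases j <;> fin_cases k <;> norm_num [perm]

/-- Combines `exists_approximation`, the energy estimate and Hardy. The weights `(1 + r)⁻¹` and `(1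
+ |x|)⁻¹` replace `r⁻¹` and `|x|⁻¹`: they are smaller, so Hardy still applies, and bounded by one,
so the limit can be taken. -/
theorem exists_cutoff_estimate {C : ℝ} (hr : S.IsRadius r) (hC : C ∈ S.hardyConstants r)
    (hlt : ENNReal.ofReal C * S.curvatureSize r < 1) (hB : MemLp B 2 volume)
    (hf : MemLp f 2 volume)
    (h1 : ∀ X : testForms, ∫ x, S.sqrtDet x * (S.ip x (B x) (S.curl X x)
      + f x * S.trace x (S.covDeriv X x)) = 0)
    (h2 : ∀ ψ : Chart → ℝ, ContDiff ℝ ∞ ψ → HasCompactSupport ψ →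
      ∫ x, S.sqrtDet x * S.ip x (B x) (grad ψ x) = 0) :
    ∃ K : ℝ, ∀ χ : Chart → ℝ, ContDiff ℝ ∞ χ → HasCompactSupport χ →
      eLpNorm (fun x => (1 + r x)⁻¹ • χ x • B x) 2 volume ≤ ENNReal.ofReal K *
        (eLpNorm (S.cutoffCurl B f χ) 2 volume + eLpNorm (S.cutoffDiv B χ) 2 volume) ∧
      eLpNorm (fun x => (1 + ‖x‖)⁻¹ • χ x • f x) 2 volume ≤ ENNReal.ofReal K *
        (eLpNorm (S.cutoffCurl B f χ) 2 volume + eLpNorm (S.cutoffDiv B χ) 2 volume) := by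
  obtain ⟨K₁, hK₁, h₁⟩ := exists_energy_estimate hr hC hlt
  obtain ⟨K₂, h₂⟩ := exists_hardy_eLpNorm hr
  have hm : (0 : ℝ) ≤ max K₂ 6 := le_max_of_le_right (by norm_num)
  refine ⟨max K₂ 6 * K₁, fun χ hχ hχc => ?_⟩
  obtain ⟨X, ψ, hψ, hψc, l1, l2, l3, l4⟩ := exists_approximation hB hf h1 h2 hχ hχc
  have e := fun n => h₁ (X n) (ψ n) (hψ n) (hψc n)
  have mV := fun n => memLp_curlSubGrad (S := S) (X n) (hψ n) (hψc n)
  have mD := fun n => memLp_divDensity (S := S) (X n)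
  have hχm := hχ.continuous.aestronglyMeasurable (μ := (volume : Measure Chart))
  have hcc : AEStronglyMeasurable (S.cutoffCurl B f χ) volume :=
    (aemeasurable_pi_iff.2 fun k =>
      (memLp_cutoffCurl hB hf hχ hχc k).1.aemeasurable).aestronglyMeasurable
  have hcd : AEStronglyMeasurable (S.cutoffDiv B χ) volume := (memLp_cutoffDiv hB hχ hχc).1
  constructor
  · refine l1.eLpNorm_smul_le l3 l4 (fun n => (memLp_testForm (X n)).1) (hχm.smul hB.1)
      (fun n => (mV n).1) hcc (fun n => (mD n).1) hcd ?_ (fun x => ?_) fun n => ?_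
    · exact ((continuous_const.add hr.continuous).inv₀ fun x =>
        (add_pos_of_pos_of_nonneg one_pos (hr.nonneg x)).ne').aestronglyMeasurable
    · have := hr.nonneg x
      rw [abs_of_nonneg (by positivity)]
      exact inv_le_one_of_one_le₀ (by linarith)
    · have a1 := ENNReal.le_ofReal_mul_add hK₁ (memLp_covDeriv (S := S) (X n)).2.ne (mV n).2.ne
        (mD n).2.ne (e n).1
      rw [ENNReal.ofReal_mul hm, mul_assoc]
      refine le_trans ?_ (mul_le_mul' (ENNReal.ofReal_le_ofReal (le_max_left K₂ 6)) a1)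
      refine le_trans (eLpNorm_mono_ae ?_) (h₂ (X n))
      filter_upwards [hr.ae_pos] with x hx
      rw [norm_smul, norm_smul, norm_inv, norm_inv, Real.norm_of_nonneg hx.le,
        Real.norm_of_nonneg (by positivity)]
      gcongr
      linarith
  · refine l2.eLpNorm_smul_le l3 l4 (fun n => (hψ n).continuous.aestronglyMeasurable)
      (hχm.smul hf.1) (fun n => (mV n).1) hcc (fun n => (mD n).1) hcd ?_ (fun x => ?_) fun n => ?_
    · exact ((continuous_const.add continuous_norm).inv₀ fun x =>
        (add_pos_of_pos_of_nonneg one_pos (norm_nonneg x)).ne').aestronglyMeasurable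
    · rw [abs_of_nonneg (by positivity)]
      exact inv_le_one_of_one_le₀ (by linarith [norm_nonneg x])
    · have a1 := ENNReal.le_ofReal_mul_add hK₁ (memLp_grad (hψ n) (hψc n)).2.ne (mV n).2.ne
        (mD n).2.ne (e n).2
      rw [ENNReal.ofReal_mul hm, mul_assoc]
      refine le_trans ?_ (mul_le_mul' (ENNReal.ofReal_le_ofReal (le_max_right K₂ 6)) a1)
      exact hardy_functions_eLpNorm (hψ n) (hψc n)

/-- Square integrable solutions of the homogeneous first order elliptic system vanish. -/
theorem ae_eq_zero_of_weak_solution {C : ℝ} (hr : S.IsRadius r) (hC : C ∈ S.hardyConstants r)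
    (hlt : ENNReal.ofReal C * S.curvatureSize r < 1) (hB : MemLp B 2 volume)
    (hf : MemLp f 2 volume)
    (h1 : ∀ X : testForms, ∫ x, S.sqrtDet x * (S.ip x (B x) (S.curl X x)
      + f x * S.trace x (S.covDeriv X x)) = 0)
    (h2 : ∀ ψ : Chart → ℝ, ContDiff ℝ ∞ ψ → HasCompactSupport ψ →
      ∫ x, S.sqrtDet x * S.ip x (B x) (grad ψ x) = 0) :
    B =ᵐ[volume] 0 ∧ f =ᵐ[volume] 0 := by
  obtain ⟨K, hK⟩ := exists_cutoff_estimate hr hC hlt hB hf h1 h2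
  obtain ⟨χ, D, hD0, hχ, hχc, hχd, hχ1⟩ := exists_cutoff_sequence
  obtain ⟨H, hH, hinv⟩ := S.exists_hinv_bound
  obtain ⟨a, b, -, hb, hab⟩ := S.exists_sqrtDet_bounds
  have hdens : ∀ i j x, |S.dens i j x| ≤ b * H := by
    intro i j x
    rw [dens, abs_mul, abs_of_pos (S.sqrtDet_pos x)]
    exact mul_le_mul (hab x).2 (hinv x i j) (abs_nonneg _) hb.le
  have hQ : MemLp (fun x => ‖B x‖ + ‖f x‖) 2 volume := hB.norm.add hf.norm
  have hcurl : ∀ n x, ‖S.cutoffCurl B f (χ n) x‖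
      ≤ (9 + 3 * (b * H)) * (D / ((n : ℝ) + 1)) * ‖‖B x‖ + ‖f x‖‖ := by
    intro n x
    have hd0 : 0 ≤ D / ((n : ℝ) + 1) := by positivity
    rw [Real.norm_of_nonneg (by positivity)]
    refine (pi_norm_le_iff_of_nonneg (by positivity)).2 fun k => ?_
    have t1 : |∑ i, ∑ j, perm i j k * (B x i * pd j (χ n) x)|
        ≤ 3 * (3 * (1 * (‖B x‖ * (D / ((n : ℝ) + 1))))) := by
      refine abs_sum_le fun i => abs_sum_le fun j => ?_
      rw [abs_mul, abs_mul]
      exact mul_le_mul (abs_perm_le i j k) (mul_le_mul (abs_cov_le _ i) (hχd n j x) (abs_nonneg _)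
        (norm_nonneg _)) (by positivity) zero_le_one
    have t2 : |∑ i, S.dens i k x * (f x * pd i (χ n) x)|
        ≤ 3 * (b * H * (‖f x‖ * (D / ((n : ℝ) + 1)))) := by
      refine abs_sum_le fun i => ?_
      rw [abs_mul, abs_mul]
      exact mul_le_mul (hdens i k x) (mul_le_mul le_rfl (hχd n i x) (abs_nonneg _)
        (norm_nonneg _)) (by positivity) (by positivity)
    rw [cutoffCurl, norm_neg, Real.norm_eq_abs]
    refine (abs_add_le _ _).trans ((add_le_add t1 t2).trans ?_)
    have p1 : 0 ≤ (b * H) * (D / ((n : ℝ) + 1)) * ‖B x‖ := by positivity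
    have p2 : 0 ≤ (D / ((n : ℝ) + 1)) * ‖f x‖ := by positivity
    linarith
  have hdiv : ∀ n x, ‖S.cutoffDiv B (χ n) x‖
      ≤ (9 * (b * H)) * (D / ((n : ℝ) + 1)) * ‖‖B x‖ + ‖f x‖‖ := by
    intro n x
    have hd0 : 0 ≤ D / ((n : ℝ) + 1) := by positivity
    rw [(Real.norm_of_nonneg (by positivity) : ‖‖B x‖ + ‖f x‖‖ = _)]
    have t1 : |∑ l, ∑ j, S.dens l j x * (B x l * pd j (χ n) x)|
        ≤ 3 * (3 * (b * H * (‖B x‖ * (D / ((n : ℝ) + 1))))) := by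
      refine abs_sum_le fun i => abs_sum_le fun j => ?_
      rw [abs_mul, abs_mul]
      exact mul_le_mul (hdens i j x) (mul_le_mul (abs_cov_le _ i) (hχd n j x) (abs_nonneg _)
        (norm_nonneg _)) (by positivity) (by positivity)
    rw [cutoffDiv, Real.norm_eq_abs]
    refine t1.trans ?_
    have p1 : 0 ≤ (b * H) * (D / ((n : ℝ) + 1)) * ‖f x‖ := by positivity
    linarith
  set Q := eLpNorm (fun x => ‖B x‖ + ‖f x‖) 2 volume
  -- Both commutators carry a derivative of the rescaled cutoff, of size `D/(n + 1)`, against the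
  -- fixed finite norm `Q` of `|B| + |f|`.
  have hlim : Tendsto (fun n => ENNReal.ofReal K * (eLpNorm (S.cutoffCurl B f (χ n)) 2 volume
      + eLpNorm (S.cutoffDiv B (χ n)) 2 volume)) atTop (𝓝 0) := by
    have base : ∀ c : ℝ, Tendsto (fun n : ℕ => ENNReal.ofReal (c * (D / ((n : ℝ) + 1))) * Q) atTop
        (𝓝 0) := by
      intro c
      have h3 : Tendsto (fun n : ℕ => c * (D / ((n : ℝ) + 1))) atTop (𝓝 0) := by
        have := (tendsto_one_div_add_atTop_nhds_zero_nat (𝕜 := ℝ)).const_mul (c * D)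
        rw [mul_zero] at this
        refine this.congr fun n => ?_
        ring
      have := ENNReal.Tendsto.mul_const (b := Q) (ENNReal.tendsto_ofReal h3) (Or.inr hQ.2.ne)
      rwa [ENNReal.ofReal_zero, zero_mul] at this
    have h4 := ENNReal.Tendsto.const_mul (a := ENNReal.ofReal K)
      ((base (9 + 3 * (b * H))).add (base (9 * (b * H)))) (Or.inr ENNReal.ofReal_ne_top)
    rw [add_zero, mul_zero] at h4
    refine tendsto_of_tendsto_of_tendsto_of_le_of_le tendsto_const_nhds h4 (fun _ => zero_le)
      fun n => ?_
    dsimp only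
    gcongr
    · exact eLpNorm_le_mul_eLpNorm_of_ae_le_mul (Eventually.of_forall (hcurl n)) 2
    · exact eLpNorm_le_mul_eLpNorm_of_ae_le_mul (Eventually.of_forall (hdiv n)) 2
  have hr1 : ∀ x, 1 + r x ≠ 0 := fun x =>
    (add_pos_of_pos_of_nonneg one_pos (hr.nonneg x)).ne'
  have hx1 : ∀ x : Chart, 1 + ‖x‖ ≠ 0 := fun x => by positivity
  constructor
  · refine ae_eq_zero_of_tendsto_cutoff hB.1 ((continuous_const.add hr.continuous).inv₀ hr1)
      (fun x => inv_ne_zero (hr1 x)) (fun n => (hχ n).continuous) hχ1 ?_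
    exact tendsto_of_tendsto_of_tendsto_of_le_of_le tendsto_const_nhds hlim (fun _ => zero_le)
      fun n => (hK _ (hχ n) (hχc n)).1
  · refine ae_eq_zero_of_tendsto_cutoff hf.1 ((continuous_const.add continuous_norm).inv₀ hx1)
      (fun x => inv_ne_zero (hx1 x)) (fun n => (hχ n).continuous) hχ1 ?_
    exact tendsto_of_tendsto_of_tendsto_of_le_of_le tendsto_const_nhds hlim (fun _ => zero_le)
      fun n => (hK _ (hχ n) (hχc n)).2

end InitialSurface

theorem Continuous.aestronglyMeasurable_comp_prodMk {E F : Type*} [NormedAddCommGroup E]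
    [SecondCountableTopology E] [TopologicalSpace F] {β : Chart → E → F}
    (hβ : Continuous fun p : Chart × E => β p.1 p.2) {f : Chart → E}
    (hf : AEStronglyMeasurable f volume) : AEStronglyMeasurable (fun x => β x (f x)) volume :=
  hβ.comp_aestronglyMeasurable (aestronglyMeasurable_id.prodMk hf)

namespace InitialSurface

variable {S : InitialSurface} {r : Chart → ℝ}

/-! ### Square integrable forms -/

theorem mem_L2_iff {B : FormField} : B ∈ S.L2 ↔ MemLp B 2 volume := by
  obtain ⟨c, K, hc, hK, h⟩ := S.exists_ip_bounds
  obtain ⟨c', K', hc', hK', h'⟩ := S.lintegral_vol_bounds hc hK h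
  have h1 := h' Set.univ MeasurableSet.univ B
  simp only [Measure.restrict_univ] at h1
  change ∫⁻ x, ENNReal.ofReal (S.ip x (B x) (B x)) ∂S.vol < ⊤ ↔ _
  constructor
  · intro h2
    refine ⟨B.aestronglyMeasurable, lt_top_iff_ne_top.2 fun h3 => ?_⟩
    have h4 := h1.1.trans_lt h2
    rw [h3, ENNReal.top_pow two_ne_zero, ENNReal.mul_top (by simpa using hc')] at h4
    exact lt_irrefl _ h4
  · intro h2
    exact h1.2.trans_lt (ENNReal.mul_lt_top ENNReal.ofReal_lt_top (ENNReal.pow_lt_top h2.2))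

theorem memLp_epsContract {G : Chart → Ten} (hG : MemLp G 2 volume) :
    MemLp (fun x => S.epsContract x (G x)) 2 volume := by
  obtain ⟨K, hK, h⟩ := S.bddBilin_eps.bound
  obtain ⟨c, d, hc, -, hcd⟩ := S.exists_ip_bounds
  obtain ⟨a, b, ha, -, hab⟩ := S.exists_sqrtDet_bounds
  have hc1 : Continuous fun z : Chart × Ten => S.epsContract z.1 z.2 := by
    refine continuous_pi fun i => ?_
    simp only [epsContract_eq]
    refine continuous_finsetSum _ fun l _ =>
      ((S.h_contDiff i l).continuous.comp continuous_fst).mul ?_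
    exact ((continuous_alt l).comp continuous_snd).div (S.continuous_sqrtDet.comp continuous_fst)
      fun z => (S.sqrtDet_pos z.1).ne'
  refine hG.of_le_mul (c := K / (a * c)) (hc1.aestronglyMeasurable_comp_prodMk hG.1) ?_
  filter_upwards [h] with x hx
  set w := S.epsContract x (G x) with hw
  have h1 := (le_abs_self _).trans (hx (G x) w)
  rw [← hw] at h1
  have h2 : a * (c * ‖w‖ ^ 2) ≤ S.sqrtDet x * S.ip x w w :=
    mul_le_mul (hab x).1 (hcd x w).1 (by positivity) (S.sqrtDet_pos x).le
  rcases (norm_nonneg w).eq_or_lt with h0 | h0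
  · rw [← h0]; positivity
  · rw [div_mul_eq_mul_div, le_div_iff₀ (by positivity)]
    refine le_of_mul_le_mul_right ?_ h0
    linarith

theorem memLp_trace {G : Chart → Ten} (hG : MemLp G 2 volume) :
    MemLp (fun x => S.trace x (G x)) 2 volume := by
  obtain ⟨K, hK, h⟩ := exists_abs_trace_le (S := S)
  have hc1 : Continuous fun z : Chart × Ten => S.trace z.1 z.2 := by
    have h1 := continuous_fst_hinv (S := S) (Y := Ten)
    unfold trace
    fun_prop
  exact hG.of_le_mul (hc1.aestronglyMeasurable_comp_prodMk hG.1) (Eventually.of_forall fun x => h x (G x))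

/-- Test forms with a single component reduce this to the fundamental lemma for the scalar functions
`√h a^k`; definiteness of `h⁻¹` concludes. -/
theorem ae_eq_zero_of_integral_ip {a : Chart → Cov} (ha : MemLp a 2 volume)
    (h : ∀ X : testForms, ∫ x, S.sqrtDet x * S.ip x (a x) ((X : Chart → Cov) x) = 0) :
    a =ᵐ[volume] 0 := by
  have hc : ∀ k, ∀ᵐ x, S.sqrtDet x * S.raise x (a x) k = 0 := by
    intro k
    have hl : LocallyIntegrable (fun x => S.sqrtDet x * S.raise x (a x) k) volume := by
      have e : (fun x => S.sqrtDet x * S.raise x (a x) k)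
          = fun x => ∑ j, a x j • (S.sqrtDet x * S.hinv x k j) := by
        funext x
        rw [raise, Finset.mul_sum]
        refine Finset.sum_congr rfl fun j _ => ?_
        rw [smul_eq_mul]; ring
      rw [e]
      exact locallyIntegrable_finsetSum _ fun j _ =>
        ((memLp_apply ha j).locallyIntegrable one_le_two).smul_continuous
          (S.continuous_sqrtDet.mul (S.continuous_hinv k j))
    refine ae_eq_zero_of_integral_contDiff_smul_eq_zero hl fun g hg hgc => ?_
    have hX : (fun y => Pi.single k (g y) : Chart → Cov) ∈ testForms := by
      refine ⟨contDiff_pi.2 fun l => ?_, hasCompactSupport_of_zero hgc fun x hx => by simp [hx]⟩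
      by_cases h : l = k
      · subst h; simpa using hg
      · simp only [Pi.single_eq_of_ne h]; exact contDiff_const
    rw [← h ⟨_, hX⟩]
    congr 1; funext x
    change g x • (S.sqrtDet x * S.raise x (a x) k) = S.sqrtDet x * S.ip x (a x) (Pi.single k (g x))
    rw [ip_symm, ip_eq_raise]
    simp [Pi.single_apply]
    ring
  filter_upwards [hc 0, hc 1, hc 2] with x h0 h1 h2
  have hr : ∀ k, S.raise x (a x) k = 0 := by
    have hs := (S.sqrtDet_pos x).ne'
    intro k
    fin_cases k
    · exact (mul_eq_zero.1 h0).resolve_left hs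
    · exact (mul_eq_zero.1 h1).resolve_left hs
    · exact (mul_eq_zero.1 h2).resolve_left hs
  by_contra hne
  have := S.ip_pos x hne
  rw [ip_eq_raise] at this
  simp [hr] at this

/-! ### Curl and divergence of elements of `Ḣ¹` -/

section H1

variable {A : FormField} {G : TensorField}

/-- The pairing is read as `A/r` against `rY`; since `rY` is bounded with compact support, weighted
convergence suffices. -/
theorem tendsto_integral_ip (hr : S.IsRadius r) {φ : ℕ → testForms} (hA : S.IsH1 A G)
    (h : S.TendstoH1 r φ A G) {Y : Chart → Cov} (hY : Continuous Y) (hc : HasCompactSupport Y) :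
    Tendsto (fun n => ∫ x, S.ip x ((φ n : Chart → Cov) x) (Y x) ∂S.vol) atTop
      (𝓝 (∫ x, S.ip x (A x) (Y x) ∂S.vol)) := by
  have hrY : MemLp (fun x => r x • Y x) 2 volume :=
    (hr.continuous.smul hY).memLp_of_hasCompactSupport hc.smul_left
  have e : ∀ Z : Chart → Cov, ∫ x, S.ip x (Z x) (Y x) ∂S.vol
      = ∫ x, S.sqrtDet x * S.ip x ((r x)⁻¹ • Z x) (r x • Y x) := by
    intro Z
    rw [integral_vol]
    refine integral_congr_ae ?_
    filter_upwards [hr.ae_pos] with x hx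
    rw [ip_smul_smul, inv_mul_cancel₀ hx.ne', one_mul]
  simp only [e]
  exact S.bddBilin_ip.tendsto_integral_left h.weighted
    (fun n => InitialSurface.memLp_weighted hr (φ n)) (hA.memLp_weighted hr) hrY

theorem IsH1.curlPairing_eq (hr : S.IsRadius r) (hA : S.IsH1 A G) (X : testForms) :
    S.curlPairing A X = ∫ x, S.sqrtDet x * S.ip x (S.epsContract x (G x)) ((X : Chart → Cov) x) := by
  obtain ⟨φ, hφ⟩ := (isH1_iff hr).1 hA
  have l1 := tendsto_integral_ip hr hA hφ (continuous_curl (S := S) (testForms_contDiff X))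
    (hasCompactSupport_curl (testForms_compact X))
  have l2 := S.bddBilin_eps.tendsto_integral_left hφ.deriv (fun n => memLp_covDeriv (S := S) (φ n))
    hA.memLp (memLp_testForm X)
  refine tendsto_nhds_unique l1 (l2.congr fun n => ?_)
  rw [integral_ip_curl_comm (testForms_contDiff (φ n)) (testForms_contDiff X)
    (Or.inr (testForms_compact X)), integral_vol]
  rfl

theorem IsH1.integral_ip_grad (hr : S.IsRadius r) (hA : S.IsH1 A G) {ψ : Chart → ℝ}
    (hψ : ContDiff ℝ ∞ ψ) (hψc : HasCompactSupport ψ) :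
    ∫ x, S.ip x (A x) (grad ψ x) ∂S.vol = -∫ x, S.sqrtDet x * (S.trace x (G x) * ψ x) := by
  obtain ⟨φ, hφ⟩ := (isH1_iff hr).1 hA
  have l1 := tendsto_integral_ip hr hA hφ (contDiff_grad hψ).continuous
    (hasCompactSupport_grad hψc)
  have l2 := S.bddBilin_trace.tendsto_integral_left hφ.deriv
    (fun n => memLp_covDeriv (S := S) (φ n)) hA.memLp
    (hψ.continuous.memLp_of_hasCompactSupport hψc)
  refine tendsto_nhds_unique l1 (l2.neg.congr fun n => ?_)
  rw [InitialSurface.integral_ip_grad (testForms_contDiff (φ n)) hψ (Or.inr hψc), integral_vol]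

/-- The identity `∇ · (∇ × A) = 0`, carried from test forms to `Ḣ¹`. -/
theorem IsH1.integral_eps_grad (hr : S.IsRadius r) (hA : S.IsH1 A G) {ψ : Chart → ℝ}
    (hψ : ContDiff ℝ ∞ ψ) (hψc : HasCompactSupport ψ) :
    ∫ x, S.sqrtDet x * S.ip x (S.epsContract x (G x)) (grad ψ x) = 0 := by
  obtain ⟨φ, hφ⟩ := (isH1_iff hr).1 hA
  have l2 := S.bddBilin_eps.tendsto_integral_left hφ.deriv (fun n => memLp_covDeriv (S := S) (φ n))
    hA.memLp (memLp_grad hψ hψc)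
  refine tendsto_nhds_unique l2 (tendsto_const_nhds.congr fun n => ?_)
  rw [← integral_ip_curl_grad (S := S) (testForms_contDiff (φ n)) hψ (testForms_compact (φ n)),
    integral_vol]
  rfl

/-- The integrated Weitzenböck identity, carried to `Ḣ¹` in the first argument: both sides are
continuous along an approximating sequence. -/
theorem IsH1.opPairing_eq (hr : S.IsRadius r) (hδ : S.curvatureSize r ≠ ⊤) (hA : S.IsH1 A G)
    (X : testForms) : S.opPairing (-1) A G X = ∫ x, S.sqrtDet x *
      (S.ip x (S.epsContract x (G x)) (S.curl X x)
        + S.trace x (G x) * S.trace x (S.covDeriv X x)) := by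
  obtain ⟨φ, hφ⟩ := (isH1_iff hr).1 hA
  have l1 := hA.tendsto_opPairing hr hδ (-1) hφ X
  have l2 := S.bddBilin_hodge.tendsto_integral_left hφ.deriv
    (fun n => memLp_covDeriv (S := S) (φ n)) hA.memLp (memLp_covDeriv (S := S) X)
  refine tendsto_nhds_unique l1 (l2.congr fun n => ?_)
  rw [integral_form_test (testForms_contDiff (φ n)) (testForms_contDiff X)
    (testForms_compact (φ n)), integral_vol]
  rfl

end H1

/-! ### Potentials -/

variable (S) in
/-- `A ∈ Ḣ¹` is divergence free and `∇ × A = B`. -/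
def IsPotential (B A : FormField) : Prop :=
  ∃ G, S.IsH1 A G ∧ (∀ᵐ x, S.epsContract x (G x) = B x) ∧ ∀ᵐ x, S.trace x (G x) = 0

section Potential

variable {A B : FormField} {G : TensorField}

theorem ae_epsContract_of_hasCurl (hr : S.IsRadius r) (hA : S.IsH1 A G) (hB : B ∈ S.L2)
    (h : S.HasCurl A B) : ∀ᵐ x, S.epsContract x (G x) = B x := by
  have h1 := memLp_epsContract (S := S) hA.memLp
  have h2 := mem_L2_iff.1 hB
  have := ae_eq_zero_of_integral_ip (S := S) (h1.sub h2) fun X => by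
    have e := h X
    rw [hA.curlPairing_eq hr, integral_vol] at e
    have i1 := S.bddBilin_ip.integrable h1 (memLp_testForm X)
    have i2 := S.bddBilin_ip.integrable h2 (memLp_testForm X)
    simp only [Pi.sub_apply, ip_sub_left, mul_sub]
    rw [integral_sub i1 i2, e, sub_self]
  filter_upwards [this] with x hx
  exact sub_eq_zero.1 hx

theorem hasCurl_of_ae_epsContract (hr : S.IsRadius r) (hA : S.IsH1 A G)
    (h : ∀ᵐ x, S.epsContract x (G x) = B x) : S.HasCurl A B := by
  intro X
  rw [hA.curlPairing_eq hr, integral_vol]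
  refine integral_congr_ae ?_
  filter_upwards [h] with x hx
  rw [hx]

theorem divFree_iff (hr : S.IsRadius r) (hA : S.IsH1 A G) :
    S.DivFree A ↔ ∀ᵐ x, S.trace x (G x) = 0 := by
  constructor
  · intro h
    have hl := (memLp_trace (S := S) hA.memLp).locallyIntegrable one_le_two
    have := ae_eq_zero_of_integral_contDiff_smul_eq_zero
      (hl.smul_continuous S.continuous_sqrtDet) fun ψ hψ hψc => by
        have e := h ψ hψ hψc
        change ∫ x, S.ip x (A x) (grad ψ x) ∂S.vol = 0 at e
        rw [hA.integral_ip_grad hr hψ hψc, neg_eq_zero] at e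
        rw [← e]
        congr 1; funext x
        simp only [smul_eq_mul]; ring
    filter_upwards [this] with x hx
    exact (smul_eq_zero.1 hx).resolve_right (S.sqrtDet_pos x).ne'
  · intro h ψ hψ hψc
    change ∫ x, S.ip x (A x) (grad ψ x) ∂S.vol = 0
    rw [hA.integral_ip_grad hr hψ hψc, neg_eq_zero]
    refine integral_eq_zero_of_ae ?_
    filter_upwards [h] with x hx
    simp [hx]

theorem IsPotential.hasCurl (hr : S.IsRadius r) (h : S.IsPotential B A) : S.HasCurl A B := by
  obtain ⟨G, hA, h1, -⟩ := h
  exact hasCurl_of_ae_epsContract hr hA h1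

theorem IsPotential.mem_L2div (hr : S.IsRadius r) (h : S.IsPotential B A) : B ∈ S.L2div := by
  obtain ⟨G, hA, h1, -⟩ := h
  refine ⟨mem_L2_iff.2 ((memLp_epsContract (S := S) hA.memLp).ae_eq h1), fun ψ hψ hψc => ?_⟩
  rw [integral_vol, ← hA.integral_eps_grad hr hψ hψc]
  refine integral_congr_ae ?_
  filter_upwards [h1] with x hx
  rw [hx]
  rfl

/-- Distributional curl and divergence of an `Ḣ¹` field are the contractions of its weak covariant
derivative, by the fundamental lemma. -/
theorem mem_H1Ccurl_iff (hr : S.IsRadius r) : A ∈ S.H1Ccurl ↔ ∃ B, S.IsPotential B A := by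
  constructor
  · rintro ⟨⟨G, hA⟩, hd, B, hB, hc⟩
    exact ⟨B, G, hA, ae_epsContract_of_hasCurl hr hA hB hc, (divFree_iff hr hA).1 hd⟩
  · rintro ⟨B, h⟩
    obtain ⟨G, hA, h1, h2⟩ := id h
    exact ⟨⟨G, hA⟩, (divFree_iff hr hA).2 h2, B, (h.mem_L2div hr).1, h.hasCurl hr⟩

theorem IsPotential.opPairing_eq (hr : S.IsRadius r) (hδ : S.curvatureSize r ≠ ⊤)
    (h : S.IsPotential B A) (hA : S.IsH1 A G) (X : testForms) :
    S.opPairing (-1) A G X = S.curlPairing B X := by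
  have h1 := ae_epsContract_of_hasCurl hr hA (h.mem_L2div hr).1 (h.hasCurl hr)
  have h2 := (divFree_iff hr hA).1 ((mem_H1Ccurl_iff hr).2 ⟨B, h⟩).2.1
  rw [hA.opPairing_eq hr hδ, curlPairing, integral_vol]
  refine integral_congr_ae ?_
  filter_upwards [h1, h2] with x hx1 hx2
  rw [hx1, hx2, zero_mul, add_zero]

theorem IsPotential.curl_unique (hr : S.IsRadius r) {B' : FormField} (h : S.IsPotential B A)
    (h' : S.IsPotential B' A) : B = B' := by
  obtain ⟨G, hA, h1, -⟩ := h
  have h2 := ae_epsContract_of_hasCurl hr hA (h'.mem_L2div hr).1 (h'.hasCurl hr)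
  refine AEEqFun.ext ?_
  filter_upwards [h1, h2] with x hx1 hx2
  rw [← hx1, hx2]

/-- The difference of two potentials is curl free and divergence free, so its Hodge form vanishes
and the trivial kernel of `P` applies. -/
theorem IsPotential.unique {C : ℝ} (hr : S.IsRadius r) (hC : C ∈ S.hardyConstants r)
    (hlt : ENNReal.ofReal C * S.curvatureSize r < 1) {A' : FormField} (h : S.IsPotential B A)
    (h' : S.IsPotential B A') : A = A' := by
  obtain ⟨G, hA, h1, h2⟩ := h
  obtain ⟨G', hA', h1', h2'⟩ := h'
  have hδ := curvatureSize_ne_top hr hC hlt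
  have hs := hA.sub hr hA'
  refine sub_eq_zero.1 (hs.eq_zero_of_opPairing hr hC hlt (Or.inr rfl) fun X => ?_)
  rw [hs.opPairing_eq hr hδ]
  refine integral_eq_zero_of_ae ?_
  filter_upwards [h1, h2, h1', h2', AEEqFun.coeFn_sub G G'] with x e1 e2 e1' e2' e3
  rw [e3, Pi.sub_apply, epsContract_sub, trace_sub, e1, e2, e1', e2']
  simp [ip]

/-- Solving `P A = ∇ × B` determines only the combination of curl and divergence seen by the Hodge
form. The elliptic system for the errors then shows that they vanish separately. -/
theorem exists_isPotential {C : ℝ} (hr : S.IsRadius r) (hC : C ∈ S.hardyConstants r)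
    (hlt : ENNReal.ofReal C * S.curvatureSize r < 1) (hB : B ∈ S.L2div) :
    ∃ A, S.IsPotential B A := by
  have hδ := curvatureSize_ne_top hr hC hlt
  have hBm := mem_L2_iff.1 hB.1
  have hint := fun X : testForms => S.bddBilin_ip.integrable hBm (memLp_curl (S := S) X)
  have hcurl : ∀ X : testForms, S.curlPairing B X
      = ∫ x, S.sqrtDet x * S.ip x (B x) (S.curl X x) := fun X => integral_vol S _
  let l : testForms →ₗ[ℝ] ℝ :=
    { toFun := fun X => S.curlPairing B X
      map_add' := fun X Y => by
        simp only [hcurl]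
        rw [← integral_add (hint X) (hint Y)]
        congr 1; funext x
        rw [← mul_add, S.ip_symm x (B x), S.ip_symm x (B x), S.ip_symm x (B x), ← ip_add_left]
        congr 2
        have := S.epsContract_sub x (S.covDeriv (X + Y : testForms) x) (S.covDeriv Y x)
        rw [covDeriv_add, add_sub_cancel_right] at this
        rw [curl, curl, curl, covDeriv_add, this, sub_add_cancel]
      map_smul' := fun c X => by
        simp only [hcurl, RingHom.id_apply, smul_eq_mul]
        rw [← integral_const_mul]
        congr 1; funext x
        simp only [curl, sqrtDet_mul_ip_epsContract, covDeriv_smul, alt, Finset.mul_sum,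
          Pi.smul_apply, smul_eq_mul]
        refine Finset.sum_congr rfl fun i _ => Finset.sum_congr rfl fun j _ =>
          Finset.sum_congr rfl fun k _ => by ring }
  -- The curl is bounded pointwise by `∇X`, so `B ∈ L²` makes `∇ × B` an element of `Ḣ⁻¹`.
  have hl : S.IsHMinus1 l := by
    obtain ⟨K, hK, h⟩ := S.bddBilin_eps.exists_integral_le
    obtain ⟨K', hK', h'⟩ := exists_eLpNorm_le_sqrt_normSq₂ (S := S)
    refine ⟨K * K' * (eLpNorm B 2 volume).toReal, fun X => ?_⟩
    have e1 := h _ _ (memLp_covDeriv (S := S) X) hBm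
    have e2 := h' _ (memLp_covDeriv (S := S) X)
    have e3 : l X = ∫ x, S.sqrtDet x * S.ip x (S.epsContract x (S.covDeriv X x)) (B x) := by
      change S.curlPairing B X = _
      rw [hcurl]
      congr 1; funext x
      rw [ip_symm]; rfl
    rw [e3]
    refine e1.trans ?_
    have e4 := mul_le_mul_of_nonneg_left (mul_le_mul_of_nonneg_right e2
      (ENNReal.toReal_nonneg (a := eLpNorm B 2 volume))) hK
    refine e4.trans (le_of_eq ?_)
    ring
  obtain ⟨A, G, hA, h⟩ := exists_isH1_opPairing_eq hr hC hlt (Or.inr rfl) hl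
  have hE := memLp_epsContract (S := S) hA.memLp
  have hT := memLp_trace (S := S) hA.memLp
  -- The errors `∇ × A - B` and `∇ · A` solve the homogeneous system: the first equation is `P A = ∇
  -- × B`, the second says that `∇ × A` and `B` are both divergence free.
  have hz := ae_eq_zero_of_weak_solution hr hC hlt (hE.sub hBm) hT (fun X => by
      have e := h X
      change _ = S.curlPairing B X at e
      rw [hA.opPairing_eq hr hδ, hcurl] at e
      have i1 : Integrable fun x => S.sqrtDet x * (S.ip x (S.epsContract x (G x)) (S.curl X x)
          + S.trace x (G x) * S.trace x (S.covDeriv X x)) :=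
        S.bddBilin_hodge.integrable hA.memLp (memLp_covDeriv (S := S) X)
      rw [← sub_eq_zero, ← integral_sub i1 (hint X)] at e
      rw [← e]
      congr 1; funext x
      rw [Pi.sub_apply, ip_sub_left]
      ring)
    (fun ψ hψ hψc => by
      have e1 := hA.integral_eps_grad hr hψ hψc
      have e2 : ∫ x, S.sqrtDet x * S.ip x (B x) (grad ψ x) = 0 := by
        rw [← integral_vol]; exact hB.2 ψ hψ hψc
      have i1 := S.bddBilin_ip.integrable hE (memLp_grad hψ hψc)
      have i2 := S.bddBilin_ip.integrable hBm (memLp_grad hψ hψc)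
      simp only [Pi.sub_apply, ip_sub_left, mul_sub]
      rw [integral_sub i1 i2, e1, e2, sub_zero])
  refine ⟨A, G, hA, ?_, hz.2⟩
  filter_upwards [hz.1] with x hx
  exact sub_eq_zero.1 hx

end Potential

end InitialSurface

namespace InitialSurface

variable {S : InitialSurface} {r : Chart → ℝ}

/-! ### The map `Int` -/

variable (S) in
theorem continuous_dotκ : Continuous fun z : Chart × Cov => S.dotκ z.1 z.2 := by
  refine continuous_pi fun i => ?_
  have h1 := continuous_fst_hinv (S := S) (Y := Cov)
  have h2 : ∀ i b, Continuous fun z : Chart × Cov => S.κ z.1 i b := fun i b =>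
    (S.κ_continuous i b).comp continuous_fst
  unfold dotκ raise
  fun_prop

/-- `A·κ` is the contraction of `A/r` with `rκ`, and `rκ` is bounded: `κ` is continuous and vanishes
outside the ball of radius `r₀`. -/
theorem memLp_dotκ (hr : S.IsRadius r) {A : Chart → Cov} (hA : AEStronglyMeasurable A volume)
    (h : MemLp (fun x => (r x)⁻¹ • A x) 2 volume) :
    MemLp (fun x => S.dotκ x (A x)) 2 volume := by
  obtain ⟨H, hH, hinv⟩ := S.exists_hinv_bound
  have hcs : ∀ i b, HasCompactSupport fun x => r x * S.κ x i b := fun i b =>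
    hasCompactSupport_of_norm (R := S.r₀) fun x hx => by
      rw [S.κ_schwarzschild x hx.le, Matrix.zero_apply, mul_zero]
  choose K hK using fun i b =>
    (hr.continuous.mul (S.κ_continuous i b)).bounded_above_of_compact_support (hcs i b)
  have hK0 : ∀ i b, 0 ≤ K i b := fun i b => (norm_nonneg _).trans (hK i b 0)
  set M := ∑ i, ∑ b, K i b with hM
  have hM0 : 0 ≤ M := Finset.sum_nonneg fun i _ => Finset.sum_nonneg fun b _ => hK0 i b
  have hKM : ∀ i b, K i b ≤ M := fun i b =>
    (Finset.single_le_sum (fun b _ => hK0 i b) (Finset.mem_univ b)).trans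
      (Finset.single_le_sum (f := fun i => ∑ b, K i b)
        (fun i _ => Finset.sum_nonneg fun b _ => hK0 i b) (Finset.mem_univ i))
  refine h.of_le_mul (c := 3 * (3 * H * M))
    (S.continuous_dotκ.aestronglyMeasurable_comp_prodMk hA) ?_
  filter_upwards [hr.ae_pos] with x hx
  set a := (r x)⁻¹ • A x with ha
  have hra : ∀ b, |S.raise x a b| ≤ 3 * (H * ‖a‖) := fun b => abs_sum_le fun j => by
    rw [abs_mul]
    exact mul_le_mul (hinv x b j) (abs_cov_le a j) (abs_nonneg _) hH.le
  refine (pi_norm_le_iff_of_nonneg (by positivity)).2 fun i => ?_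
  rw [Real.norm_eq_abs, dotκ]
  refine (abs_sum_le (M := 3 * (H * ‖a‖) * M) fun b => ?_).trans (le_of_eq (by ring))
  have e : S.raise x (A x) b * S.κ x i b = S.raise x a b * (r x * S.κ x i b) := by
    rw [ha, raise_smul]
    field_simp
  rw [e, abs_mul]
  exact mul_le_mul (hra b) ((hK i b x).trans (hKM i b)) (abs_nonneg _) (by positivity)

theorem divFree_congr {A A' : Chart → Cov} (h : A =ᵐ[volume] A') : S.DivFree A ↔ S.DivFree A' := by
  refine forall_congr' fun ψ => forall_congr' fun _ => forall_congr' fun _ => ?_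
  have e : ∫ x, S.ip x (A x) (fun i => pd i ψ x) ∂S.vol =
      ∫ x, S.ip x (A' x) (fun i => pd i ψ x) ∂S.vol :=
    integral_congr_ae (S.ae_vol_iff.2 (h.mono fun x hx => by simp only [hx]))
  rw [e]

variable (S) in
/-- The field `A·κ`. -/
noncomputable def dotκField (A : FormField) : FormField :=
  AEEqFun.mk (fun x => S.dotκ x (A x))
    (S.continuous_dotκ.aestronglyMeasurable_comp_prodMk A.aestronglyMeasurable)

theorem coeFn_dotκField (A : FormField) : ∀ᵐ x, S.dotκField A x = S.dotκ x (A x) :=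
  AEEqFun.coeFn_mk _ _

theorem dotκField_mem_L2 (hr : S.IsRadius r) {A : FormField} {G : TensorField} (h : S.IsH1 A G) :
    S.dotκField A ∈ S.L2 :=
  mem_L2_iff.2 ((memLp_dotκ hr A.aestronglyMeasurable (h.memLp_weighted hr)).ae_eq
    ((coeFn_dotκField A).mono fun _ hx => hx.symm))

theorem add_mem_L2 {A B : FormField} (hA : A ∈ S.L2) (hB : B ∈ S.L2) : A + B ∈ S.L2 :=
  mem_L2_iff.2 (((mem_L2_iff.1 hA).add (mem_L2_iff.1 hB)).ae_eq (AEEqFun.coeFn_add A B).symm)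

theorem sub_mem_L2 {A B : FormField} (hA : A ∈ S.L2) (hB : B ∈ S.L2) : A - B ∈ S.L2 :=
  mem_L2_iff.2 (((mem_L2_iff.1 hA).sub (mem_L2_iff.1 hB)).ae_eq (AEEqFun.coeFn_sub A B).symm)

open Classical in
variable (S) in
/-- The divergence-free potential of `B` in `Ḣ¹`. -/
noncomputable def potential (B : FormField) : FormField :=
  if h : ∃ A, S.IsPotential B A then h.choose else 0

variable (S) in
/-- The map `(B, E) ↦ (P⁻¹ (∇ × B), E + A⁽⁰⁾·κ)`. -/
noncomputable def intMap (a : FormField × FormField) : FormField × FormField :=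
  (S.potential a.1, a.2 + S.dotκField (S.potential a.1))

section IntMap

variable {C : ℝ}

theorem isPotential_potential (hr : S.IsRadius r) (hC : C ∈ S.hardyConstants r)
    (hlt : ENNReal.ofReal C * S.curvatureSize r < 1) {B : FormField} (hB : B ∈ S.L2div) :
    S.IsPotential B (S.potential B) := by
  have h := exists_isPotential hr hC hlt hB
  rw [potential, dif_pos h]
  exact h.choose_spec

/-- Injectivity: `B` is recovered as the curl of the potential, then `E` by subtraction.
Surjectivity: every element of the Coulomb space is the unique potential of its own curl, and `A·κ`
may be subtracted within `L²`. -/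
theorem bijOn_intMap (hr : S.IsRadius r) (hC : C ∈ S.hardyConstants r)
    (hlt : ENNReal.ofReal C * S.curvatureSize r < 1) :
    Set.BijOn S.intMap (S.L2div ×ˢ S.L2) (S.H1Ccurl ×ˢ S.L2) := by
  refine ⟨?_, ?_, ?_⟩
  · rintro ⟨B, E⟩ ⟨hB, hE⟩
    have h := isPotential_potential hr hC hlt hB
    obtain ⟨G, hA, -⟩ := id h
    exact ⟨(mem_H1Ccurl_iff hr).2 ⟨B, h⟩, add_mem_L2 hE (dotκField_mem_L2 hr hA)⟩
  · rintro ⟨B, E⟩ ⟨hB, hE⟩ ⟨B', E'⟩ ⟨hB', hE'⟩ he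
    have h := isPotential_potential hr hC hlt hB
    have h' := isPotential_potential hr hC hlt hB'
    simp only [intMap, Prod.mk.injEq] at he
    rw [← he.1] at h'
    have hBB := h.curl_unique hr h'
    subst hBB
    rw [add_left_injective _ |>.eq_iff] at he
    exact Prod.ext rfl he.2
  · rintro ⟨A, A₁⟩ ⟨hA, hA₁⟩
    obtain ⟨B, h⟩ := (mem_H1Ccurl_iff hr).1 hA
    obtain ⟨G, hG, -⟩ := id h
    have hB := h.mem_L2div hr
    have e : S.potential B = A := (isPotential_potential hr hC hlt hB).unique hr hC hlt h
    refine ⟨(B, A₁ - S.dotκField A), ⟨hB, sub_mem_L2 hA₁ (dotκField_mem_L2 hr hG)⟩, ?_⟩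
    simp only [intMap, e, sub_add_cancel]

theorem coeFn_intMap_snd (a : FormField × FormField) : ∀ᵐ x,
    (S.intMap a).2 x = a.2 x + S.dotκ x ((S.intMap a).1 x) := by
  filter_upwards [AEEqFun.coeFn_add a.2 (S.dotκField (S.potential a.1)),
    coeFn_dotκField (S := S) (S.potential a.1)] with x h1 h2
  rw [intMap, h1, Pi.add_apply, h2]

theorem divFree_intMap_iff (a : FormField × FormField) :
    S.DivFree (fun x => (S.intMap a).2 x - S.dotκ x ((S.intMap a).1 x)) ↔ S.DivFree a.2 := by
  refine divFree_congr ?_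
  filter_upwards [coeFn_intMap_snd a] with x hx
  rw [hx, add_sub_cancel_right]

/-- Since `A⁽¹⁾ - A⁽⁰⁾·κ` equals `E` almost everywhere, the two constraints correspond under the
bijection already obtained. -/
theorem bijOn_intMap_divFree (hr : S.IsRadius r) (hC : C ∈ S.hardyConstants r)
    (hlt : ENNReal.ofReal C * S.curvatureSize r < 1) :
    Set.BijOn S.intMap (S.L2div ×ˢ S.L2div)
      {a | a ∈ S.H1Ccurl ×ˢ S.L2 ∧ S.DivFree (fun x => a.2 x - S.dotκ x (a.1 x))} := by
  obtain ⟨h1, h2, h3⟩ := bijOn_intMap hr hC hlt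
  refine ⟨fun a ha => ⟨h1 (Set.mk_mem_prod ha.1 ha.2.1), (divFree_intMap_iff a).2 ha.2.2⟩,
    h2.mono fun a ha => Set.mk_mem_prod ha.1 ha.2.1, ?_⟩
  rintro b ⟨hb, hd⟩
  obtain ⟨a, ha, rfl⟩ := h3 hb
  exact ⟨a, ⟨ha.1, ha.2, (divFree_intMap_iff a).1 hd⟩, rfl⟩

end IntMap

end InitialSurface

theorem mainTheorem10 (S : InitialSurface) (r : Chart → ℝ) (hr : S.IsRadius r) :
    -- `C` is the best constant in Hardy's inequality on `Σ`, which exists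
    ∃ C : ℝ, IsLeast (S.hardyConstants r) C ∧
      (ENNReal.ofReal C * S.curvatureSize r < 1 →
        -- the operator `-Δ - R`, for either sign convention `R = σ Ric` of the curvature
        (0 < 1 - C * (S.curvatureSize r).toReal ∧
          ∀ σ : ℝ, (σ = 1 ∨ σ = -1) →
          -- it is a continuous map from `Ḣ¹` to the dual of `Ḣ¹`
          (∃ M : ℝ, ∀ A G A' G', S.IsH1 A G → S.IsH1 A' G' →
            Integrable (S.formDensity σ A G A' G') S.vol ∧
            |S.form σ A G A' G'| ≤ M * Real.sqrt (S.normSq₂ G) * Real.sqrt (S.normSq₂ G')) ∧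
          -- it is coercive
          (∀ A G, S.IsH1 A G →
            (1 - C * (S.curvatureSize r).toReal) * S.normSq₂ G ≤ S.form σ A G A G) ∧
          -- its kernel is trivial
          (∀ A G, S.IsH1 A G → (∀ X, S.opPairing σ A G X = 0) → A = 0) ∧
          -- it is onto `Ḣ⁻¹`
          (∀ ℓ, S.IsHMinus1 ℓ → ∃ A G, S.IsH1 A G ∧ ∀ X, S.opPairing σ A G X = ℓ X)) ∧
        -- the bijection `Int`
        ∃ Int : FormField × FormField → FormField × FormField,
          Set.BijOn Int (S.L2div ×ˢ S.L2) (S.H1Ccurl ×ˢ S.L2) ∧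
          -- divergence-free `E` correspond to `∇·(A⁽¹⁾ - A⁽⁰⁾·κ) = 0`
          Set.BijOn Int (S.L2div ×ˢ S.L2div)
            {a | a ∈ S.H1Ccurl ×ˢ S.L2 ∧ S.DivFree (fun x => a.2 x - S.dotκ x (a.1 x))} ∧
          ∀ B ∈ S.L2div, ∀ E ∈ S.L2,
            -- `A⁽⁰⁾` is the potential of `B`
            S.HasCurl (Int (B, E)).1 B ∧
            -- `A⁽⁰⁾ = P⁻¹ (∇ × B)` with `P = -Δ + Ric`
            (∀ G, S.IsH1 (Int (B, E)).1 G →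
              ∀ X, S.opPairing (-1) (Int (B, E)).1 G X = S.curlPairing B X) ∧
            -- `A⁽¹⁾ = E + A⁽⁰⁾·κ`
            ∀ᵐ x ∂S.vol, (Int (B, E)).2 x = E x + S.dotκ x ((Int (B, E)).1 x)) := by
  obtain ⟨C, hC⟩ := InitialSurface.exists_isLeast_hardyConstants hr
  refine ⟨C, hC, fun hlt => ?_⟩
  have hδ := InitialSurface.curvatureSize_ne_top hr hC.1 hlt
  refine ⟨⟨InitialSurface.one_sub_mul_pos hr hC.1 hlt, fun σ hσ => ⟨?_, ?_, ?_, ?_⟩⟩,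
    S.intMap, InitialSurface.bijOn_intMap hr hC.1 hlt,
    InitialSurface.bijOn_intMap_divFree hr hC.1 hlt, fun B hB E hE => ?_⟩
  · exact InitialSurface.exists_form_bound hr hδ σ
  · exact fun A G h => h.coercive hr hC.1 hδ hσ
  · exact fun A G h h0 => h.eq_zero_of_opPairing hr hC.1 hlt hσ h0
  · exact fun l hl => InitialSurface.exists_isH1_opPairing_eq hr hC.1 hlt hσ hl
  · have h := InitialSurface.isPotential_potential hr hC.1 hlt hB
    exact ⟨h.hasCurl hr, fun G hG X => h.opPairing_eq hr hδ hG X,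
      S.ae_vol_iff.2 (InitialSurface.coeFn_intMap_snd (B, E))⟩
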